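/- Let $\beta_0>0$ and $\alpha_0\in\mathbb R$, and put $\gamma_0=\alpha_0-\beta_0$. Let $L^2_r(0,1)$ denote the space of (complex-valued) functions on $(0,1)$ that are square integrable with respect to $r\,\mathrm dr$, and let $H^k_r(0,1)$ be the space of functions whose weak derivatives up to order $k$ lie in $L^2_r(0,1)$. Consider the Hilbert space $$X=\mathbb C\times\mathbb C\times H^1_r(0,1)\times L^2_r(0,1)\ni(\eta,\omega,\phi,\zeta)$$ and its subspace $Y$ of those $(\eta,\omega,\phi,\zeta)$ with $\phi\in H^2_r(0,1)$, $\phi_r/r\in L^2_r(0,1)$ and $\zeta\in H^1_r(0,1)$. With $w=\beta_0^{-1}\big(\omega-\int_0^1r^2\phi_r\,\mathrm dr\big)$ let $$K\begin{pmatrix}\eta\\ \omega\\ \phi\\ \zeta\end{pmatrix}=\begin{pmatrix}w\\ -2\int_0^1r\zeta\,\mathrm dr-2\eta+(\alpha_0-\beta_0)\eta\\ \zeta+2\eta\\ -\frac1r(r\phi_r)_r-2w\end{pmatrix},\qquad \mathcal D(K)=\{(\eta,\omega,\phi,\zeta)\in Y:\ \phi_r|_{r=1}+w=0\},$$ let $\mathrm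 dG:X\to X$ be the linear isomorphism $(\eta,\omega,\phi,\zeta)\mapsto\big(\eta,\ \int_0^1r^2\phi_r\,\mathrm dr,\ \phi+\tfrac12r^2w,\ \zeta\big)$, and let $L=\mathrm dG\,K\,\mathrm dG^{-1}$ with domain $\mathcal D(L)=\mathrm dG\,\mathcal D(K)$ (this is the linearisation at the origin of the spatial Hamiltonian evolution equation, in the variables in which its boundary condition is linear, for axisymmetric travelling waves on a ferrofluid jet). (i) The spectrum $\sigma(L)$ consists entirely of isolated eigenvalues of finite algebraic multiplicity (the algebraic multiplicity of $\lambda$ is the dimension of $\bigcup_n\ker(L-\lambda I)^n$). A complex number $\lambda$ is an eigenvalue of $L$ if and only if $$\lambda J_0(\lambda)=(\gamma_0-\beta_0\lambda^2)J_1(\lambda),$$ where $J_0$, $J_1$ are the Bessel functions of the first kind. In particular, $0$ is an eigenvalue of $L$, and $\sigma(L)\cap\mathrm i\mathbb R$ is a finite set. (ii) There exist real constants $C,s_0>0$ such that for each real number $s$ with $|s|>s_0$ the operator $L-\mathrm isI$ has a bounded inverse on $X$ and $$\|(L-\mathrm isI)^{-1}\|_{\mathcal L(X,X)}\le\frac C{|s|}.$$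 -/

import Mathlib

open MeasureTheory Set

noncomputable section

namespace FerroJet

/-! ### Weighted Lebesgue and Sobolev spaces on `(0,1)` -/

/-- The measure `r dr` on the interval `(0,1)`. -/
def rMeasure : Measure ℝ :=
  (volume.restrict (Ioo (0 : ℝ) 1)).withDensity fun r => ENNReal.ofReal r

/-- The (complexified) space `L²_r(0,1)`. -/
abbrev L2r : Type := Lp ℂ 2 rMeasure

instance instIsFiniteMeasureRMeasure : IsFiniteMeasure rMeasure := by
  refine isFiniteMeasure_withDensity (ne_of_lt ?_)
  calc ∫⁻ r in Ioo (0 : ℝ) 1, ENNReal.ofReal r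
      ≤ ∫⁻ _ in Ioo (0 : ℝ) 1, 1 := by
        refine setLIntegral_mono measurable_const fun r hr => ?_
        simpa using ENNReal.ofReal_le_ofReal hr.2.le
    _ < ⊤ := by simp

/-- `g` is the weak (distributional) derivative of `f` on `(0,1)`. -/
def IsWeakDeriv (f g : ℝ → ℂ) : Prop :=
  ∀ χ : ℝ → ℝ, ContDiff ℝ (⊤ : ℕ∞) χ → HasCompactSupport χ → tsupport χ ⊆ Ioo (0 : ℝ) 1 →
    ∫ r in Ioo (0 : ℝ) 1, deriv χ r • f r = -∫ r in Ioo (0 : ℝ) 1, χ r • g r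

theorem ae_rMeasure_iff {p : ℝ → Prop} :
    (∀ᵐ r ∂rMeasure, p r) ↔ ∀ᵐ r ∂(volume.restrict (Ioo (0 : ℝ) 1)), p r := by
  rw [rMeasure, ae_withDensity_iff (by fun_prop),
    ae_restrict_iff' measurableSet_Ioo, ae_restrict_iff' measurableSet_Ioo]
  refine ⟨fun h => ?_, fun h => ?_⟩
  · filter_upwards [h] with r hr hr'
    exact hr hr' (by simpa using hr'.1)
  · filter_upwards [h] with r hr hr' _
    exact hr hr'

/-- Elements of `L²_r(0,1)` are locally integrable on `(0,1)`. -/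
theorem integrableOn_compact (f : L2r) {k : Set ℝ} (hk : IsCompact k) (hs : k ⊆ Ioo (0 : ℝ) 1) :
    IntegrableOn (fun r => f r) k volume := by
  have hcont : ContinuousOn (fun r : ℝ => r⁻¹) k :=
    continuousOn_inv₀.mono fun r hr => (hs hr).1.ne'
  obtain ⟨C, hC⟩ := hk.exists_bound_of_continuousOn hcont
  have h1 : Integrable (fun r => f r) rMeasure := (Lp.memLp f).integrable (by norm_num)
  have h2 : Integrable (fun r => k.indicator (fun r : ℝ => r⁻¹) r • f r) rMeasure := by
    refine Integrable.bdd_smul (f := fun r => f r)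
      (φ := fun r => k.indicator (fun r : ℝ => r⁻¹) r) h1 (max C 0) ?_ ?_
    · exact (measurable_inv.indicator hk.measurableSet).aestronglyMeasurable
    · refine Filter.Eventually.of_forall fun r => ?_
      by_cases hr : r ∈ k
      · rw [indicator_of_mem hr]
        exact (hC r hr).trans (le_max_left _ _)
      · simp [indicator_of_notMem hr]
  unfold rMeasure at h2
  rw [integrable_withDensity_iff_integrable_smul' (by fun_prop) (by simp)] at h2
  have h3 := h2.mono_measure (Measure.restrict_mono hs le_rfl)
  refine h3.congr ?_
  filter_upwards [ae_restrict_mem hk.measurableSet] with r hr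
  have h0 : 0 < r := (hs hr).1
  simp only [indicator_of_mem hr, ENNReal.toReal_ofReal h0.le, smul_smul,
    mul_inv_cancel₀ h0.ne', one_smul]
  rfl

theorem integrable_test {χ : ℝ → ℝ} (hχ : Continuous χ) (hc : HasCompactSupport χ)
    (hs : tsupport χ ⊆ Ioo (0 : ℝ) 1) (f : L2r) :
    Integrable (fun r => χ r • f r) (volume.restrict (Ioo (0 : ℝ) 1)) := by
  have h1 : IntegrableOn (fun r => χ r • f r) (tsupport χ) volume :=
    (integrableOn_compact f hc hs).continuousOn_smul hχ.continuousOn hc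
  refine Integrable.mono_measure ?_ Measure.restrict_le_self
  refine (integrableOn_iff_integrable_of_support_subset ?_).1 h1
  intro r hr
  refine subset_tsupport _ fun h => hr ?_
  simp [h]

theorem integrable_test_deriv {χ : ℝ → ℝ} (hχ : ContDiff ℝ (⊤ : ℕ∞) χ) (hc : HasCompactSupport χ)
    (hs : tsupport χ ⊆ Ioo (0 : ℝ) 1) (f : L2r) :
    Integrable (fun r => deriv χ r • f r) (volume.restrict (Ioo (0 : ℝ) 1)) :=
  integrable_test (hχ.continuous_deriv (by simp)) hc.deriv
    ((closure_minimal support_deriv_subset (isClosed_tsupport χ)).trans hs) f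

theorem isWeakDeriv_congr {f f' g g' : ℝ → ℂ} (hf : f =ᵐ[rMeasure] f') (hg : g =ᵐ[rMeasure] g')
    (h : IsWeakDeriv f g) : IsWeakDeriv f' g' := by
  intro χ h1 h2 h3
  have hf' := ae_rMeasure_iff.1 hf
  have hg' := ae_rMeasure_iff.1 hg
  have e1 : ∫ r in Ioo (0 : ℝ) 1, deriv χ r • f' r = ∫ r in Ioo (0 : ℝ) 1, deriv χ r • f r :=
    integral_congr_ae (by filter_upwards [hf'] with r hr; rw [hr])
  have e2 : ∫ r in Ioo (0 : ℝ) 1, χ r • g' r = ∫ r in Ioo (0 : ℝ) 1, χ r • g r :=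
    integral_congr_ae (by filter_upwards [hg'] with r hr; rw [hr])
  rw [e1, e2]
  exact h χ h1 h2 h3

/-- The (complexified) space `H¹_r(0,1)` of functions in `L²_r(0,1)` with weak derivative in
`L²_r(0,1)`. An element is stored as the pair `(φ, φ_r)`, so that the norm is
`(‖φ‖² + ‖φ_r‖²)^(1/2)`. -/
def H1Sub : Submodule ℂ (WithLp 2 (L2r × L2r)) where
  carrier := {p | IsWeakDeriv p.fst p.snd}
  zero_mem' := by
    refine isWeakDeriv_congr (f := 0) (g := 0) (Lp.coeFn_zero _ _ _).symm
      (Lp.coeFn_zero _ _ _).symm fun χ _ _ _ => ?_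
    simp
  add_mem' := by
    intro p q hp hq
    refine isWeakDeriv_congr (Lp.coeFn_add p.fst q.fst).symm (Lp.coeFn_add p.snd q.snd).symm
      fun χ h1 h2 h3 => ?_
    simp only [Pi.add_apply, smul_add]
    rw [integral_add (integrable_test_deriv h1 h2 h3 _) (integrable_test_deriv h1 h2 h3 _),
      integral_add (integrable_test h1.continuous h2 h3 _)
        (integrable_test h1.continuous h2 h3 _), hp χ h1 h2 h3, hq χ h1 h2 h3]
    ring
  smul_mem' := by
    intro c p hp
    refine isWeakDeriv_congr (Lp.coeFn_smul c p.fst).symm (Lp.coeFn_smul c p.snd).symm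
      fun χ h1 h2 h3 => ?_
    simp only [Pi.smul_apply, smul_comm _ c]
    rw [integral_smul, integral_smul, hp χ h1 h2 h3, smul_neg]

/-- `H¹_r(0,1)` as a Hilbert space. -/
def H1r : Type := H1Sub

instance instNormedAddCommGroupH1r : NormedAddCommGroup H1r :=
  inferInstanceAs (NormedAddCommGroup H1Sub)

instance instInnerProductSpaceH1r : InnerProductSpace ℂ H1r :=
  inferInstanceAs (InnerProductSpace ℂ H1Sub)

/-- The inclusion `φ ↦ φ` of `H¹_r(0,1)` into `L²_r(0,1)`. -/
def H1r.val : H1r →ₗ[ℂ] L2r where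
  toFun p := p.1.fst
  map_add' _ _ := rfl
  map_smul' _ _ := rfl

/-- The weak derivative `φ ↦ φ_r` from `H¹_r(0,1)` to `L²_r(0,1)`. -/
def H1r.der : H1r →ₗ[ℂ] L2r where
  toFun p := p.1.snd
  map_add' _ _ := rfl
  map_smul' _ _ := rfl

/-- Weak derivatives are unique. -/
theorem H1r.val_injective : Function.Injective H1r.val := by
  rw [← LinearMap.ker_eq_bot, LinearMap.ker_eq_bot']
  intro p hp
  have hp1 : p.1.fst = 0 := hp
  have hw : IsWeakDeriv 0 p.1.snd := by
    refine isWeakDeriv_congr ?_ Filter.EventuallyEq.rfl p.2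
    rw [hp1]
    exact Lp.coeFn_zero _ _ _
  have hloc : LocallyIntegrableOn (fun r => p.1.snd r) (Ioo (0 : ℝ) 1) volume := by
    exact (locallyIntegrableOn_iff isOpen_Ioo.isLocallyClosed).2 fun k hk hkc =>
      integrableOn_compact _ hkc hk
  have h0 := isOpen_Ioo.ae_eq_zero_of_integral_contDiff_smul_eq_zero hloc fun χ h1 h2 h3 => by
    have h4 := hw χ h1 h2 h3
    simp only [Pi.zero_apply, smul_zero, integral_zero, zero_eq_neg] at h4
    rw [← h4, setIntegral_eq_integral_of_forall_compl_eq_zero]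
    intro x hx
    rw [image_eq_zero_of_notMem_tsupport fun h => hx (h3 h), zero_smul]
  have h5 : p.1.snd = 0 := by
    refine Lp.ext ?_
    filter_upwards [Lp.coeFn_zero ℂ 2 rMeasure,
      ae_rMeasure_iff.2 ((ae_restrict_iff' measurableSet_Ioo).2 h0)] with r h6 h7
    rw [h6, h7, Pi.zero_apply]
  exact Subtype.ext (WithLp.ofLp_injective 2 (Prod.ext hp1 h5))

/-- A function in `L²_r(0,1)` that has a weak derivative in `L²_r(0,1)`, as an element of
`H¹_r(0,1)`. -/
def H1r.lift : LinearMap.range H1r.val ≃ₗ[ℂ] H1r :=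
  (LinearEquiv.ofInjective H1r.val H1r.val_injective).symm

theorem isWeakDeriv_of_hasDerivAt {f g : ℝ → ℂ} (hf : ∀ r, HasDerivAt f (g r) r)
    (hg : Continuous g) : IsWeakDeriv f g := by
  intro χ h1 h2 h3
  have hχ0 : χ 0 = 0 := image_eq_zero_of_notMem_tsupport fun h => lt_irrefl _ (h3 h).1
  have hχ1 : χ 1 = 0 := image_eq_zero_of_notMem_tsupport fun h => lt_irrefl _ (h3 h).2
  have hd : Continuous (deriv χ) := h1.continuous_deriv (by simp)
  have hfc : Continuous f := continuous_iff_continuousAt.2 fun r => (hf r).continuousAt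
  have key := intervalIntegral.integral_eq_sub_of_hasDerivAt (a := 0) (b := 1)
    (f := fun r => χ r • f r) (f' := fun r => χ r • g r + deriv χ r • f r)
    (fun r _ => ((h1.differentiable (by simp)) r).hasDerivAt.smul (hf r))
    (((h1.continuous.smul hg).add (hd.smul hfc)).intervalIntegrable _ _)
  rw [intervalIntegral.integral_add (f := fun r => χ r • g r) (g := fun r => deriv χ r • f r)
    ((h1.continuous.smul hg).intervalIntegrable _ _)
    ((hd.smul hfc).intervalIntegrable _ _), hχ0, hχ1, zero_smul, zero_smul, sub_zero,
    intervalIntegral.integral_of_le zero_le_one, intervalIntegral.integral_of_le zero_le_one,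
    integral_Ioc_eq_integral_Ioo, integral_Ioc_eq_integral_Ioo] at key
  exact eq_neg_of_add_eq_zero_right key

theorem memLp_of_continuous {f : ℝ → ℂ} (hf : Continuous f) : MemLp f 2 rMeasure := by
  obtain ⟨C, hC⟩ := (isCompact_Icc (a := (0 : ℝ)) (b := 1)).exists_bound_of_continuousOn
    hf.continuousOn
  refine MemLp.of_bound hf.aestronglyMeasurable C (ae_rMeasure_iff.2 ?_)
  filter_upwards [ae_restrict_mem measurableSet_Ioo] with r hr
  exact hC r (Ioo_subset_Icc_self hr)

/-- A `C¹` function on the line, restricted to `(0,1)`, as an element of `H¹_r(0,1)`. -/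
def H1r.ofC1 (f g : ℝ → ℂ) (hf : ∀ r, HasDerivAt f (g r) r) (hg : Continuous g) : H1r :=
  have hfm : MemLp f 2 rMeasure :=
    memLp_of_continuous (continuous_iff_continuousAt.2 fun r => (hf r).continuousAt)
  have hgm : MemLp g 2 rMeasure := memLp_of_continuous hg
  ⟨WithLp.toLp 2 (hfm.toLp f, hgm.toLp g),
    isWeakDeriv_congr hfm.coeFn_toLp.symm hgm.coeFn_toLp.symm
      (isWeakDeriv_of_hasDerivAt hf hg)⟩

/-- The constant function `1` in `H¹_r(0,1)`. -/
def H1r.one : H1r := H1r.ofC1 (fun _ => 1) (fun _ => 0) (fun r => hasDerivAt_const r 1)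
  continuous_const

/-- The function `r²/2` in `H¹_r(0,1)`. -/
def H1r.halfSq : H1r := H1r.ofC1 (fun r => (r : ℂ) ^ 2 / 2) (fun r => (r : ℂ))
  (fun r => by
    have := ((Complex.ofRealCLM.hasDerivAt (x := r)).pow 2).div_const 2
    simpa using this) Complex.continuous_ofReal

/-- The constant function `1` in `L²_r(0,1)`. -/
def L2r.one : L2r := H1r.val H1r.one

theorem integrable_coe (ψ : L2r) : Integrable (fun r => ψ r) rMeasure :=
  (Lp.memLp ψ).integrable (by norm_num)

theorem integrable_mul_coe (ψ : L2r) : Integrable (fun r : ℝ => (r : ℂ) * ψ r) rMeasure := by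
  refine (integrable_coe ψ).bdd_mul (c := 1) Complex.continuous_ofReal.aestronglyMeasurable
    (ae_rMeasure_iff.2 ?_)
  filter_upwards [ae_restrict_mem measurableSet_Ioo] with r hr
  rw [Complex.norm_real, Real.norm_of_nonneg hr.1.le]
  exact hr.2.le

/-- The functional `ζ ↦ ∫₀¹ r ζ dr` (recall that `rMeasure` is `r dr`). -/
def mean : L2r →ₗ[ℂ] ℂ where
  toFun ζ := ∫ r, ζ r ∂rMeasure
  map_add' f g := by
    rw [← integral_add (integrable_coe f) (integrable_coe g)]
    exact integral_congr_ae (Lp.coeFn_add f g)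
  map_smul' c f := by
    rw [RingHom.id_apply, ← integral_smul]
    exact integral_congr_ae (Lp.coeFn_smul c f)

/-- The functional `ψ ↦ ∫₀¹ r² ψ dr` (recall that `rMeasure` is `r dr`). -/
def moment : L2r →ₗ[ℂ] ℂ where
  toFun ψ := ∫ r, (r : ℂ) * ψ r ∂rMeasure
  map_add' f g := by
    rw [← integral_add (integrable_mul_coe f) (integrable_mul_coe g)]
    refine integral_congr_ae ?_
    filter_upwards [Lp.coeFn_add f g] with r hr
    rw [hr, Pi.add_apply, mul_add]
  map_smul' c f := by
    rw [RingHom.id_apply, ← integral_smul]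
    refine integral_congr_ae ?_
    filter_upwards [Lp.coeFn_smul c f] with r hr
    rw [hr, Pi.smul_apply, smul_eq_mul, smul_eq_mul]
    ring

/-- The subspace of those `ψ ∈ L²_r(0,1)` that lie in `L²_{1/r}(0,1)`, that is for which
`ψ/r ∈ L²_r(0,1)`. -/
def divDomain : Submodule ℂ L2r where
  carrier := {ψ | MemLp (fun r : ℝ => (r : ℂ)⁻¹ * ψ r) 2 rMeasure}
  zero_mem' := by
    refine (memLp_congr_ae ?_).1 (MemLp.zero (ε := ℂ))
    filter_upwards [Lp.coeFn_zero ℂ 2 rMeasure] with r hr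
    rw [hr, Pi.zero_apply, mul_zero]
  add_mem' := by
    intro f g hf hg
    refine (memLp_congr_ae ?_).1 (MemLp.add hf hg)
    filter_upwards [Lp.coeFn_add f g] with r hr
    rw [hr, Pi.add_apply, Pi.add_apply, mul_add]
  smul_mem' := by
    intro c f hf
    refine (memLp_congr_ae ?_).1 (MemLp.const_smul hf c)
    filter_upwards [Lp.coeFn_smul c f] with r hr
    rw [hr, Pi.smul_apply, Pi.smul_apply, smul_eq_mul, smul_eq_mul, mul_left_comm]

theorem memLp_div (ψ : divDomain) : MemLp (fun r : ℝ => (r : ℂ)⁻¹ * ψ.1 r) 2 rMeasure := ψ.2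

/-- The map `ψ ↦ ψ/r`. -/
def divR : divDomain →ₗ[ℂ] L2r where
  toFun ψ := (memLp_div ψ).toLp _
  map_add' f g := by
    rw [← MemLp.toLp_add]
    refine MemLp.toLp_congr _ _ ?_
    filter_upwards [Lp.coeFn_add f.1 g.1] with r hr
    rw [Submodule.coe_add, hr, Pi.add_apply, Pi.add_apply, mul_add]
  map_smul' c f := by
    rw [RingHom.id_apply, ← MemLp.toLp_const_smul]
    refine MemLp.toLp_congr _ _ ?_
    filter_upwards [Lp.coeFn_smul c f.1] with r hr
    rw [Submodule.coe_smul, hr, Pi.smul_apply, Pi.smul_apply, smul_eq_mul, smul_eq_mul,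
      mul_left_comm]

/-- `ψ|_{r=1} = c`: the function `ψ` has a representative that is continuous on `(0,1]` and takes
the value `c` at `1`. -/
def HasTraceOne (ψ : L2r) (c : ℂ) : Prop :=
  ∃ f : ℝ → ℂ, ContinuousOn f (Ioc 0 1) ∧ f =ᵐ[rMeasure] ψ ∧ f 1 = c

/-! ### The phase space and the linearised operator -/

/-- The (complexified) Hilbert space `X = ℂ × ℂ × H¹_r(0,1) × L²_r(0,1)` of all
`(η, ω, φ, ζ)`. -/
def X : Type := WithLp 2 (ℂ × WithLp 2 (ℂ × WithLp 2 (H1r × L2r)))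

instance instNormedAddCommGroupX : NormedAddCommGroup X :=
  inferInstanceAs (NormedAddCommGroup (WithLp 2 (ℂ × WithLp 2 (ℂ × WithLp 2 (H1r × L2r)))))

instance instInnerProductSpaceX : InnerProductSpace ℂ X :=
  inferInstanceAs (InnerProductSpace ℂ (WithLp 2 (ℂ × WithLp 2 (ℂ × WithLp 2 (H1r × L2r)))))

/-- The component `η`. -/
def X.eta : X →ₗ[ℂ] ℂ where
  toFun u := u.fst
  map_add' _ _ := rfl
  map_smul' _ _ := rfl

/-- The component `ω`. -/
def X.omega : X →ₗ[ℂ] ℂ where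
  toFun u := u.snd.fst
  map_add' _ _ := rfl
  map_smul' _ _ := rfl

/-- The component `φ`. -/
def X.phi : X →ₗ[ℂ] H1r where
  toFun u := u.snd.snd.fst
  map_add' _ _ := rfl
  map_smul' _ _ := rfl

/-- The component `ζ`. -/
def X.zeta : X →ₗ[ℂ] L2r where
  toFun u := u.snd.snd.snd
  map_add' _ _ := rfl
  map_smul' _ _ := rfl

/-- The element `(η, ω, φ, ζ)` of `X`. -/
def X.mk (η ω : ℂ) (φ : H1r) (ζ : L2r) : X :=
  WithLp.toLp 2 (η, WithLp.toLp 2 (ω, WithLp.toLp 2 (φ, ζ)))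

theorem X.ext {u v : X} (h1 : X.eta u = X.eta v) (h2 : X.omega u = X.omega v)
    (h3 : X.phi u = X.phi v) (h4 : X.zeta u = X.zeta v) : u = v :=
  WithLp.ofLp_injective 2 (Prod.ext h1 (WithLp.ofLp_injective 2 (Prod.ext h2
    (WithLp.ofLp_injective 2 (Prod.ext h3 h4)))))

@[simp] theorem X.eta_mk (η ω : ℂ) (φ : H1r) (ζ : L2r) : X.eta (X.mk η ω φ ζ) = η := rfl

@[simp] theorem X.omega_mk (η ω : ℂ) (φ : H1r) (ζ : L2r) : X.omega (X.mk η ω φ ζ) = ω := rfl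

@[simp] theorem X.phi_mk (η ω : ℂ) (φ : H1r) (ζ : L2r) : X.phi (X.mk η ω φ ζ) = φ := rfl

@[simp] theorem X.zeta_mk (η ω : ℂ) (φ : H1r) (ζ : L2r) : X.zeta (X.mk η ω φ ζ) = ζ := rfl

/-- The subspace `Y` of those `(η, ω, φ, ζ) ∈ X` with `φ ∈ H²_r(0,1)`, `ζ ∈ H¹_r(0,1)` and
`φ_r ∈ L²_{1/r}(0,1)`. -/
def Y : Submodule ℂ X :=
  (LinearMap.range H1r.val).comap (H1r.der ∘ₗ X.phi) ⊓ (LinearMap.range H1r.val).comap X.zeta ⊓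
    divDomain.comap (H1r.der ∘ₗ X.phi)

/-- The functional `(η, ω, φ, ζ) ↦ β⁻¹ (ω - ∫₀¹ r² φ_r dr)`. -/
def linW (β : ℝ) : X →ₗ[ℂ] ℂ := (β : ℂ)⁻¹ • (X.omega - moment ∘ₗ H1r.der ∘ₗ X.phi)

/-- The domain of `K`: those `(η, ω, φ, ζ) ∈ Y` that satisfy the boundary condition
`-φ_r - β⁻¹ (ω - ∫₀¹ r² φ_r dr) = 0` at `r = 1`. -/
def domK (β : ℝ) : Submodule ℂ X where
  carrier := {u | u ∈ Y ∧ HasTraceOne (H1r.der (X.phi u)) (-linW β u)}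
  zero_mem' := by
    refine ⟨Y.zero_mem, fun _ => 0, continuousOn_const, ?_, by simp⟩
    simp only [map_zero]
    exact (Lp.coeFn_zero _ _ _).symm
  add_mem' := by
    rintro u v ⟨hu, f, hf1, hf2, hf3⟩ ⟨hv, g, hg1, hg2, hg3⟩
    refine ⟨Y.add_mem hu hv, f + g, hf1.add hg1, ?_, ?_⟩
    · simp only [map_add]
      exact (hf2.add hg2).trans (Lp.coeFn_add _ _).symm
    · rw [Pi.add_apply, hf3, hg3, map_add, neg_add]
  smul_mem' := by
    rintro c u ⟨hu, f, hf1, hf2, hf3⟩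
    refine ⟨Y.smul_mem c hu, c • f, hf1.const_smul c, ?_, ?_⟩
    · simp only [map_smul]
      exact (hf2.const_smul c).trans (Lp.coeFn_smul _ _).symm
    · rw [Pi.smul_apply, hf3, map_smul, smul_neg]

/-- For `u = (η, ω, φ, ζ)` in `Y`, the function `ζ` as an element of `H¹_r(0,1)`. -/
def zetaH1 : Y →ₗ[ℂ] H1r :=
  H1r.lift.toLinearMap ∘ₗ (X.zeta ∘ₗ Y.subtype).codRestrict _ fun u => u.2.1.2

/-- For `u = (η, ω, φ, ζ)` in `Y`, the function `φ_rr`. -/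
def phiRR : Y →ₗ[ℂ] L2r :=
  H1r.der ∘ₗ H1r.lift.toLinearMap ∘ₗ
    (H1r.der ∘ₗ X.phi ∘ₗ Y.subtype).codRestrict _ fun u => u.2.1.1

/-- For `u = (η, ω, φ, ζ)` in `Y`, the function `φ_r / r`. -/
def phiRDivR : Y →ₗ[ℂ] L2r :=
  divR ∘ₗ (H1r.der ∘ₗ X.phi ∘ₗ Y.subtype).codRestrict _ fun u => u.2.2

/-- The inclusion of `D(K)` in `Y`. -/
def domKToY (β : ℝ) : domK β →ₗ[ℂ] Y := Submodule.inclusion fun _ h => h.1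

/-- The operator `K : D(K) → X`, the linearisation at the origin of Hamilton's equations:
with `w = β⁻¹ (ω - ∫₀¹ r² φ_r dr)`,
`K (η, ω, φ, ζ) = (w, -2 ∫₀¹ r ζ dr - 2 η + (α - β) η, ζ + 2 η, -r⁻¹ (r φ_r)_r - 2 w)`,
where `r⁻¹ (r φ_r)_r = φ_rr + φ_r / r`. -/
def opKFun (β α : ℝ) : domK β →ₗ[ℂ] X where
  toFun := fun u =>
    X.mk (linW β u)
      (-2 * mean (X.zeta u) - 2 * X.eta u + ((α : ℂ) - (β : ℂ)) * X.eta u)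
      (zetaH1 (domKToY β u) + (2 * X.eta u) • H1r.one)
      (-(phiRR (domKToY β u) + phiRDivR (domKToY β u)) - (2 * linW β u) • L2r.one)
  map_add' := by
    intro u v
    apply X.ext <;>
      simp only [X.eta_mk, X.omega_mk, X.phi_mk, X.zeta_mk, map_add, Submodule.coe_add]
    · ring
    · module
    · module
  map_smul' := by
    intro c u
    apply X.ext <;>
      simp only [X.eta_mk, X.omega_mk, X.phi_mk, X.zeta_mk, map_smul, Submodule.coe_smul,
        RingHom.id_apply, smul_eq_mul]
    · ring
    · module
    · module

/-- The unbounded operator `K` with domain `D(K)`. -/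
def opK (β α : ℝ) : X →ₗ.[ℂ] X := ⟨domK β, opKFun β α⟩

theorem moment_halfSq : moment (H1r.der H1r.halfSq) = 1 / 4 := by
  have h1 : moment (H1r.der H1r.halfSq) = ∫ r, (r : ℂ) * (r : ℂ) ∂rMeasure := by
    refine integral_congr_ae ?_
    have h2 : H1r.der H1r.halfSq =ᵐ[rMeasure] fun r : ℝ => (r : ℂ) :=
      (memLp_of_continuous Complex.continuous_ofReal).coeFn_toLp
    filter_upwards [h2] with r hr
    rw [hr]
  rw [h1, rMeasure, integral_withDensity_eq_integral_toReal_smul (by fun_prop) (by simp)]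
  have h3 : ∫ r in Ioo (0 : ℝ) 1, (ENNReal.ofReal r).toReal • ((r : ℂ) * (r : ℂ)) =
      ∫ r in Ioo (0 : ℝ) 1, ((r ^ 3 : ℝ) : ℂ) := by
    refine setIntegral_congr_fun measurableSet_Ioo fun r hr => ?_
    simp only [ENNReal.toReal_ofReal hr.1.le, Complex.real_smul]
    push_cast
    ring
  rw [h3, integral_complex_ofReal, ← integral_Ioc_eq_integral_Ioo,
    ← intervalIntegral.integral_of_le zero_le_one, integral_pow]
  norm_num

/-- The derivative at the origin of the change of variables `(η, ω, φ, ζ) ↦ (η, ω̂, φ̂, ζ)` that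
straightens the boundary condition, namely
`ω̂ = ∫₀¹ r² φ_r dr`, `φ̂ = φ + (r²/2) β⁻¹ (ω - ∫₀¹ r² φ_r dr)`. -/
def dG (β : ℝ) (hβ : 0 < β) : X ≃ₗ[ℂ] X where
  toFun u := X.mk (X.eta u) (moment (H1r.der (X.phi u)))
    (X.phi u + linW β u • H1r.halfSq) (X.zeta u)
  invFun u :=
    let w := 4 * (moment (H1r.der (X.phi u)) - X.omega u)
    X.mk (X.eta u) (X.omega u + β * w) (X.phi u - w • H1r.halfSq) (X.zeta u)
  map_add' u v := by
    apply X.ext <;>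
      simp only [X.eta_mk, X.omega_mk, X.phi_mk, X.zeta_mk, map_add]
    module
  map_smul' c u := by
    apply X.ext <;>
      simp only [X.eta_mk, X.omega_mk, X.phi_mk, X.zeta_mk, map_smul, RingHom.id_apply,
        smul_eq_mul]
    module
  left_inv u := by
    have hb : (β : ℂ) ≠ 0 := by exact_mod_cast hβ.ne'
    have hw : 4 * (moment (H1r.der (X.phi u)) + linW β u * (1 / 4)
        - moment (H1r.der (X.phi u))) = linW β u := by ring
    apply X.ext <;>
      simp only [X.eta_mk, X.omega_mk, X.phi_mk, X.zeta_mk, map_add, map_smul, smul_eq_mul,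
        moment_halfSq, hw]
    · simp only [linW, LinearMap.smul_apply, LinearMap.sub_apply, LinearMap.comp_apply,
        smul_eq_mul]
      field_simp
      ring
    · module
  right_inv u := by
    have hb : (β : ℂ) ≠ 0 := by exact_mod_cast hβ.ne'
    apply X.ext <;>
      simp only [X.eta_mk, X.omega_mk, X.phi_mk, X.zeta_mk, map_sub, map_smul, smul_eq_mul,
        moment_halfSq, linW, LinearMap.smul_apply, LinearMap.sub_apply, LinearMap.comp_apply]
    · ring
    · rw [show (β : ℂ)⁻¹ * (X.omega u + β * (4 * (moment (H1r.der (X.phi u)) - X.omega u)) -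
          (moment (H1r.der (X.phi u)) -
            4 * (moment (H1r.der (X.phi u)) - X.omega u) * (1 / 4))) =
          4 * (moment (H1r.der (X.phi u)) - X.omega u) by field_simp; ring]
      module

/-- The linearised operator `L = dG K dG⁻¹`, with domain `dG D(K)`. -/
def opL (β α : ℝ) (hβ : 0 < β) : X →ₗ.[ℂ] X where
  domain := (opK β α).domain.comap (dG β hβ).symm.toLinearMap
  toFun := (dG β hβ).toLinearMap ∘ₗ (opK β α).toFun ∘ₗ
    ((dG β hβ).symm.toLinearMap ∘ₗ Submodule.subtype _).codRestrict (opK β α).domain fun u => u.2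

/-! ### Spectral notions for an unbounded operator -/

/-- The bounded operator `R` is the inverse of `A - z I : D(A) → E`. -/
def IsResolvent {E : Type*} [NormedAddCommGroup E] [NormedSpace ℂ E] (A : E →ₗ.[ℂ] E) (z : ℂ)
    (R : E →L[ℂ] E) : Prop :=
  (∀ u : A.domain, R (A u - z • (u : E)) = u) ∧
    ∀ f : E, ∃ u : A.domain, (u : E) = R f ∧ A u - z • (u : E) = f

/-- The spectrum: all `z` for which `A - z I : D(A) → E` has no bounded inverse. -/
def spectrumOf {E : Type*} [NormedAddCommGroup E] [NormedSpace ℂ E] (A : E →ₗ.[ℂ] E) : Set ℂ :=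
  {z | ¬ ∃ R : E →L[ℂ] E, IsResolvent A z R}

/-- `z` is an eigenvalue of `A`. -/
def IsEigenvalue {E : Type*} [AddCommGroup E] [Module ℂ E] (A : E →ₗ.[ℂ] E) (z : ℂ) : Prop :=
  ∃ u : A.domain, (u : E) ≠ 0 ∧ A u = z • (u : E)

/-- The kernel of `(A - z I)^n`: recursively, `u ∈ ker (A - z I)^(n+1)` if and only if `u ∈ D(A)`
and `A u - z u ∈ ker (A - z I)^n`. -/
def genKer {E : Type*} [AddCommGroup E] [Module ℂ E] (A : E →ₗ.[ℂ] E) (z : ℂ) :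
    ℕ → Submodule ℂ E
  | 0 => ⊥
  | n + 1 => ((genKer A z n).comap (A.toFun - z • A.domain.subtype)).map A.domain.subtype

/-- The generalised eigenspace `⋃ₙ ker (A - z I)^n` of `z`; its dimension is the algebraic
multiplicity of `z`. -/
def genEigenspace {E : Type*} [AddCommGroup E] [Module ℂ E] (A : E →ₗ.[ℂ] E) (z : ℂ) :
    Submodule ℂ E := ⨆ n, genKer A z n

/-! ### Bessel functions -/

/-- The Bessel function of the first kind `J_n` of integer order `n ≥ 0`. -/
def besselJ (n : ℕ) (z : ℂ) : ℂ :=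
  ∑' k : ℕ, (-1) ^ k / ((k.factorial : ℂ) * ((k + n).factorial : ℂ)) * (z / 2) ^ (2 * k + n)

end FerroJet

end

/-!
The bounded operator `opSol` inverting the radial Laplacian `r⁻¹ (r φ_r)_r` identifies the elements
of `Y` as `φ = c + opSol g`, and turns `(K - z) u = f` into a Bessel equation for `φ` together with
two scalar equations for `c = φ(0)` and `η`. The regular solution `(1 + z² opSol)⁻¹ 1 = J₀(z r)` and
the solution operator are entire in `z`, so Cramer's rule writes the resolvent as `N z / D z` with
`D` entire and `N z` bounded. The zeros of `D` are the roots of the characteristic equation; they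
are isolated, and since the kernels are spanned by two vectors, the usual pole argument bounds the
generalised eigenspaces.

On the imaginary axis, testing the equation for `ψ = φ - (i/s) f₃` with `ψ` controls
`‖ψ_r‖² + s² ‖ψ‖²` by the data and the boundary term `|ψ(1)| |w|`, where `|w| ≲ |ψ(1)| + ‖f‖/|s|`.
The trace inequality `|s| |ψ(1)|² ≲ ‖ψ_r‖² + s² ‖ψ‖²` absorbs this term for large `|s|`.
-/

open MeasureTheory Set
open scoped InnerProductSpace ComplexConjugate Topology

noncomputable section

namespace FerroJet

/-! ### Integration over the interval and over triangles -/

section Integration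

theorem ae_rMeasure : ae rMeasure = ae (volume.restrict (Ioo (0 : ℝ) 1)) :=
  Filter.ext fun _ => ae_rMeasure_iff

theorem ae_rMeasure_mem_Ioo : ∀ᵐ r ∂rMeasure, r ∈ Ioo (0 : ℝ) 1 :=
  ae_rMeasure_iff.2 (ae_restrict_mem measurableSet_Ioo)

theorem aestronglyMeasurable_rMeasure_iff {F : Type*} [TopologicalSpace F] {f : ℝ → F} :
    AEStronglyMeasurable f rMeasure ↔ AEStronglyMeasurable f (volume.restrict (Ioo (0 : ℝ) 1)) :=
  ⟨fun hf => hf.mono_ac (Measure.ae_le_iff_absolutelyContinuous.1 ae_rMeasure.ge),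
    fun hf => hf.mono_ac (Measure.ae_le_iff_absolutelyContinuous.1 ae_rMeasure.le)⟩

variable {E : Type*} [NormedAddCommGroup E] [NormedSpace ℝ E]

theorem setIntegral_rMeasure (f : ℝ → E) {s : Set ℝ} (hs : MeasurableSet s) :
    ∫ r in s, f r ∂rMeasure = ∫ r in s ∩ Ioo 0 1, r • f r := by
  rw [rMeasure, setIntegral_withDensity_eq_setIntegral_toReal_smul (by fun_prop) (by simp) _ hs,
    Measure.restrict_restrict hs]
  refine setIntegral_congr_fun (hs.inter measurableSet_Ioo) fun r hr => ?_
  simp only [ENNReal.toReal_ofReal hr.2.1.le]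

theorem integral_rMeasure (f : ℝ → E) : ∫ r, f r ∂rMeasure = ∫ r in Ioo 0 1, r • f r := by
  simpa using setIntegral_rMeasure f MeasurableSet.univ

theorem integrable_rMeasure_iff {f : ℝ → E} :
    Integrable f rMeasure ↔ IntegrableOn (fun r => r • f r) (Ioo 0 1) := by
  rw [rMeasure, integrable_withDensity_iff_integrable_smul' (by fun_prop) (by simp), IntegrableOn]
  refine integrable_congr ?_
  filter_upwards [ae_restrict_mem measurableSet_Ioo] with r hr
  rw [ENNReal.toReal_ofReal hr.1.le]

theorem setLIntegral_rMeasure (f : ℝ → ENNReal) {s : Set ℝ} (hs : MeasurableSet s) :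
    ∫⁻ r in s, f r ∂rMeasure = ∫⁻ r in s, ENNReal.ofReal r * f r ∂volume.restrict (Ioo 0 1) := by
  rw [rMeasure, restrict_withDensity hs,
    lintegral_withDensity_eq_lintegral_mul_non_measurable _ (by fun_prop) (by simp)]
  rfl

theorem lintegral_rMeasure (f : ℝ → ENNReal) :
    ∫⁻ r, f r ∂rMeasure = ∫⁻ r in Ioo 0 1, ENNReal.ofReal r * f r := by
  simpa using setLIntegral_rMeasure f MeasurableSet.univ

theorem intervalIntegral_eq_setIntegral_Ioo (f : ℝ → E) {a b : ℝ} (hab : a ≤ b) :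
    ∫ r in a..b, f r = ∫ r in Ioo a b, f r := by
  rw [intervalIntegral.integral_of_le hab, integral_Ioc_eq_integral_Ioo]

theorem setIntegral_Iio_restrict_Ioo (f : ℝ → E) {a b r : ℝ} (hr : r ∈ Icc a b) :
    ∫ s in Iio r, f s ∂volume.restrict (Ioo a b) = ∫ s in a..r, f s := by
  rw [Measure.restrict_restrict measurableSet_Iio, inter_comm, Ioo_inter_Iio, min_eq_right hr.2,
    intervalIntegral_eq_setIntegral_Ioo f hr.1]

theorem setIntegral_Ioi_restrict_Ioo (f : ℝ → E) {a b r : ℝ} (hr : r ∈ Icc a b) :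
    ∫ s in Ioi r, f s ∂volume.restrict (Ioo a b) = ∫ s in r..b, f s := by
  rw [Measure.restrict_restrict measurableSet_Ioi, Ioi_inter_Ioo, sup_eq_left.2 hr.1,
    intervalIntegral_eq_setIntegral_Ioo f hr.2]

theorem sq_lintegral_le_measure_mul_lintegral_sq {α : Type*} [MeasurableSpace α] {μ : Measure α}
    {f : α → ENNReal} (hf : AEMeasurable f μ) :
    (∫⁻ a, f a ∂μ) ^ 2 ≤ μ univ * ∫⁻ a, f a ^ 2 ∂μ := by
  have holder := ENNReal.lintegral_mul_le_Lp_mul_Lq μ Real.HolderConjugate.two_two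
    aemeasurable_const (f := 1) hf
  simp only [Pi.mul_apply, Pi.one_apply, one_mul, lintegral_const, ENNReal.rpow_ofNat,
    one_pow] at holder
  calc (∫⁻ a, f a ∂μ) ^ 2
      ≤ ((μ univ) ^ (1 / 2 : ℝ) * (∫⁻ a, f a ^ 2 ∂μ) ^ (1 / 2 : ℝ)) ^ 2 := by gcongr
    _ = μ univ * ∫⁻ a, f a ^ 2 ∂μ := by
        rw [mul_pow, ← ENNReal.rpow_natCast, ← ENNReal.rpow_natCast, ← ENNReal.rpow_mul,
          ← ENNReal.rpow_mul]
        norm_num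

theorem setIntegral_norm_le_sqrt_mul_norm {α : Type*} [MeasurableSpace α] {μ : Measure α}
    [IsFiniteMeasure μ] {F : Type*} [NormedAddCommGroup F] (g : Lp F 2 μ) (s : Set α) :
    ∫ a in s, ‖g a‖ ∂μ ≤ √(μ.real s) * ‖g‖ := by
  have hmeas := (Lp.aestronglyMeasurable g).restrict (s := s)
  rw [integral_norm_eq_lintegral_enorm hmeas, ← eLpNorm_one_eq_lintegral_enorm, Lp.norm_def,
    mul_comm, Real.sqrt_eq_rpow, Measure.real, ENNReal.toReal_rpow, ← ENNReal.toReal_mul]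
  refine ENNReal.toReal_mono (ENNReal.mul_ne_top (Lp.eLpNorm_ne_top g) (by simp)) ?_
  calc eLpNorm g 1 (μ.restrict s)
      ≤ eLpNorm g 2 (μ.restrict s) * μ s ^ (1 / 2 : ℝ) := by
        have := eLpNorm_le_eLpNorm_mul_rpow_measure_univ one_le_two hmeas
        norm_num at this ⊢
        exact this
    _ ≤ eLpNorm g 2 μ * μ s ^ (1 / 2 : ℝ) := by
        gcongr
        exact Measure.restrict_le_self

theorem rMeasure_Iio_le (r : ℝ) : rMeasure (Iio r) ≤ ENNReal.ofReal r ^ 2 := by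
  rw [rMeasure, withDensity_apply _ measurableSet_Iio, Measure.restrict_restrict measurableSet_Iio,
    inter_comm, Ioo_inter_Iio]
  calc ∫⁻ s in Ioo 0 (min 1 r), ENNReal.ofReal s
      ≤ ∫⁻ _ in Ioo 0 (min 1 r), ENNReal.ofReal r :=
        setLIntegral_mono measurable_const fun s hs =>
          ENNReal.ofReal_le_ofReal (hs.2.le.trans (min_le_right _ _))
    _ ≤ ENNReal.ofReal r ^ 2 := by
        rw [setLIntegral_const, Real.volume_Ioo, sub_zero, sq]
        gcongr
        exact min_le_right _ _

theorem setIntegral_Iio_norm_le {F : Type*} [NormedAddCommGroup F] (g : Lp F 2 rMeasure) (r : ℝ) :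
    ∫ s in Iio r, ‖g s‖ ∂rMeasure ≤ |r| * ‖g‖ := by
  refine (setIntegral_norm_le_sqrt_mul_norm g _).trans ?_
  gcongr
  refine Real.sqrt_le_iff.2 ⟨abs_nonneg r, ENNReal.toReal_le_of_le_ofReal (by positivity) ?_⟩
  rw [ENNReal.ofReal_pow (abs_nonneg r)]
  exact (rMeasure_Iio_le r).trans (by gcongr; exact le_abs_self r)

/-- The half plane `r < s` of all pairs `(s, r)`, over which the iterated integrals
`∫ h(s) ∫_{r < s} G(r)` extend. -/
def belowDiagonal : Set (ℝ × ℝ) := {p | p.2 < p.1}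

theorem measurableSet_belowDiagonal : MeasurableSet belowDiagonal :=
  measurableSet_lt measurable_snd measurable_fst

theorem lintegral_mul_setLIntegral_Iio {μ ν : Measure ℝ} [SFinite μ] [SFinite ν]
    {h k : ℝ → ENNReal} (hh : AEMeasurable h μ) (hk : AEMeasurable k ν) :
    ∫⁻ s, h s * ∫⁻ r in Iio s, k r ∂ν ∂μ = ∫⁻ r, (∫⁻ s in Ioi r, h s ∂μ) * k r ∂ν := by
  have hmeas : AEMeasurable
      (Function.uncurry fun s r => belowDiagonal.indicator (fun p => h p.1 * k p.2) (s, r))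
      (μ.prod ν) :=
    (hh.comp_fst.mul hk.comp_snd).indicator measurableSet_belowDiagonal
  calc ∫⁻ s, h s * ∫⁻ r in Iio s, k r ∂ν ∂μ
      = ∫⁻ s, ∫⁻ r, belowDiagonal.indicator (fun p => h p.1 * k p.2) (s, r) ∂ν ∂μ := by
        refine lintegral_congr fun s => ?_
        rw [← lintegral_const_mul'' _ hk.restrict, ← lintegral_indicator measurableSet_Iio]
        rfl
    _ = ∫⁻ r, ∫⁻ s, belowDiagonal.indicator (fun p => h p.1 * k p.2) (s, r) ∂μ ∂ν :=
        lintegral_lintegral_swap hmeas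
    _ = ∫⁻ r, (∫⁻ s in Ioi r, h s ∂μ) * k r ∂ν := by
        refine lintegral_congr fun r => ?_
        rw [← lintegral_mul_const'' _ hh.restrict, ← lintegral_indicator measurableSet_Ioi]
        rfl

theorem integrable_indicator_triangle {μ ν : Measure ℝ} [SFinite μ] [SFinite ν]
    {𝕜 : Type*} [RCLike 𝕜] {h G : ℝ → 𝕜} {w : ℝ → ℝ} (hh : AEStronglyMeasurable h μ)
    (hG : Integrable G ν) (hw : Integrable (fun s => ‖h s‖ * w s) μ)
    (hGw : ∀ᵐ s ∂μ, ∫ r in Iio s, ‖G r‖ ∂ν ≤ w s) :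
    Integrable (belowDiagonal.indicator fun p => h p.1 * G p.2) (μ.prod ν) := by
  have hmeas : AEStronglyMeasurable (belowDiagonal.indicator fun p => h p.1 * G p.2) (μ.prod ν) :=
    (hh.comp_fst.mul hG.1.comp_snd).indicator measurableSet_belowDiagonal
  refine (integrable_prod_iff hmeas).2 ⟨.of_forall fun s => ?_, ?_⟩
  · exact (hG.const_mul (h s)).indicator (measurableSet_Iio (a := s))
  · refine hw.mono' hmeas.norm.integral_prod_right' ?_
    filter_upwards [hGw] with s hs
    have inner : ∫ r, ‖belowDiagonal.indicator (fun p => h p.1 * G p.2) (s, r)‖ ∂ν =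
        ‖h s‖ * ∫ r in Iio s, ‖G r‖ ∂ν := by
      rw [← integral_const_mul, ← integral_indicator measurableSet_Iio]
      simp_rw [norm_indicator_eq_indicator_norm, norm_mul]
      rfl
    rw [inner, Real.norm_of_nonneg (by positivity)]
    gcongr

theorem integral_mul_setIntegral_Iio {μ ν : Measure ℝ} [SFinite μ] [SFinite ν]
    {𝕜 : Type*} [RCLike 𝕜] {h G : ℝ → 𝕜} {w : ℝ → ℝ} (hh : AEStronglyMeasurable h μ)
    (hG : Integrable G ν) (hw : Integrable (fun s => ‖h s‖ * w s) μ)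
    (hGw : ∀ᵐ s ∂μ, ∫ r in Iio s, ‖G r‖ ∂ν ≤ w s) :
    ∫ s, h s * ∫ r in Iio s, G r ∂ν ∂μ = ∫ r, (∫ s in Ioi r, h s ∂μ) * G r ∂ν := by
  calc ∫ s, h s * ∫ r in Iio s, G r ∂ν ∂μ
      = ∫ s, ∫ r, belowDiagonal.indicator (fun p => h p.1 * G p.2) (s, r) ∂ν ∂μ := by
        refine integral_congr_ae (.of_forall fun s => ?_)
        simp only [← integral_const_mul]
        exact (integral_indicator measurableSet_Iio).symm
    _ = ∫ r, ∫ s, belowDiagonal.indicator (fun p => h p.1 * G p.2) (s, r) ∂μ ∂ν :=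
        integral_integral_swap (integrable_indicator_triangle hh hG hw hGw)
    _ = ∫ r, (∫ s in Ioi r, h s ∂μ) * G r ∂ν := by
        refine integral_congr_ae (.of_forall fun r => ?_)
        simp only [← integral_mul_const]
        exact integral_indicator (f := fun s => h s * G r) measurableSet_Ioi

end Integration

/-! ### Weak derivatives -/

/-- The test functions of `IsWeakDeriv`: smooth with compact support in `(0,1)`. -/
structure IsTestFunction (χ : ℝ → ℝ) : Prop where
  contDiff : ContDiff ℝ (⊤ : ℕ∞) χ
  hasCompactSupport : HasCompactSupport χ
  tsupport_subset : tsupport χ ⊆ Ioo (0 : ℝ) 1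

theorem isWeakDeriv_iff {f g : ℝ → ℂ} : IsWeakDeriv f g ↔ ∀ χ, IsTestFunction χ →
    ∫ r in Ioo (0 : ℝ) 1, deriv χ r • f r = -∫ r in Ioo (0 : ℝ) 1, χ r • g r :=
  ⟨fun h χ hχ => h χ hχ.1 hχ.2 hχ.3, fun h χ h₁ h₂ h₃ => h χ ⟨h₁, h₂, h₃⟩⟩

namespace IsTestFunction

variable {χ ψ : ℝ → ℝ}

theorem differentiable (hχ : IsTestFunction χ) : Differentiable ℝ χ :=
  hχ.contDiff.differentiable (by simp)

theorem apply_eq_zero (hχ : IsTestFunction χ) {r : ℝ} (hr : r ∉ Ioo (0 : ℝ) 1) : χ r = 0 :=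
  image_eq_zero_of_notMem_tsupport fun h => hr (hχ.tsupport_subset h)

theorem of_support_subset (hχ : IsTestFunction χ) (hψ : ContDiff ℝ (⊤ : ℕ∞) ψ)
    (hsupp : Function.support ψ ⊆ tsupport χ) : IsTestFunction ψ where
  contDiff := hψ
  hasCompactSupport := hχ.hasCompactSupport.mono' hsupp
  tsupport_subset := (closure_minimal hsupp (isClosed_tsupport χ)).trans hχ.tsupport_subset

protected theorem deriv (hχ : IsTestFunction χ) : IsTestFunction (deriv χ) :=
  hχ.of_support_subset (contDiff_infty_iff_deriv.1 hχ.contDiff).2 support_deriv_subset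

theorem mul {a : ℝ → ℝ} (ha : ContDiffOn ℝ (⊤ : ℕ∞) a (Ioo 0 1)) (hχ : IsTestFunction χ) :
    IsTestFunction fun r => a r * χ r := by
  refine hχ.of_support_subset (contDiff_iff_contDiffAt.2 fun r => ?_) fun r hr =>
    subset_tsupport χ fun h => hr (by simp [h])
  by_cases hr : r ∈ tsupport χ
  · exact (ha.contDiffAt (isOpen_Ioo.mem_nhds (hχ.tsupport_subset hr))).mul hχ.contDiff.contDiffAt
  · refine (contDiffAt_const (c := (0 : ℝ))).congr_of_eventuallyEq ?_
    filter_upwards [notMem_tsupport_iff_eventuallyEq.1 hr] with x hx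
    simp [hx]

theorem sub (hχ : IsTestFunction χ) (hψ : IsTestFunction ψ) :
    IsTestFunction fun r => χ r - ψ r where
  contDiff := hχ.contDiff.sub hψ.contDiff
  hasCompactSupport := hχ.hasCompactSupport.sub hψ.hasCompactSupport
  tsupport_subset := (tsupport_sub χ ψ).trans (union_subset hχ.tsupport_subset hψ.tsupport_subset)

theorem integrableOn_smul {E : Type*} [NormedAddCommGroup E] [NormedSpace ℝ E] {f : ℝ → E}
    (hχ : IsTestFunction χ) (hf : LocallyIntegrableOn f (Ioo (0 : ℝ) 1)) :
    IntegrableOn (fun r => χ r • f r) (Ioo (0 : ℝ) 1) := by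
  have on_tsupport : IntegrableOn (fun r => χ r • f r) (tsupport χ) :=
    ((hf.mono_set hχ.tsupport_subset).integrableOn_isCompact hχ.hasCompactSupport).continuousOn_smul
      hχ.contDiff.continuous.continuousOn hχ.hasCompactSupport
  refine ((integrableOn_iff_integrable_of_support_subset fun r hr => ?_).1 on_tsupport).integrableOn
  exact subset_tsupport χ fun h => hr (by simp [h])

theorem integrableOn (hχ : IsTestFunction χ) : IntegrableOn χ (Ioo (0 : ℝ) 1) :=
  (hχ.contDiff.continuous.integrable_of_hasCompactSupport hχ.hasCompactSupport).integrableOn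

theorem intervalIntegral_deriv (hχ : IsTestFunction χ) (a b : ℝ) :
    ∫ r in a..b, ((deriv χ r : ℝ) : ℂ) = χ b - χ a := by
  rw [intervalIntegral.integral_ofReal, intervalIntegral.integral_deriv_eq_sub
    (fun r _ => hχ.differentiable r) (hχ.deriv.contDiff.continuous.intervalIntegrable _ _),
    Complex.ofReal_sub]

end IsTestFunction

theorem IsWeakDeriv.sub {f g f' g' : ℝ → ℂ} (hf : LocallyIntegrableOn f (Ioo (0 : ℝ) 1))
    (hf' : LocallyIntegrableOn f' (Ioo (0 : ℝ) 1)) (hg : LocallyIntegrableOn g (Ioo (0 : ℝ) 1))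
    (hg' : LocallyIntegrableOn g' (Ioo (0 : ℝ) 1)) (h : IsWeakDeriv f f') (k : IsWeakDeriv g g') :
    IsWeakDeriv (fun r => f r - g r) fun r => f' r - g' r := by
  refine isWeakDeriv_iff.2 fun χ hχ => ?_
  simp_rw [smul_sub]
  rw [integral_sub (hχ.deriv.integrableOn_smul hf) (hχ.deriv.integrableOn_smul hg),
    integral_sub (hχ.integrableOn_smul hf') (hχ.integrableOn_smul hg'),
    isWeakDeriv_iff.1 h χ hχ, isWeakDeriv_iff.1 k χ hχ]
  ring

/-- The product rule is the definition of the weak derivative of `f`, tested with `a χ`. -/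
theorem IsWeakDeriv.smul {a : ℝ → ℝ} {f f' : ℝ → ℂ}
    (ha : ContDiffOn ℝ (⊤ : ℕ∞) a (Ioo 0 1)) (hf : LocallyIntegrableOn f (Ioo (0 : ℝ) 1))
    (hf' : LocallyIntegrableOn f' (Ioo (0 : ℝ) 1)) (h : IsWeakDeriv f f') :
    IsWeakDeriv (fun r => a r • f r) fun r => deriv a r • f r + a r • f' r := by
  refine isWeakDeriv_iff.2 fun χ hχ => ?_
  have ha' : ContDiffOn ℝ (⊤ : ℕ∞) (deriv a) (Ioo 0 1) :=
    ((contDiffOn_infty_iff_deriv_of_isOpen isOpen_Ioo).1 ha).2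
  have leibniz : ∀ r ∈ Ioo (0 : ℝ) 1,
      deriv (fun r => a r * χ r) r = deriv a r * χ r + a r * deriv χ r := fun r hr =>
    deriv_fun_mul ((ha.contDiffAt (isOpen_Ioo.mem_nhds hr)).differentiableAt (by simp))
      (hχ.differentiable r)
  have test := isWeakDeriv_iff.1 h _ (hχ.mul ha)
  rw [setIntegral_congr_fun measurableSet_Ioo fun r hr => by rw [leibniz r hr, add_smul],
    integral_add ((hχ.mul ha').integrableOn_smul hf) ((hχ.deriv.mul ha).integrableOn_smul hf)]
    at test
  simp_rw [smul_add, smul_smul, mul_comm (χ _), mul_comm (deriv χ _)]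
  rw [integral_add ((hχ.mul ha').integrableOn_smul hf) ((hχ.mul ha).integrableOn_smul hf')]
  linear_combination test

theorem exists_Icc_superset_of_isCompact {K : Set ℝ} (hK : IsCompact K) {a b : ℝ} (hab : a < b)
    (hKab : K ⊆ Ioo a b) : ∃ c d, a < c ∧ d < b ∧ K ⊆ Icc c d := by
  obtain rfl | hne := K.eq_empty_or_nonempty
  · exact ⟨b, a, hab, hab, empty_subset _⟩
  obtain ⟨c, hcK, hc⟩ := hK.exists_isLeast hne
  obtain ⟨d, hdK, hd⟩ := hK.exists_isGreatest hne
  exact ⟨c, d, (hKab hcK).1, (hKab hdK).2, fun r hr => ⟨hc hr, hd hr⟩⟩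

theorem IsTestFunction.exists_deriv_eq {k : ℝ → ℝ} (hk : IsTestFunction k)
    (hk₀ : ∫ r in Ioo (0 : ℝ) 1, k r = 0) : ∃ χ, IsTestFunction χ ∧ deriv χ = k := by
  set χ : ℝ → ℝ := fun r => ∫ s in (0 : ℝ)..r, k s
  have hk_cont := hk.contDiff.continuous
  have hderiv : deriv χ = k := funext fun r => hk_cont.deriv_integral k 0 r
  have hdiff : Differentiable ℝ χ := fun r =>
    (intervalIntegral.integral_hasDerivAt_right (hk_cont.intervalIntegrable _ _)
      hk_cont.stronglyMeasurable.stronglyMeasurableAtFilter hk_cont.continuousAt).differentiableAt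
  have χ_zero : χ 0 = 0 := intervalIntegral.integral_same
  have χ_one : χ 1 = 0 := (intervalIntegral_eq_setIntegral_Ioo k zero_le_one).trans hk₀
  obtain ⟨a, b, ha, hb, hab⟩ :=
    exists_Icc_superset_of_isCompact hk.hasCompactSupport zero_lt_one hk.tsupport_subset
  have k_eq_zero : ∀ r ∉ Icc a b, k r = 0 := fun r hr =>
    image_eq_zero_of_notMem_tsupport fun h => hr (hab h)
  have supp : Function.support χ ⊆ Icc a b := by
    intro r hr
    by_contra hrab
    rw [mem_Icc, not_and_or, not_le, not_le] at hrab
    obtain hra | hbr := hrab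
    · exact hr <| (isOpen_Iio.is_const_of_deriv_eq_zero isPreconnected_Iio hdiff.differentiableOn
        (fun s hs => by simp [hderiv, k_eq_zero s fun h => h.1.not_gt hs]) hra ha).trans χ_zero
    · exact hr <| (isOpen_Ioi.is_const_of_deriv_eq_zero isPreconnected_Ioi hdiff.differentiableOn
        (fun s hs => by simp [hderiv, k_eq_zero s fun h => h.2.not_gt hs]) hbr hb).trans χ_one
  exact ⟨χ, ⟨contDiff_infty_iff_deriv.2 ⟨hdiff, hderiv ▸ hk.contDiff⟩,
    .of_support_subset_isCompact isCompact_Icc supp,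
    (closure_minimal supp isClosed_Icc).trans (Icc_subset_Ioo ha hb)⟩, hderiv⟩

theorem exists_isTestFunction_integral_eq_one :
    ∃ b, IsTestFunction b ∧ ∫ r in Ioo (0 : ℝ) 1, b r = 1 := by
  let B : ContDiffBump (1 / 2 : ℝ) := ⟨1 / 8, 1 / 4, by norm_num, by norm_num⟩
  have hB : IsTestFunction (B.normed volume) := by
    refine ⟨B.contDiff_normed, B.hasCompactSupport_normed, fun r hr => ?_⟩
    rw [B.tsupport_normed_eq, Real.closedBall_eq_Icc] at hr
    exact Icc_subset_Ioo (by norm_num [B]) (by norm_num [B]) hr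
  refine ⟨_, hB, ?_⟩
  rw [setIntegral_eq_integral_of_forall_compl_eq_zero fun r hr => hB.apply_eq_zero hr]
  exact B.integral_normed

theorem integral_smul_eq_of_isWeakDeriv_zero {f : ℝ → ℂ} {b ψ : ℝ → ℝ}
    (hf : LocallyIntegrableOn f (Ioo (0 : ℝ) 1)) (hw : IsWeakDeriv f fun _ => 0)
    (hb : IsTestFunction b) (hb₁ : ∫ r in Ioo (0 : ℝ) 1, b r = 1) (hψ : IsTestFunction ψ) :
    ∫ r in Ioo (0 : ℝ) 1, ψ r • f r =
      (∫ r in Ioo (0 : ℝ) 1, ψ r) • ∫ r in Ioo (0 : ℝ) 1, b r • f r := by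
  set m := ∫ r in Ioo (0 : ℝ) 1, ψ r with hm
  have hmb : IsTestFunction fun r => m * b r := hb.mul contDiffOn_const
  obtain ⟨χ, hχ, hχ'⟩ := (hψ.sub hmb).exists_deriv_eq <| by
    rw [integral_sub hψ.integrableOn hmb.integrableOn, integral_const_mul, hb₁, mul_one, ← hm,
      sub_self]
  have test := isWeakDeriv_iff.1 hw χ hχ
  simp only [hχ', sub_smul, smul_zero, integral_zero, neg_zero] at test
  rw [integral_sub (hψ.integrableOn_smul hf) (hmb.integrableOn_smul hf), sub_eq_zero] at test
  rw [test, ← integral_smul]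
  simp only [smul_smul]

theorem ae_eq_const_of_isWeakDeriv_zero {f : ℝ → ℂ}
    (hf : LocallyIntegrableOn f (Ioo (0 : ℝ) 1)) (hw : IsWeakDeriv f fun _ => 0) :
    ∃ c : ℂ, f =ᵐ[rMeasure] fun _ => c := by
  obtain ⟨b, hb, hb₁⟩ := exists_isTestFunction_integral_eq_one
  set c : ℂ := ∫ r in Ioo (0 : ℝ) 1, b r • f r
  have const_loc : LocallyIntegrableOn (fun _ => c) (Ioo (0 : ℝ) 1) :=
    continuousOn_const.locallyIntegrableOn measurableSet_Ioo
  have ae_zero := isOpen_Ioo.ae_eq_zero_of_integral_contDiff_smul_eq_zero (hf.sub const_loc)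
    fun ψ h₁ h₂ h₃ => by
      have hψ : IsTestFunction ψ := ⟨h₁, h₂, h₃⟩
      rw [← setIntegral_eq_integral_of_forall_compl_eq_zero (s := Ioo (0 : ℝ) 1) fun r hr => by
        simp [hψ.apply_eq_zero hr]]
      simp_rw [Pi.sub_apply, smul_sub]
      rw [integral_sub (hψ.integrableOn_smul hf) (hψ.integrableOn_smul const_loc),
        integral_smul_eq_of_isWeakDeriv_zero hf hw hb hb₁ hψ, integral_smul_const, sub_self]
  refine ⟨c, ae_rMeasure_iff.2 ((ae_restrict_iff' measurableSet_Ioo).2 ?_)⟩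
  filter_upwards [ae_zero] with r hr hr_mem
  exact sub_eq_zero.1 (hr hr_mem)

theorem IsWeakDeriv.ae_eq_add_const {f g h : ℝ → ℂ} (hf : LocallyIntegrableOn f (Ioo (0 : ℝ) 1))
    (hg : LocallyIntegrableOn g (Ioo (0 : ℝ) 1)) (hh : LocallyIntegrableOn h (Ioo (0 : ℝ) 1))
    (hfh : IsWeakDeriv f h) (hgh : IsWeakDeriv g h) :
    ∃ c : ℂ, f =ᵐ[rMeasure] fun r => c + g r := by
  have diff := hfh.sub hf hh hg hh hgh
  simp only [sub_self] at diff
  obtain ⟨c, hc⟩ := ae_eq_const_of_isWeakDeriv_zero (hf.sub hg) diff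
  refine ⟨c, ?_⟩
  filter_upwards [hc] with r hr
  exact eq_add_of_sub_eq hr

theorem isWeakDeriv_primitive {f : ℝ → ℂ} (hf : IntegrableOn f (Ioo 0 1)) :
    IsWeakDeriv (fun r => ∫ s in (0 : ℝ)..r, f s) f := by
  refine isWeakDeriv_iff.2 fun χ hχ => ?_
  have hχ' : Integrable (fun r => ((deriv χ r : ℝ) : ℂ)) (volume.restrict (Ioo 0 1)) :=
    hχ.deriv.integrableOn.ofReal
  have swap := integral_mul_setIntegral_Iio (w := fun _ => ∫ r in Ioo 0 1, ‖f r‖) hχ'.1 hf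
    (hχ'.norm.mul_const _) <| .of_forall fun s =>
      setIntegral_le_integral hf.norm (.of_forall fun _ => norm_nonneg _)
  rw [setIntegral_congr_fun measurableSet_Ioo fun r hr => by
      rw [Complex.real_smul, ← setIntegral_Iio_restrict_Ioo f (Ioo_subset_Icc_self hr)],
    swap, ← integral_neg]
  refine setIntegral_congr_fun measurableSet_Ioo fun r hr => ?_
  simp only [setIntegral_Ioi_restrict_Ioo _ (Ioo_subset_Icc_self hr), hχ.intervalIntegral_deriv,
    hχ.apply_eq_zero (r := 1) (by simp), Complex.real_smul, Complex.ofReal_zero]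
  ring

theorem IsTestFunction.exists_setIntegral_Iio_norm_deriv_le {χ : ℝ → ℝ} (hχ : IsTestFunction χ) :
    ∃ C, ∀ s ∈ Ioo (0 : ℝ) 1,
      ∫ r in Iio s, ‖((deriv χ r : ℝ) : ℂ)‖ ∂volume.restrict (Ioo 0 1) ≤ C * s := by
  obtain ⟨C, hC⟩ :=
    hχ.deriv.hasCompactSupport.exists_bound_of_continuous hχ.deriv.contDiff.continuous
  refine ⟨C, fun s hs => ?_⟩
  rw [setIntegral_Iio_restrict_Ioo _ (Ioo_subset_Icc_self hs)]
  have bound := intervalIntegral.norm_integral_le_of_norm_le_const (a := 0) (b := s)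
    (f := fun r => ‖((deriv χ r : ℝ) : ℂ)‖) (C := C) fun r _ => by simpa using hC r
  rw [sub_zero, abs_of_pos hs.1] at bound
  exact (le_abs_self _).trans bound

/-- The weight `s` at the origin comes from the vanishing of test functions there. -/
theorem isWeakDeriv_tail {h : ℝ → ℂ}
    (hh : AEStronglyMeasurable h (volume.restrict (Ioo (0 : ℝ) 1)))
    (hi : IntegrableOn (fun s : ℝ => s • h s) (Ioo 0 1)) :
    IsWeakDeriv (fun r => ∫ s in r..1, h s) fun r => -h r := by
  refine isWeakDeriv_iff.2 fun χ hχ => ?_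
  obtain ⟨C, hC⟩ := hχ.exists_setIntegral_Iio_norm_deriv_le
  have hw : IntegrableOn (fun s => ‖h s‖ * (C * s)) (Ioo 0 1) := by
    refine IntegrableOn.congr_fun (hi.norm.const_mul C) (fun s hs => ?_) measurableSet_Ioo
    simp only [norm_smul, Real.norm_of_nonneg hs.1.le]
    ring
  have hχ' : Integrable (fun r => ((deriv χ r : ℝ) : ℂ)) (volume.restrict (Ioo 0 1)) :=
    hχ.deriv.integrableOn.ofReal
  have swap := integral_mul_setIntegral_Iio hh hχ' hw
    ((ae_restrict_iff' measurableSet_Ioo).2 (.of_forall hC))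
  simp_rw [smul_neg, integral_neg, neg_neg, Complex.real_smul]
  rw [setIntegral_congr_fun measurableSet_Ioo fun r hr => by
      rw [mul_comm, ← setIntegral_Ioi_restrict_Ioo h (Ioo_subset_Icc_self hr)]]
  refine swap.symm.trans (setIntegral_congr_fun measurableSet_Ioo fun s hs => ?_)
  simp only [setIntegral_Iio_restrict_Ioo _ (Ioo_subset_Icc_self hs)]
  rw [hχ.intervalIntegral_deriv, hχ.apply_eq_zero (r := 0) (by simp), Complex.ofReal_zero,
    sub_zero, mul_comm]

/-! ### The inverse of the radial Laplacian -/

instance instNullSingletonClassRMeasure : NullSingletonClass rMeasure :=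
  inferInstanceAs (NullSingletonClass ((volume.restrict (Ioo (0 : ℝ) 1)).withDensity _))

/-- The flux `r φ_r = ∫₀ʳ s g(s) ds` of the solution of `r⁻¹ (r φ_r)_r = g` that is regular at the
origin. -/
def radFlux : L2r →ₗ[ℂ] ℝ → ℂ where
  toFun g r := ∫ s in Iio r, g s ∂rMeasure
  map_add' f g := funext fun _ =>
    (integral_congr_ae (ae_restrict_of_ae (Lp.coeFn_add f g))).trans
      (integral_add (integrable_coe f).integrableOn (integrable_coe g).integrableOn)
  map_smul' c g := funext fun _ =>
    (integral_congr_ae (ae_restrict_of_ae (Lp.coeFn_smul c g))).trans (integral_smul c _)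

theorem radFlux_apply (g : L2r) (r : ℝ) : radFlux g r = ∫ s in Iio r, g s ∂rMeasure := rfl

/-- The derivative `φ_r = r⁻¹ ∫₀ʳ s g(s) ds` of the solution of `r⁻¹ (r φ_r)_r = g` that is
regular at the origin. -/
def radDeriv : L2r →ₗ[ℂ] ℝ → ℂ where
  toFun g r := (r : ℂ)⁻¹ * radFlux g r
  map_add' f g := by ext r; simp [mul_add]
  map_smul' c g := by ext r; simp [mul_left_comm]

theorem radDeriv_apply (g : L2r) (r : ℝ) : radDeriv g r = (r : ℂ)⁻¹ * radFlux g r := rfl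

theorem norm_radFlux_le (g : L2r) (r : ℝ) : ‖radFlux g r‖ ≤ |r| * ‖g‖ :=
  (norm_integral_le_integral_norm _).trans (setIntegral_Iio_norm_le g r)

theorem norm_radDeriv_le (g : L2r) (r : ℝ) : ‖radDeriv g r‖ ≤ ‖g‖ := by
  rw [radDeriv_apply, norm_mul, norm_inv, Complex.norm_real, Real.norm_eq_abs]
  exact inv_mul_le_of_le_mul₀ (abs_nonneg r) (norm_nonneg g) (norm_radFlux_le g r)

theorem continuous_radFlux (g : L2r) : Continuous (radFlux g) := by
  have primitive : radFlux g =
      fun r => (∫ s in (0 : ℝ)..r, g s ∂rMeasure) + ∫ s in Iic 0, g s ∂rMeasure := by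
    ext r
    rw [intervalIntegral.integral_Iic_sub_Iic (integrable_coe g).integrableOn
      (integrable_coe g).integrableOn |>.symm, sub_add_cancel, integral_Iic_eq_integral_Iio,
      radFlux_apply]
  rw [primitive]
  exact (intervalIntegral.continuous_primitive
    (fun _ _ => (integrable_coe g).intervalIntegrable) 0).add continuous_const

theorem continuousOn_radDeriv (g : L2r) : ContinuousOn (radDeriv g) {0}ᶜ :=
  (Complex.continuous_ofReal.continuousOn.inv₀ fun _ hr => Complex.ofReal_ne_zero.2 hr).mul
    (continuous_radFlux g).continuousOn

theorem measurable_radDeriv (g : L2r) : Measurable (radDeriv g) :=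
  Complex.measurable_ofReal.inv.mul (continuous_radFlux g).measurable

theorem integrable_radDeriv (g : L2r) (μ : Measure ℝ) [IsFiniteMeasure μ] :
    Integrable (radDeriv g) μ :=
  .of_bound (measurable_radDeriv g).aestronglyMeasurable ‖g‖ (.of_forall (norm_radDeriv_le g))

theorem intervalIntegrable_radDeriv (g : L2r) (a b : ℝ) :
    IntervalIntegrable (radDeriv g) volume a b :=
  ⟨integrable_radDeriv g _, integrable_radDeriv g _⟩

/-- The solution of `r⁻¹ (r φ_r)_r = g` that is regular at the origin and vanishes there. -/
def radSol : L2r →ₗ[ℂ] ℝ → ℂ where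
  toFun g r := ∫ t in (0 : ℝ)..r, radDeriv g t
  map_add' f g := funext fun r => by
    simp only [map_add, Pi.add_apply]
    exact intervalIntegral.integral_add (intervalIntegrable_radDeriv f 0 r)
      (intervalIntegrable_radDeriv g 0 r)
  map_smul' c g := funext fun r => by
    simp only [map_smul, Pi.smul_apply]
    exact intervalIntegral.integral_smul c (radDeriv g)

theorem radSol_apply (g : L2r) (r : ℝ) : radSol g r = ∫ t in (0 : ℝ)..r, radDeriv g t := rfl

theorem norm_radSol_le (g : L2r) (r : ℝ) : ‖radSol g r‖ ≤ |r| * ‖g‖ := by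
  have bound := intervalIntegral.norm_integral_le_of_norm_le_const (a := 0) (b := r)
    fun t _ => norm_radDeriv_le g t
  rwa [sub_zero, mul_comm] at bound

theorem continuous_radSol (g : L2r) : Continuous (radSol g) :=
  intervalIntegral.continuous_primitive (intervalIntegrable_radDeriv g) 0

theorem integrableOn_smul_coe (g : L2r) : IntegrableOn (fun s : ℝ => s • g s) (Ioo 0 1) :=
  integrable_rMeasure_iff.1 (integrable_coe g)

theorem radFlux_eq_intervalIntegral (g : L2r) {r : ℝ} (hr : r ∈ Icc (0 : ℝ) 1) :
    radFlux g r = ∫ s in (0 : ℝ)..r, s • g s := by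
  rw [radFlux_apply, setIntegral_rMeasure _ measurableSet_Iio,
    ← setIntegral_Iio_restrict_Ioo _ hr, Measure.restrict_restrict measurableSet_Iio]

theorem isWeakDeriv_radSol (g : L2r) : IsWeakDeriv (radSol g) (radDeriv g) :=
  isWeakDeriv_primitive (integrable_radDeriv g _)

theorem isWeakDeriv_radFlux (g : L2r) : IsWeakDeriv (radFlux g) fun r => r • g r := by
  refine isWeakDeriv_congr ?_ .rfl (isWeakDeriv_primitive (integrableOn_smul_coe g))
  filter_upwards [ae_rMeasure_mem_Ioo] with r hr
  exact (radFlux_eq_intervalIntegral g (Ioo_subset_Icc_self hr)).symm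

theorem isWeakDeriv_radDeriv (g : L2r) :
    IsWeakDeriv (radDeriv g) fun r => g r - (r : ℂ)⁻¹ * radDeriv g r := by
  have inv_smooth : ContDiffOn ℝ (⊤ : ℕ∞) (fun r : ℝ => r⁻¹) (Ioo 0 1) :=
    contDiffOn_id.inv fun r hr => hr.1.ne'
  have product := (isWeakDeriv_radFlux g).smul inv_smooth
    ((continuous_radFlux g).locallyIntegrable.locallyIntegrableOn _)
    (integrableOn_smul_coe g).locallyIntegrableOn
  refine isWeakDeriv_congr (.of_forall fun r => ?_) ?_ product
  · simp [radDeriv_apply]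
  · filter_upwards [ae_rMeasure_mem_Ioo] with r hr
    have hr₀ : (r : ℂ) ≠ 0 := Complex.ofReal_ne_zero.2 hr.1.ne'
    simp only [deriv_inv, radDeriv_apply, Complex.real_smul]
    push_cast
    field_simp
    ring

section BoundedOperators

variable {α : Type*} [MeasurableSpace α] {μ : Measure α} [IsFiniteMeasure μ]

/-- The bounded operator on `L²` defined by a linear operation `A` with values in the bounded
functions. -/
def lpOfPointwise (A : Lp ℂ 2 μ →ₗ[ℂ] α → ℂ) (hmeas : ∀ g, AEStronglyMeasurable (A g) μ)
    (hbound : ∀ g, ∀ᵐ a ∂μ, ‖A g a‖ ≤ ‖g‖) : Lp ℂ 2 μ →L[ℂ] Lp ℂ 2 μ :=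
  have hA : ∀ g, MemLp (A g) 2 μ := fun g => .of_bound (hmeas g) ‖g‖ (hbound g)
  LinearMap.mkContinuous
    { toFun := fun g => (hA g).toLp
      map_add' := fun f g => by simp_rw [map_add]; exact MemLp.toLp_add (hA f) (hA g)
      map_smul' := fun c g => by simp_rw [map_smul]; exact MemLp.toLp_const_smul c (hA g) }
    (μ.real univ ^ (ENNReal.toReal 2)⁻¹) fun g => by
      refine Lp.norm_le_of_ae_bound (norm_nonneg _) ?_
      filter_upwards [(hA g).coeFn_toLp, hbound g] with a ha hga
      exact (congrArg norm ha).trans_le hga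

theorem coeFn_lpOfPointwise (A : Lp ℂ 2 μ →ₗ[ℂ] α → ℂ) (hmeas hbound) (g : Lp ℂ 2 μ) :
    lpOfPointwise A hmeas hbound g =ᵐ[μ] A g :=
  MemLp.coeFn_toLp (.of_bound (hmeas g) ‖g‖ (hbound g))

end BoundedOperators

/-- `radDeriv` as a bounded operator on `L²_r(0,1)`. -/
def opDeriv : L2r →L[ℂ] L2r :=
  lpOfPointwise radDeriv (fun g => (measurable_radDeriv g).aestronglyMeasurable)
    fun g => .of_forall (norm_radDeriv_le g)

/-- `radSol` as a bounded operator on `L²_r(0,1)`. -/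
def opSol : L2r →L[ℂ] L2r :=
  lpOfPointwise radSol (fun g => (continuous_radSol g).aestronglyMeasurable) fun g => by
    filter_upwards [ae_rMeasure_mem_Ioo] with r hr
    refine (norm_radSol_le g r).trans (mul_le_of_le_one_left (norm_nonneg g) ?_)
    rw [abs_of_pos hr.1]
    exact hr.2.le

theorem coeFn_opDeriv (g : L2r) : opDeriv g =ᵐ[rMeasure] radDeriv g :=
  coeFn_lpOfPointwise _ _ _ g

theorem coeFn_opSol (g : L2r) : opSol g =ᵐ[rMeasure] radSol g :=
  coeFn_lpOfPointwise _ _ _ g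

theorem lintegral_Ioi_inv_sq {s : ℝ} (hs : 0 < s) :
    ∫⁻ r in Ioi s, (ENNReal.ofReal r)⁻¹ ^ 2 = (ENNReal.ofReal s)⁻¹ := by
  have rpow_eq : ∀ r ∈ Ioi s, (ENNReal.ofReal r)⁻¹ ^ 2 = ENNReal.ofReal (r ^ (-2 : ℝ)) :=
    fun r (hr : s < r) => by
      rw [Real.rpow_neg (hs.trans hr).le, Real.rpow_ofNat, ← inv_pow,
        ENNReal.ofReal_pow (inv_nonneg.2 (hs.trans hr).le),
        ENNReal.ofReal_inv_of_pos (hs.trans hr)]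
  rw [setLIntegral_congr_fun measurableSet_Ioi rpow_eq,
    ← ofReal_integral_eq_lintegral_ofReal (integrableOn_Ioi_rpow_of_lt (by norm_num) hs)
      ((ae_restrict_mem measurableSet_Ioi).mono fun r hr => Real.rpow_nonneg (hs.trans hr).le _),
    integral_Ioi_rpow_of_lt (by norm_num) hs, ← ENNReal.ofReal_inv_of_pos hs,
    show (-2 + 1 : ℝ) = -1 by norm_num, Real.rpow_neg_one, div_neg, div_one, neg_neg]

theorem enorm_radFlux_sq_le (g : L2r) (r : ℝ) :
    ‖radFlux g r‖ₑ ^ 2 ≤ ENNReal.ofReal r *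
      ∫⁻ s in Iio r, (ENNReal.ofReal s * ‖g s‖ₑ) ^ 2 ∂volume.restrict (Ioo 0 1) := by
  have hmeas : AEMeasurable (fun s => ENNReal.ofReal s * ‖g s‖ₑ) (volume.restrict (Ioo 0 1)) :=
    ENNReal.measurable_ofReal.aemeasurable.mul
      (aestronglyMeasurable_rMeasure_iff.1 (Lp.aestronglyMeasurable g)).enorm
  calc ‖radFlux g r‖ₑ ^ 2
      ≤ (∫⁻ s in Iio r, ‖g s‖ₑ ∂rMeasure) ^ 2 := by
        gcongr
        exact enorm_integral_le_lintegral_enorm _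
    _ = (∫⁻ s in Iio r, ENNReal.ofReal s * ‖g s‖ₑ ∂volume.restrict (Ioo 0 1)) ^ 2 := by
        rw [setLIntegral_rMeasure _ measurableSet_Iio]
    _ ≤ _ := sq_lintegral_le_measure_mul_lintegral_sq hmeas.restrict
    _ ≤ _ := by
        gcongr
        rw [Measure.restrict_apply_univ, Measure.restrict_apply measurableSet_Iio, inter_comm,
          Ioo_inter_Iio, Real.volume_Ioo, sub_zero]
        exact ENNReal.ofReal_le_ofReal (min_le_right _ _)

theorem mul_enorm_inv_mul_radDeriv_sq_le (g : L2r) {r : ℝ} (hr : 0 < r) :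
    ENNReal.ofReal r * ‖(r : ℂ)⁻¹ * radDeriv g r‖ₑ ^ 2 ≤ (ENNReal.ofReal r)⁻¹ ^ 2 *
      ∫⁻ s in Iio r, (ENNReal.ofReal s * ‖g s‖ₑ) ^ 2 ∂volume.restrict (Ioo 0 1) := by
  have hcancel : ENNReal.ofReal r * (ENNReal.ofReal r)⁻¹ = 1 :=
    ENNReal.mul_inv_cancel (ENNReal.ofReal_pos.2 hr).ne' ENNReal.ofReal_ne_top
  have hinv : ‖(r : ℂ)⁻¹‖ₑ = (ENNReal.ofReal r)⁻¹ := by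
    rw [enorm_inv (Complex.ofReal_ne_zero.2 hr.ne'), ← ofReal_norm, Complex.norm_real,
      Real.norm_of_nonneg hr.le]
  have hflux := enorm_radFlux_sq_le g r
  set fluxBound := ∫⁻ s in Iio r, (ENNReal.ofReal s * ‖g s‖ₑ) ^ 2 ∂volume.restrict (Ioo 0 1)
  set x := ENNReal.ofReal r
  calc x * ‖(r : ℂ)⁻¹ * radDeriv g r‖ₑ ^ 2
      = x * x⁻¹ * (x⁻¹ ^ 3 * ‖radFlux g r‖ₑ ^ 2) := by
        rw [radDeriv_apply, enorm_mul, enorm_mul, hinv]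
        ring
    _ ≤ x * x⁻¹ * (x⁻¹ ^ 3 * (x * fluxBound)) := by gcongr
    _ = (x * x⁻¹) ^ 2 * (x⁻¹ ^ 2 * fluxBound) := by ring
    _ = x⁻¹ ^ 2 * fluxBound := by rw [hcancel, one_pow, one_mul]

theorem lintegral_enorm_inv_mul_radDeriv_sq_le (g : L2r) :
    ∫⁻ r : ℝ, ‖(r : ℂ)⁻¹ * radDeriv g r‖ₑ ^ 2 ∂rMeasure ≤ ∫⁻ r, ‖g r‖ₑ ^ 2 ∂rMeasure := by
  set k : ℝ → ENNReal := fun s => (ENNReal.ofReal s * ‖g s‖ₑ) ^ 2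
  have hk : AEMeasurable k (volume.restrict (Ioo 0 1)) :=
    (ENNReal.measurable_ofReal.aemeasurable.mul
      (aestronglyMeasurable_rMeasure_iff.1 (Lp.aestronglyMeasurable g)).enorm).pow_const 2
  calc ∫⁻ r : ℝ, ‖(r : ℂ)⁻¹ * radDeriv g r‖ₑ ^ 2 ∂rMeasure
      ≤ ∫⁻ r in Ioo 0 1, (ENNReal.ofReal r)⁻¹ ^ 2 *
          ∫⁻ s in Iio r, k s ∂volume.restrict (Ioo 0 1) := by
        rw [lintegral_rMeasure]
        exact setLIntegral_mono' measurableSet_Ioo fun r hr =>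
          mul_enorm_inv_mul_radDeriv_sq_le g hr.1
    _ = ∫⁻ s in Ioo 0 1,
          (∫⁻ r in Ioi s, (ENNReal.ofReal r)⁻¹ ^ 2 ∂volume.restrict (Ioo 0 1)) * k s :=
        lintegral_mul_setLIntegral_Iio (by fun_prop) hk
    _ ≤ ∫⁻ s in Ioo 0 1, (ENNReal.ofReal s)⁻¹ * k s := by
        refine setLIntegral_mono' measurableSet_Ioo fun s hs => ?_
        gcongr
        rw [← lintegral_Ioi_inv_sq hs.1]
        exact lintegral_mono' (Measure.restrict_mono_measure Measure.restrict_le_self _) le_rfl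
    _ = ∫⁻ r, ‖g r‖ₑ ^ 2 ∂rMeasure := by
        rw [lintegral_rMeasure]
        refine setLIntegral_congr_fun measurableSet_Ioo fun s hs => ?_
        simp only [k, mul_pow, ← mul_assoc, sq (ENNReal.ofReal s)]
        rw [ENNReal.inv_mul_cancel (ENNReal.ofReal_pos.2 hs.1).ne' ENNReal.ofReal_ne_top, one_mul]

/-- Hardy's inequality. -/
theorem memLp_inv_mul_radDeriv (g : L2r) :
    MemLp (fun r : ℝ => (r : ℂ)⁻¹ * radDeriv g r) 2 rMeasure := by
  have eLpNorm_lt_top_iff {f : ℝ → ℂ} :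
      eLpNorm f 2 rMeasure < ⊤ ↔ ∫⁻ r, ‖f r‖ₑ ^ 2 ∂rMeasure < ⊤ := by
    simpa using eLpNorm_lt_top_iff_lintegral_rpow_enorm_lt_top (p := 2) (f := f) (μ := rMeasure)
      (by simp) (by simp)
  exact ⟨(Complex.measurable_ofReal.inv.mul (measurable_radDeriv g)).aestronglyMeasurable,
    eLpNorm_lt_top_iff.2 <| (lintegral_enorm_inv_mul_radDeriv_sq_le g).trans_lt <|
      eLpNorm_lt_top_iff.1 (Lp.memLp g).2⟩

/-! ### The domain of the radial Laplacian -/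

theorem locallyIntegrableOn_coe (g : L2r) : LocallyIntegrableOn g (Ioo (0 : ℝ) 1) :=
  (locallyIntegrableOn_iff isOpen_Ioo.isLocallyClosed).2 fun _ hs hk =>
    integrableOn_compact g hk hs

/-- `H1r.val` as a bounded operator. -/
def valL : H1r →L[ℂ] L2r :=
  H1r.val.mkContinuous 1 fun p => by
    rw [one_mul]
    exact WithLp.norm_fst_le _ p.1

/-- `H1r.der` as a bounded operator. -/
def derL : H1r →L[ℂ] L2r :=
  H1r.der.mkContinuous 1 fun p => by
    rw [one_mul]
    exact WithLp.norm_snd_le _ p.1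

theorem H1r.norm_sq (p : H1r) : ‖p‖ ^ 2 = ‖H1r.val p‖ ^ 2 + ‖H1r.der p‖ ^ 2 :=
  WithLp.prod_norm_sq_eq_of_L2 p.1

theorem H1r.isWeakDeriv (p : H1r) : IsWeakDeriv (H1r.val p) (H1r.der p) := p.2

theorem L2r.coeFn_one : L2r.one =ᵐ[rMeasure] fun _ => (1 : ℂ) :=
  (memLp_of_continuous continuous_const).coeFn_toLp

@[simp] theorem H1r.val_one : H1r.val H1r.one = L2r.one := rfl

@[simp] theorem H1r.der_one : H1r.der H1r.one = 0 :=
  MemLp.toLp_zero (memLp_of_continuous continuous_const)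

theorem H1r.val_lift (f : LinearMap.range H1r.val) : H1r.val (H1r.lift f) = f :=
  congrArg Subtype.val (H1r.lift.symm_apply_apply f)

theorem H1r.eq_smul_one_of_der_eq_zero (p : H1r) (hp : H1r.der p = 0) :
    ∃ c : ℂ, p = c • H1r.one := by
  obtain ⟨c, hc⟩ := ae_eq_const_of_isWeakDeriv_zero (locallyIntegrableOn_coe (H1r.val p)) <|
    isWeakDeriv_congr .rfl (Lp.coeFn_zero ℂ 2 rMeasure) (hp ▸ p.isWeakDeriv)
  refine ⟨c, H1r.val_injective (Lp.ext ?_)⟩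
  rw [map_smul, H1r.val_one]
  filter_upwards [hc, Lp.coeFn_smul c L2r.one, L2r.coeFn_one] with r hp_r hsmul hone
  rw [hp_r, hsmul, Pi.smul_apply, hone, smul_eq_mul, mul_one]

/-- The operator `g ↦ φ`, where `φ` is the solution of `r⁻¹ (r φ_r)_r = g` that is regular at the
origin and vanishes there, with values in `H¹_r(0,1)`. -/
def opSolH1 : L2r →L[ℂ] H1r :=
  ContinuousLinearMap.codRestrict
    ((WithLp.prodContinuousLinearEquiv 2 ℂ L2r L2r).symm.toContinuousLinearMap ∘L
      opSol.prod opDeriv) H1Sub fun g =>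
    isWeakDeriv_congr (coeFn_opSol g).symm (coeFn_opDeriv g).symm (isWeakDeriv_radSol g)

@[simp] theorem val_opSolH1 (g : L2r) : H1r.val (opSolH1 g) = opSol g := rfl

@[simp] theorem der_opSolH1 (g : L2r) : H1r.der (opSolH1 g) = opDeriv g := rfl

/-- The function `r⁻¹ φ_r` for the solution `φ` of `r⁻¹ (r φ_r)_r = g`. -/
def divDeriv (g : L2r) : L2r := (memLp_inv_mul_radDeriv g).toLp _

theorem coeFn_divDeriv (g : L2r) :
    divDeriv g =ᵐ[rMeasure] fun r => (r : ℂ)⁻¹ * radDeriv g r := MemLp.coeFn_toLp _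

theorem isWeakDeriv_opDeriv (g : L2r) : IsWeakDeriv (opDeriv g) (g - divDeriv g : L2r) := by
  refine isWeakDeriv_congr (coeFn_opDeriv g).symm ?_ (isWeakDeriv_radDeriv g)
  filter_upwards [Lp.coeFn_sub g (divDeriv g), coeFn_divDeriv g] with r hsub hdiv
  rw [hsub, Pi.sub_apply, hdiv]

/-- The derivative `φ_r` of the solution `φ` of `r⁻¹ (r φ_r)_r = g`, as an element of
`H¹_r(0,1)`. -/
def derivH1 (g : L2r) : H1r := ⟨WithLp.toLp 2 (opDeriv g, g - divDeriv g), isWeakDeriv_opDeriv g⟩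

theorem opDeriv_mem_divDomain (g : L2r) : opDeriv g ∈ divDomain := by
  refine (memLp_congr_ae ?_).1 (memLp_inv_mul_radDeriv g)
  filter_upwards [coeFn_opDeriv g] with r hr
  rw [hr]

theorem not_memLp_inv_mul {C : ℂ} (hC : C ≠ 0) :
    ¬ MemLp (fun r : ℝ => (r : ℂ)⁻¹ * C) 2 rMeasure := by
  intro h
  rw [memLp_two_iff_integrable_sq_norm h.1, integrable_rMeasure_iff] at h
  have inv_integrable : IntegrableOn (fun r : ℝ => r⁻¹) (Ioo 0 1) := by
    refine IntegrableOn.congr_fun (h.smul (‖C‖ ^ 2)⁻¹) (fun r hr => ?_) measurableSet_Ioo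
    have hr₀ := hr.1.ne'
    have hC₀ : ‖C‖ ≠ 0 := norm_ne_zero_iff.2 hC
    simp only [Pi.smul_apply, smul_eq_mul, norm_mul, norm_inv, Complex.norm_real,
      Real.norm_of_nonneg hr.1.le]
    field_simp
  rw [← intervalIntegrable_iff_integrableOn_Ioo_of_le zero_le_one,
    intervalIntegrable_inv_iff] at inv_integrable
  simp at inv_integrable

/-- The flux `r v` is a primitive of `r (v_r + v/r)`, hence equals `∫₀ʳ s (v_s + v/s) ds` up to a
constant `C`; this constant is `0`, because `C/r` is not square integrable. -/
theorem H1r.val_eq_opDeriv (v : H1r) {q : L2r}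
    (hq : q =ᵐ[rMeasure] fun r : ℝ => (r : ℂ)⁻¹ * H1r.val v r) :
    H1r.val v = opDeriv (H1r.der v + q) := by
  set g := H1r.der v + q with hg
  have flux_deriv : IsWeakDeriv (fun r : ℝ => r • H1r.val v r) fun r => r • g r := by
    refine isWeakDeriv_congr .rfl ?_ (v.isWeakDeriv.smul (a := id) contDiffOn_id
      (locallyIntegrableOn_coe _) (locallyIntegrableOn_coe _))
    filter_upwards [hq, Lp.coeFn_add (H1r.der v) q, ae_rMeasure_mem_Ioo] with r hq_r hadd hr
    have hr₀ : (r : ℂ) ≠ 0 := Complex.ofReal_ne_zero.2 hr.1.ne'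
    simp only [deriv_id, id, one_smul, hg, hadd, Pi.add_apply, hq_r, Complex.real_smul]
    field_simp
    ring
  obtain ⟨C, hC⟩ := flux_deriv.ae_eq_add_const
    ((locallyIntegrableOn_coe (H1r.val v)).continuousOn_smul
      isOpen_Ioo.isLocallyClosed continuousOn_id)
    ((continuous_radFlux g).locallyIntegrable.locallyIntegrableOn _)
    (integrableOn_smul_coe g).locallyIntegrableOn (isWeakDeriv_radFlux g)
  have remainder : (H1r.val v - opDeriv g : L2r) =ᵐ[rMeasure] fun r : ℝ => (r : ℂ)⁻¹ * C := by
    filter_upwards [hC, Lp.coeFn_sub (H1r.val v) (opDeriv g), coeFn_opDeriv g,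
      ae_rMeasure_mem_Ioo] with r hC_r hsub hop hr
    have hr₀ : (r : ℂ) ≠ 0 := Complex.ofReal_ne_zero.2 hr.1.ne'
    rw [id, Complex.real_smul, ← eq_inv_mul_iff_mul_eq₀ hr₀] at hC_r
    rw [hsub, Pi.sub_apply, hop, hC_r, radDeriv_apply]
    ring
  obtain rfl : C = 0 := by
    by_contra hC₀
    exact not_memLp_inv_mul hC₀ ((memLp_congr_ae remainder).1 (Lp.memLp _))
  simp only [mul_zero] at remainder
  exact sub_eq_zero.1 (Lp.ext (remainder.trans (Lp.coeFn_zero ℂ 2 rMeasure).symm))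

theorem mem_Y_of_phi_eq {u : X} {c : ℂ} {g : L2r} {ζ : H1r}
    (hφ : X.phi u = c • H1r.one + opSolH1 g) (hζ : X.zeta u = H1r.val ζ) : u ∈ Y := by
  have hφ' : H1r.der (X.phi u) = opDeriv g := by simp [hφ]
  have hdiv : H1r.der (X.phi u) ∈ divDomain := hφ' ▸ opDeriv_mem_divDomain g
  exact ⟨⟨⟨derivH1 g, hφ'.symm⟩, ζ, hζ.symm⟩, hdiv⟩

theorem val_zetaH1 (u : Y) : H1r.val (zetaH1 u) = X.zeta u := H1r.val_lift _

theorem coeFn_phiRDivR (u : Y) :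
    phiRDivR u =ᵐ[rMeasure] fun r : ℝ => (r : ℂ)⁻¹ * H1r.der (X.phi u) r :=
  (memLp_div ⟨H1r.der (X.phi u.1), u.2.2⟩).coeFn_toLp

theorem exists_phi_eq (u : Y) :
    ∃ c : ℂ, X.phi u = c • H1r.one + opSolH1 (phiRR u + phiRDivR u) := by
  set v : H1r := H1r.lift ⟨H1r.der (X.phi u.1), u.2.1.1⟩
  have hv : H1r.val v = H1r.der (X.phi u.1) := H1r.val_lift _
  have hval : H1r.val v = opDeriv (phiRR u + phiRDivR u) :=
    v.val_eq_opDeriv (by rw [hv]; exact coeFn_phiRDivR u)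
  obtain ⟨c, hc⟩ := (X.phi u.1 - opSolH1 (phiRR u + phiRDivR u)).eq_smul_one_of_der_eq_zero
    (by rw [map_sub, der_opSolH1, ← hval, hv, sub_self])
  exact ⟨c, sub_eq_iff_eq_add.1 hc⟩

theorem phiRR_add_phiRDivR_eq (u : Y) {c : ℂ} {g : L2r}
    (hφ : X.phi u = c • H1r.one + opSolH1 g) : phiRR u + phiRDivR u = g := by
  have hφ' : H1r.der (X.phi u) = opDeriv g := by simp [hφ]
  have hrr : phiRR u = g - divDeriv g := by
    have hlift : H1r.lift ⟨H1r.der (X.phi u.1), u.2.1.1⟩ = derivH1 g :=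
      H1r.val_injective ((H1r.val_lift _).trans hφ')
    exact congrArg H1r.der hlift
  have hdiv : phiRDivR u = divDeriv g := by
    refine Lp.ext ((coeFn_phiRDivR u).trans ?_)
    filter_upwards [coeFn_divDeriv g, coeFn_opDeriv g] with r hdiv hop
    rw [hdiv, hφ', hop]
  rw [hrr, hdiv, sub_add_cancel]

theorem rMeasure_restrict_Iio_one : rMeasure.restrict (Iio 1) = rMeasure :=
  Measure.restrict_eq_self_of_ae_mem (ae_rMeasure_mem_Ioo.mono fun _ hr => hr.2)

theorem radDeriv_one (g : L2r) : radDeriv g 1 = mean g := by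
  rw [radDeriv_apply, radFlux_apply, Complex.ofReal_one, inv_one, one_mul,
    rMeasure_restrict_Iio_one]
  rfl

theorem hasTraceOne_opDeriv_iff (g : L2r) (a : ℂ) : HasTraceOne (opDeriv g) a ↔ mean g = a := by
  have hcont : ContinuousOn (radDeriv g) (Ioc 0 1) :=
    (continuousOn_radDeriv g).mono fun r hr => hr.1.ne'
  constructor
  · rintro ⟨f, hf, hfg, rfl⟩
    have hIoo : EqOn f (radDeriv g) (Ioo 0 1) :=
      Measure.eqOn_open_of_ae_eq (ae_rMeasure_iff.1 (hfg.trans (coeFn_opDeriv g))) isOpen_Ioo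
        (hf.mono Ioo_subset_Ioc_self) (hcont.mono Ioo_subset_Ioc_self)
    have hIoc : EqOn f (radDeriv g) (Ioc 0 1) :=
      hIoo.of_subset_closure hf hcont Ioo_subset_Ioc_self
        (closure_Ioo (zero_ne_one' ℝ) ▸ Ioc_subset_Icc_self)
    rw [← radDeriv_one, hIoc ⟨zero_lt_one, le_rfl⟩]
  · rintro rfl
    exact ⟨radDeriv g, hcont, (coeFn_opDeriv g).symm, radDeriv_one g⟩

theorem integral_norm_le (g : L2r) : ∫ r, ‖g r‖ ∂rMeasure ≤ ‖g‖ := by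
  have h := setIntegral_Iio_norm_le g 1
  rwa [abs_one, one_mul, rMeasure_restrict_Iio_one] at h

/-- `mean` as a bounded functional. -/
def meanL : L2r →L[ℂ] ℂ :=
  mean.mkContinuous 1 fun g => by
    rw [one_mul]
    exact (norm_integral_le_integral_norm _).trans (integral_norm_le g)

/-- `moment` as a bounded functional. -/
def momentL : L2r →L[ℂ] ℂ :=
  moment.mkContinuous 1 fun g => by
    rw [one_mul]
    refine (norm_integral_le_of_norm_le (integrable_coe g).norm ?_).trans (integral_norm_le g)
    filter_upwards [ae_rMeasure_mem_Ioo] with r hr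
    rw [norm_mul, Complex.norm_real, Real.norm_of_nonneg hr.1.le]
    exact mul_le_of_le_one_left (norm_nonneg _) hr.2.le

@[simp] theorem meanL_apply (g : L2r) : meanL g = mean g := rfl

@[simp] theorem momentL_apply (g : L2r) : momentL g = moment g := rfl

/-! ### Powers of `r` -/

/-- The function `r ↦ r ^ k` in `L²_r(0,1)`. -/
def powL2 (k : ℕ) : L2r :=
  (memLp_of_continuous (f := fun r : ℝ => (r : ℂ) ^ k) (by fun_prop)).toLp _

theorem coeFn_powL2 (k : ℕ) : powL2 k =ᵐ[rMeasure] fun r => (r : ℂ) ^ k := MemLp.coeFn_toLp _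

theorem powL2_zero : powL2 0 = L2r.one := by
  refine Lp.ext ?_
  filter_upwards [coeFn_powL2 0, L2r.coeFn_one] with r hpow hone
  rw [hpow, hone, pow_zero]

theorem radFlux_powL2 (k : ℕ) {r : ℝ} (hr : r ∈ Icc (0 : ℝ) 1) :
    radFlux (powL2 k) r = (r : ℂ) ^ (k + 2) / (k + 2) := by
  have hae : ∀ᵐ s ∂volume.restrict (Ioo 0 r),
      s • powL2 k s = ((s ^ (k + 1) : ℝ) : ℂ) := by
    filter_upwards [ae_restrict_of_ae_restrict_of_subset (Ioo_subset_Ioo_right hr.2)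
      (ae_rMeasure_iff.1 (coeFn_powL2 k))] with s hs
    rw [hs, Complex.real_smul]
    push_cast
    ring
  rw [radFlux_eq_intervalIntegral _ hr, intervalIntegral_eq_setIntegral_Ioo _ hr.1,
    integral_congr_ae hae, ← intervalIntegral_eq_setIntegral_Ioo _ hr.1,
    intervalIntegral.integral_ofReal, integral_pow]
  push_cast
  ring

theorem radDeriv_powL2 (k : ℕ) {r : ℝ} (hr : r ∈ Icc (0 : ℝ) 1) :
    radDeriv (powL2 k) r = (r : ℂ) ^ (k + 1) / (k + 2) := by
  rw [radDeriv_apply, radFlux_powL2 k hr]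
  rcases eq_or_ne (r : ℂ) 0 with hr₀ | hr₀
  · simp [hr₀]
  · field_simp
    ring

theorem radSol_powL2 (k : ℕ) {r : ℝ} (hr : r ∈ Icc (0 : ℝ) 1) :
    radSol (powL2 k) r = (r : ℂ) ^ (k + 2) / (k + 2) ^ 2 := by
  have hderiv : EqOn (radDeriv (powL2 k)) (fun t => ((t ^ (k + 1) / (k + 2) : ℝ) : ℂ))
      (uIcc 0 r) := fun t ht => by
    rw [uIcc_of_le hr.1] at ht
    simp only [radDeriv_powL2 k (Icc_subset_Icc_right hr.2 ht)]
    push_cast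
    ring
  rw [radSol_apply, intervalIntegral.integral_congr hderiv, intervalIntegral.integral_ofReal,
    intervalIntegral.integral_div, integral_pow]
  push_cast
  field_simp
  ring

theorem opDeriv_powL2 (k : ℕ) : opDeriv (powL2 k) = ((k : ℂ) + 2)⁻¹ • powL2 (k + 1) := by
  refine Lp.ext ?_
  filter_upwards [coeFn_opDeriv (powL2 k), Lp.coeFn_smul ((k : ℂ) + 2)⁻¹ (powL2 (k + 1)),
    coeFn_powL2 (k + 1), ae_rMeasure_mem_Ioo] with r hop hsmul hpow hr
  rw [hop, hsmul, Pi.smul_apply, hpow, radDeriv_powL2 k (Ioo_subset_Icc_self hr), smul_eq_mul,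
    div_eq_inv_mul]

theorem opSol_powL2 (k : ℕ) : opSol (powL2 k) = (((k : ℂ) + 2) ^ 2)⁻¹ • powL2 (k + 2) := by
  refine Lp.ext ?_
  filter_upwards [coeFn_opSol (powL2 k), Lp.coeFn_smul (((k : ℂ) + 2) ^ 2)⁻¹ (powL2 (k + 2)),
    coeFn_powL2 (k + 2), ae_rMeasure_mem_Ioo] with r hop hsmul hpow hr
  rw [hop, hsmul, Pi.smul_apply, hpow, radSol_powL2 k (Ioo_subset_Icc_self hr), smul_eq_mul,
    div_eq_inv_mul]

theorem mean_powL2 (k : ℕ) : mean (powL2 k) = ((k : ℂ) + 2)⁻¹ := by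
  rw [← radDeriv_one, radDeriv_powL2 k ⟨zero_le_one, le_rfl⟩, Complex.ofReal_one, one_pow, one_div]

theorem mean_one : mean L2r.one = 2⁻¹ := by
  rw [← powL2_zero, mean_powL2, Nat.cast_zero, zero_add]

theorem inner_eq_integral (f g : L2r) : ⟪f, g⟫_ℂ = ∫ r, conj (f r) * g r ∂rMeasure := by
  simp only [L2.inner_def, RCLike.inner_apply']

theorem inner_powL2_left (k : ℕ) (f : L2r) :
    ⟪powL2 k, f⟫_ℂ = ∫ r : ℝ, (r : ℂ) ^ k * f r ∂rMeasure := by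
  rw [inner_eq_integral]
  refine integral_congr_ae ?_
  filter_upwards [coeFn_powL2 k] with r hr
  rw [hr, map_pow, Complex.conj_ofReal]

theorem inner_powL2_zero_left (f : L2r) : ⟪powL2 0, f⟫_ℂ = mean f := by
  simp only [inner_powL2_left, pow_zero, one_mul]
  rfl

theorem inner_powL2_one_left (f : L2r) : ⟪powL2 1, f⟫_ℂ = moment f := by
  simp only [inner_powL2_left, pow_one]
  rfl

theorem inner_powL2_powL2 (j k : ℕ) : ⟪powL2 j, powL2 k⟫_ℂ = ((j : ℂ) + k + 2)⁻¹ := by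
  have hmean := mean_powL2 (j + k)
  rw [Nat.cast_add] at hmean
  rw [← hmean, inner_powL2_left]
  refine integral_congr_ae ?_
  filter_upwards [coeFn_powL2 k, coeFn_powL2 (j + k)] with r hk hjk
  rw [hk, hjk, pow_add]

theorem moment_powL2 (k : ℕ) : moment (powL2 k) = ((k : ℂ) + 3)⁻¹ := by
  rw [← inner_powL2_one_left, inner_powL2_powL2]
  push_cast
  ring

theorem norm_powL2_sq (k : ℕ) : ‖powL2 k‖ ^ 2 = (2 * (k : ℝ) + 2)⁻¹ := by
  have h := inner_powL2_powL2 k k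
  rw [inner_self_eq_norm_sq_to_K, ← two_mul] at h
  apply Complex.ofReal_injective
  push_cast
  exact h

/-! ### Green's identity and the trace at `r = 1` -/

theorem integrableOn_Ioo_coe (h : L2r) {a : ℝ} (ha : 0 < a) : IntegrableOn h (Ioo a 1) := by
  have hsub : Ioo a 1 ⊆ Ioo 0 1 := Ioo_subset_Ioo_left ha.le
  refine (((integrableOn_smul_coe h).mono_set hsub).norm.const_mul a⁻¹).mono'
    ((aestronglyMeasurable_rMeasure_iff.1 (Lp.aestronglyMeasurable h)).mono_set hsub) ?_
  filter_upwards [ae_restrict_mem measurableSet_Ioo] with r hr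
  rw [norm_smul, ← mul_assoc, Real.norm_of_nonneg (ha.trans hr.1).le]
  exact le_mul_of_one_le_left (norm_nonneg _) ((one_le_inv_mul₀ ha).2 hr.1.le)

theorem continuousOn_tail (h : L2r) : ContinuousOn (fun r => ∫ s in r..1, h s) (Ioo 0 1) := by
  intro r hr
  have hle : r / 2 ≤ 1 := by linarith [hr.1, hr.2]
  have hcont := intervalIntegral.continuousOn_primitive_interval_left (a := r / 2) (b := 1)
    (μ := volume) (f := h) (by
      rw [uIcc_of_le hle, integrableOn_Icc_iff_integrableOn_Ioo]
      exact integrableOn_Ioo_coe h (half_pos hr.1))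
  rw [uIcc_of_le hle] at hcont
  exact (hcont.continuousAt (Icc_mem_nhds (half_lt_self hr.1) hr.2)).continuousWithinAt

theorem H1r.exists_ae_eq_sub_tail (ψ : H1r) :
    ∃ C : ℂ, H1r.val ψ =ᵐ[rMeasure] fun r => C - ∫ s in r..1, H1r.der ψ s := by
  have tail := isWeakDeriv_tail (h := fun s => -H1r.der ψ s)
    (aestronglyMeasurable_rMeasure_iff.1 (Lp.aestronglyMeasurable (H1r.der ψ))).neg
    (by simp only [smul_neg]; exact (integrableOn_smul_coe (H1r.der ψ)).neg)
  simp only [intervalIntegral.integral_neg, neg_neg] at tail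
  obtain ⟨C, hC⟩ := ψ.isWeakDeriv.ae_eq_add_const (locallyIntegrableOn_coe _)
    ((continuousOn_tail (H1r.der ψ)).neg.locallyIntegrableOn measurableSet_Ioo)
    (locallyIntegrableOn_coe _) tail
  exact ⟨C, by simpa only [sub_eq_add_neg, Pi.neg_apply] using hC⟩

theorem inner_opDeriv_eq_integral_tail (f g : L2r) :
    ⟪f, opDeriv g⟫_ℂ = ∫ r, conj (∫ s in r..1, f s) * g r ∂rMeasure := by
  have hf : AEStronglyMeasurable (fun s => conj (f s)) (volume.restrict (Ioo 0 1)) :=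
    aestronglyMeasurable_rMeasure_iff.1 (Lp.aestronglyMeasurable f).star
  have hw : IntegrableOn (fun s => ‖conj (f s)‖ * (|s| * ‖g‖)) (Ioo 0 1) := by
    refine ((integrableOn_smul_coe f).norm.mul_const ‖g‖).congr (.of_forall fun s => ?_)
    simp only [norm_smul, Real.norm_eq_abs, RCLike.norm_conj]
    ring
  calc ⟪f, opDeriv g⟫_ℂ
      = ∫ s in Ioo (0 : ℝ) 1, conj (f s) * ∫ r in Iio s, g r ∂rMeasure := by
        rw [inner_eq_integral, integral_rMeasure]
        refine integral_congr_ae ?_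
        filter_upwards [ae_restrict_mem measurableSet_Ioo, ae_rMeasure_iff.1 (coeFn_opDeriv g)]
          with s hs hop
        have hs₀ : (s : ℂ) ≠ 0 := Complex.ofReal_ne_zero.2 hs.1.ne'
        rw [hop, radDeriv_apply, radFlux_apply, Complex.real_smul]
        field_simp
    _ = ∫ r, (∫ s in Ioi r, conj (f s) ∂volume.restrict (Ioo 0 1)) * g r ∂rMeasure :=
        integral_mul_setIntegral_Iio hf (integrable_coe g) hw
          (.of_forall (setIntegral_Iio_norm_le g))
    _ = ∫ r, conj (∫ s in r..1, f s) * g r ∂rMeasure := by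
        refine integral_congr_ae ?_
        filter_upwards [ae_rMeasure_mem_Ioo] with r hr
        rw [integral_conj, setIntegral_Ioi_restrict_Ioo _ (Ioo_subset_Icc_self hr)]

theorem exists_inner_der_opDeriv_eq (ψ : H1r) : ∃ C : ℂ, ∀ g : L2r,
    ⟪H1r.der ψ, opDeriv g⟫_ℂ = conj C * mean g - ⟪H1r.val ψ, g⟫_ℂ := by
  obtain ⟨C, hC⟩ := ψ.exists_ae_eq_sub_tail
  refine ⟨C, fun g => ?_⟩
  have hinner : Integrable (fun r => conj (H1r.val ψ r) * g r) rMeasure := by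
    simpa only [RCLike.inner_apply'] using L2.integrable_inner (𝕜 := ℂ) (H1r.val ψ) g
  change _ = conj C * ∫ r, g r ∂rMeasure - _
  rw [inner_opDeriv_eq_integral_tail, inner_eq_integral, ← integral_const_mul,
    ← integral_sub ((integrable_coe g).const_mul _) hinner]
  refine integral_congr_ae ?_
  filter_upwards [hC] with r hr
  rw [hr, map_sub]
  ring

/-- The trace `ψ ↦ ψ|_{r=1}`, written as `∫₀¹ (r² ψ)_r dr`. -/
def traceOne : H1r →L[ℂ] ℂ := momentL ∘L derL + (2 : ℂ) • meanL ∘L valL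

theorem traceOne_apply (ψ : H1r) :
    traceOne ψ = moment (H1r.der ψ) + 2 * mean (H1r.val ψ) := rfl

/-- Green's identity. The boundary term is identified by testing with the constant `g = 1`. -/
theorem inner_der_opDeriv (ψ : H1r) (g : L2r) :
    ⟪H1r.der ψ, opDeriv g⟫_ℂ = conj (traceOne ψ) * mean g - ⟪H1r.val ψ, g⟫_ℂ := by
  obtain ⟨C, hC⟩ := exists_inner_der_opDeriv_eq ψ
  suffices C = traceOne ψ from this ▸ hC g
  have hone := congrArg conj (hC (powL2 0))
  rw [opDeriv_powL2, inner_smul_right, mean_powL2] at hone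
  simp only [zero_add, map_sub, map_mul, map_inv₀, inner_conj_symm, inner_powL2_zero_left,
    inner_powL2_one_left, Complex.conj_conj, Nat.cast_zero, Complex.conj_ofNat] at hone
  rw [traceOne_apply]
  linear_combination -2 * hone

theorem conj_traceOne_eq (ψ : H1r) (m : ℕ) : conj (traceOne ψ) =
    ⟪H1r.der ψ, powL2 (m + 1)⟫_ℂ + (m + 2) * ⟪H1r.val ψ, powL2 m⟫_ℂ := by
  have green := inner_der_opDeriv ψ (powL2 m)
  have hm : (m : ℂ) + 2 ≠ 0 := by exact_mod_cast (m + 1).succ_ne_zero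
  rw [opDeriv_powL2, mean_powL2, inner_smul_right] at green
  field_simp at green
  linear_combination -green

theorem norm_powL2_le {a : ℝ} (ha : 0 < a) {k : ℕ} (hk : a ≤ 2 * k + 2) : ‖powL2 k‖ ≤ (√a)⁻¹ := by
  rw [← Real.sqrt_inv]
  refine Real.le_sqrt_of_sq_le ?_
  rw [norm_powL2_sq]
  exact inv_anti₀ ha hk

theorem norm_traceOne_mul_sqrt_le (ψ : H1r) (m : ℕ) :
    ‖traceOne ψ‖ * √(m + 2) ≤ (m + 2) * ‖H1r.val ψ‖ + ‖H1r.der ψ‖ := by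
  have hm : (0 : ℝ) < m + 2 := by positivity
  have hm_norm : ‖(m : ℂ) + 2‖ = m + 2 := by exact_mod_cast Complex.norm_natCast (m + 2)
  rw [← le_div_iff₀ (Real.sqrt_pos.2 hm), div_eq_mul_inv]
  calc ‖traceOne ψ‖
      = ‖⟪H1r.der ψ, powL2 (m + 1)⟫_ℂ + (m + 2) * ⟪H1r.val ψ, powL2 m⟫_ℂ‖ := by
        rw [← conj_traceOne_eq, RCLike.norm_conj]
    _ ≤ ‖H1r.der ψ‖ * ‖powL2 (m + 1)‖ + (m + 2) * (‖H1r.val ψ‖ * ‖powL2 m‖) := by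
        refine (norm_add_le _ _).trans (add_le_add (norm_inner_le_norm _ _) ?_)
        rw [norm_mul, hm_norm]
        gcongr
        exact norm_inner_le_norm _ _
    _ ≤ ‖H1r.der ψ‖ * (√(m + 2))⁻¹ + (m + 2) * (‖H1r.val ψ‖ * (√(m + 2))⁻¹) := by
        gcongr <;> exact norm_powL2_le hm (by push_cast; linarith)
    _ = ((m + 2) * ‖H1r.val ψ‖ + ‖H1r.der ψ‖) * (√(m + 2))⁻¹ := by ring

/-! ### The regular solution of Bessel's equation -/

theorem integral_mul_pow_Iio_rMeasure (M : ℝ) (j : ℕ) {r : ℝ} (hr : r ∈ Icc (0 : ℝ) 1) :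
    ∫ s in Iio r, M * s ^ j ∂rMeasure = M / (j + 2) * r ^ (j + 2) := by
  have hpow : (fun s : ℝ => s • (M * s ^ j)) = fun s => M * s ^ (j + 1) := by
    ext s
    rw [smul_eq_mul]
    ring
  rw [setIntegral_rMeasure _ measurableSet_Iio, ← Measure.restrict_restrict measurableSet_Iio,
    setIntegral_Iio_restrict_Ioo _ hr, hpow, intervalIntegral.integral_const_mul, integral_pow]
  push_cast
  field_simp
  ring

section PolynomialBound

variable {f : L2r} {M : ℝ} {j : ℕ}

theorem norm_radFlux_le_mul_pow (hf : ∀ᵐ r ∂rMeasure, ‖f r‖ ≤ M * r ^ j) {r : ℝ}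
    (hr : r ∈ Icc (0 : ℝ) 1) : ‖radFlux f r‖ ≤ M / (j + 2) * r ^ (j + 2) := by
  have hint : Integrable (fun s => M * s ^ j) rMeasure :=
    integrable_rMeasure_iff.2 <|
      (by fun_prop : Continuous fun s : ℝ => s • (M * s ^ j)).integrableOn_Icc.mono_set
        Ioo_subset_Icc_self
  rw [radFlux_apply, ← integral_mul_pow_Iio_rMeasure M j hr]
  exact norm_integral_le_of_norm_le hint.integrableOn (ae_restrict_of_ae hf)

theorem norm_radDeriv_le_mul_pow (hf : ∀ᵐ r ∂rMeasure, ‖f r‖ ≤ M * r ^ j) {r : ℝ}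
    (hr : r ∈ Ioc (0 : ℝ) 1) : ‖radDeriv f r‖ ≤ M / (j + 2) * r ^ (j + 1) := by
  rw [radDeriv_apply, norm_mul, norm_inv, Complex.norm_real, Real.norm_of_nonneg hr.1.le,
    inv_mul_le_iff₀ hr.1]
  exact (norm_radFlux_le_mul_pow hf (Ioc_subset_Icc_self hr)).trans_eq (by ring)

theorem norm_radSol_le_mul_pow (hf : ∀ᵐ r ∂rMeasure, ‖f r‖ ≤ M * r ^ j) {r : ℝ}
    (hr : r ∈ Icc (0 : ℝ) 1) : ‖radSol f r‖ ≤ M / (j + 2) ^ 2 * r ^ (j + 2) := by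
  have hprimitive : ∫ s in (0 : ℝ)..r, M / (j + 2) * s ^ (j + 1) =
      M / (j + 2) ^ 2 * r ^ (j + 2) := by
    rw [intervalIntegral.integral_const_mul, integral_pow]
    push_cast
    field_simp
    ring
  rw [radSol_apply, ← hprimitive]
  refine intervalIntegral.norm_integral_le_of_norm_le hr.1 (.of_forall fun s hs => ?_)
    ((by fun_prop : Continuous fun s : ℝ => M / (j + 2) * s ^ (j + 1)).intervalIntegrable _ _)
  exact norm_radDeriv_le_mul_pow hf ⟨hs.1, hs.2.trans hr.2⟩

end PolynomialBound

theorem norm_opSol_pow_apply_le (g : L2r) (n : ℕ) :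
    ∀ᵐ r ∂rMeasure, ‖(opSol ^ (n + 1)) g r‖ ≤ ‖g‖ / n.factorial * r ^ n := by
  induction n with
  | zero =>
    filter_upwards [coeFn_opSol g, ae_rMeasure_mem_Ioo] with r hop hr
    have hr_le : |r| ≤ 1 := by rw [abs_of_pos hr.1]; exact hr.2.le
    rw [zero_add, pow_one, hop, Nat.factorial_zero, Nat.cast_one, div_one, pow_zero, mul_one]
    exact (norm_radSol_le g r).trans (mul_le_of_le_one_left (norm_nonneg _) hr_le)
  | succ n ih =>
    filter_upwards [coeFn_opSol ((opSol ^ (n + 1)) g), ae_rMeasure_mem_Ioo] with r hop hr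
    have hr₀ := hr.1.le
    rw [pow_succ' opSol (n + 1), mul_apply_eq_comp, hop]
    calc ‖radSol ((opSol ^ (n + 1)) g) r‖
        ≤ ‖g‖ / n.factorial / (n + 2) ^ 2 * r ^ (n + 2) :=
          norm_radSol_le_mul_pow ih (Ioo_subset_Icc_self hr)
      _ ≤ ‖g‖ / n.factorial / (n + 1) * r ^ (n + 1) := by
          gcongr ‖g‖ / n.factorial / ?_ * ?_
          · nlinarith [(Nat.cast_nonneg n : (0 : ℝ) ≤ n)]
          · exact pow_le_pow_of_le_one hr₀ hr.2.le (Nat.le_succ _)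
      _ = ‖g‖ / (n + 1).factorial * r ^ (n + 1) := by
          rw [Nat.factorial_succ, div_div, mul_comm (n.factorial : ℝ)]
          push_cast
          rfl

theorem exists_norm_opSol_pow_le : ∃ M : ℝ, ∀ n : ℕ, ‖opSol ^ (n + 1)‖ ≤ M / n.factorial := by
  refine ⟨rMeasure.real univ ^ (ENNReal.toReal 2)⁻¹, fun n => ?_⟩
  refine ContinuousLinearMap.opNorm_le_bound _ (by positivity) fun g => ?_
  rw [div_mul_eq_mul_div, mul_div_assoc]
  refine Lp.norm_le_of_ae_bound (by positivity) ?_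
  filter_upwards [norm_opSol_pow_apply_le g n, ae_rMeasure_mem_Ioo] with r hpow hr
  exact hpow.trans (mul_le_of_le_one_right (by positivity) (pow_le_one₀ hr.1.le hr.2.le))

theorem summable_smul_opSol_pow (w : ℂ) : Summable fun n : ℕ => (w • opSol) ^ n := by
  obtain ⟨M, hM⟩ := exists_norm_opSol_pow_le
  rw [← summable_nat_add_iff 1]
  refine .of_norm_bounded ((Real.summable_pow_div_factorial ‖w‖).mul_left (M * ‖w‖)) fun n => ?_
  rw [smul_pow, norm_smul, norm_pow]
  calc ‖w‖ ^ (n + 1) * ‖opSol ^ (n + 1)‖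
      ≤ ‖w‖ ^ (n + 1) * (M / n.factorial) := by gcongr; exact hM n
    _ = M * ‖w‖ * (‖w‖ ^ n / n.factorial) := by ring

/-- The inverse of `1 + z² opSol`: it maps `v` to the solution of
`r⁻¹ (r (u - v)_r)_r + z² u = 0` for which `u - v` is regular and vanishes at the origin. -/
def besselInv (z : ℂ) : L2r →L[ℂ] L2r := Ring.inverse (1 + z ^ 2 • opSol)

theorem one_add_smul_opSol_eq (z : ℂ) :
    (1 : L2r →L[ℂ] L2r) + z ^ 2 • opSol = 1 - (-z ^ 2) • opSol := by
  rw [neg_smul, sub_neg_eq_add]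

theorem isUnit_one_add_smul_opSol (z : ℂ) : IsUnit (1 + z ^ 2 • opSol) := by
  have hsum := summable_smul_opSol_pow (-z ^ 2)
  rw [one_add_smul_opSol_eq]
  exact ⟨⟨_, _, hsum.one_sub_mul_tsum_pow, hsum.tsum_pow_mul_one_sub⟩, rfl⟩

theorem hasSum_besselInv (z : ℂ) :
    HasSum (fun n : ℕ => ((-z ^ 2) • opSol) ^ n) (besselInv z) := by
  have hsum := summable_smul_opSol_pow (-z ^ 2)
  suffices ∑' n : ℕ, ((-z ^ 2) • opSol) ^ n = 1 * Ring.inverse (1 + z ^ 2 • opSol) by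
    rw [besselInv, ← one_mul (Ring.inverse _), ← this]
    exact hsum.hasSum
  rw [Ring.eq_mul_inverse_iff_mul_eq _ _ _ (isUnit_one_add_smul_opSol z), one_add_smul_opSol_eq]
  exact hsum.tsum_pow_mul_one_sub

theorem besselInv_add (z : ℂ) (v : L2r) : besselInv z v + z ^ 2 • opSol (besselInv z v) = v :=
  DFunLike.congr_fun (Ring.mul_inverse_cancel _ (isUnit_one_add_smul_opSol z)) v

theorem besselInv_apply_add (z : ℂ) (v : L2r) : besselInv z (v + z ^ 2 • opSol v) = v :=
  DFunLike.congr_fun (Ring.inverse_mul_cancel _ (isUnit_one_add_smul_opSol z)) v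

theorem differentiable_besselInv : Differentiable ℂ besselInv := fun z =>
  (differentiableAt_inverse (𝕜 := ℂ) (isUnit_one_add_smul_opSol z)).comp z (by fun_prop)

/-- The function `r ↦ J₀(z r)`. -/
def besselSol (z : ℂ) : L2r := besselInv z L2r.one

theorem besselSol_add (z : ℂ) : besselSol z + z ^ 2 • opSol (besselSol z) = L2r.one :=
  besselInv_add z L2r.one

theorem differentiable_besselSol : Differentiable ℂ besselSol := fun z =>
  (differentiable_besselInv z).clm_apply (differentiableAt_const _)

theorem besselSol_ne_zero (z : ℂ) : besselSol z ≠ 0 := by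
  intro hzero
  have hone := besselSol_add z
  have hmean := mean_one
  rw [hzero, map_zero, smul_zero, add_zero] at hone
  rw [← hone, map_zero] at hmean
  norm_num at hmean

theorem opSol_pow_one (n : ℕ) :
    (opSol ^ n) L2r.one = (4 ^ n * (n.factorial : ℂ) ^ 2)⁻¹ • powL2 (2 * n) := by
  induction n with
  | zero => simp [powL2_zero]
  | succ n ih =>
    have hfact : (n.factorial : ℂ) ≠ 0 := by exact_mod_cast n.factorial_ne_zero
    have hsucc : (n : ℂ) + 1 ≠ 0 := n.cast_add_one_ne_zero
    rw [pow_succ' opSol n, mul_apply_eq_comp, ih, map_smul, opSol_powL2, smul_smul,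
      Nat.factorial_succ]
    congr 1
    push_cast
    rw [show 2 * (n : ℂ) + 2 = 2 * (n + 1) by ring]
    field_simp
    ring

/-- The `n`-th term of the power series of `J₀(z)`. -/
def besselTerm (z : ℂ) (n : ℕ) : ℂ := (-z ^ 2) ^ n * (4 ^ n * (n.factorial : ℂ) ^ 2)⁻¹

theorem besselTerm_succ (z : ℂ) (n : ℕ) :
    besselTerm z (n + 1) = -z ^ 2 / (4 * (n + 1) ^ 2) * besselTerm z n := by
  rw [besselTerm, besselTerm, Nat.factorial_succ, pow_succ, pow_succ, Nat.cast_mul, mul_pow,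
    Nat.cast_succ]
  simp only [div_eq_mul_inv, mul_inv]
  ring

theorem besselJ_zero_eq_tsum (z : ℂ) : besselJ 0 z = ∑' n, besselTerm z n := by
  refine tsum_congr fun n => ?_
  rw [besselTerm, neg_pow (z ^ 2), add_zero, add_zero, pow_mul, div_pow, div_pow, ← sq]
  norm_num
  ring

theorem besselJ_one_eq_tsum (z : ℂ) :
    besselJ 1 z = ∑' n : ℕ, z * (besselTerm z n * (2 * (n : ℂ) + 2)⁻¹) := by
  refine tsum_congr fun n => ?_
  have hsucc : (n : ℂ) + 1 ≠ 0 := n.cast_add_one_ne_zero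
  have hfact : (n.factorial : ℂ) ≠ 0 := by exact_mod_cast n.factorial_ne_zero
  rw [besselTerm, neg_pow (z ^ 2), Nat.factorial_succ, pow_succ (z / 2), pow_mul, div_pow, div_pow,
    show (2 : ℂ) ^ 2 = 4 by norm_num, show 2 * (n : ℂ) + 2 = 2 * (n + 1) by ring]
  push_cast
  field_simp

theorem hasSum_apply_besselSol (ℓ : L2r →L[ℂ] ℂ) (z : ℂ) :
    HasSum (fun n : ℕ => besselTerm z n * ℓ (powL2 (2 * n))) (ℓ (besselSol z)) := by
  have hsum := ((hasSum_besselInv z).mapL (ContinuousLinearMap.apply ℂ L2r L2r.one)).mapL ℓ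
  refine hsum.congr_fun fun n => ?_
  rw [ContinuousLinearMap.apply_apply, smul_pow, smul_apply, opSol_pow_one,
    map_smul, map_smul, smul_eq_mul, smul_eq_mul, besselTerm, mul_assoc]

theorem hasSum_mean_besselSol (z : ℂ) :
    HasSum (fun n : ℕ => besselTerm z n * (2 * (n : ℂ) + 2)⁻¹) (mean (besselSol z)) := by
  refine (hasSum_apply_besselSol meanL z).congr_fun fun n => ?_
  rw [meanL_apply, mean_powL2, Nat.cast_mul, Nat.cast_two]

theorem hasSum_moment_opDeriv_besselSol (z : ℂ) :
    HasSum (fun n : ℕ => besselTerm z n * (n / (n + 1)))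
      (-z ^ 2 * moment (opDeriv (besselSol z))) := by
  rw [← hasSum_nat_add_iff' 1]
  simp only [Finset.sum_range_one, Nat.cast_zero, zero_div, mul_zero, sub_zero]
  refine ((hasSum_apply_besselSol (momentL ∘L opDeriv) z).mul_left (-z ^ 2)).congr_fun fun n => ?_
  have hsucc : (n : ℂ) + 1 ≠ 0 := n.cast_add_one_ne_zero
  have hsucc_succ : (n : ℂ) + 2 ≠ 0 := by exact_mod_cast (n + 1).succ_ne_zero
  rw [ContinuousLinearMap.comp_apply, momentL_apply, opDeriv_powL2, map_smul, moment_powL2,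
    smul_eq_mul, besselTerm_succ]
  push_cast
  rw [show 2 * (n : ℂ) + 2 = 2 * (n + 1) by ring, show 2 * (n : ℂ) + 1 + 3 = 2 * (n + 2) by ring,
    show (n : ℂ) + 1 + 1 = n + 2 by ring]
  field_simp
  ring

theorem besselJ_one (z : ℂ) : besselJ 1 z = z * mean (besselSol z) := by
  rw [besselJ_one_eq_tsum, ((hasSum_mean_besselSol z).mul_left z).tsum_eq]

theorem besselJ_zero (z : ℂ) :
    besselJ 0 z = 2 * mean (besselSol z) - z ^ 2 * moment (opDeriv (besselSol z)) := by
  rw [besselJ_zero_eq_tsum, sub_eq_add_neg, ← neg_mul]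
  refine ((((hasSum_mean_besselSol z).mul_left 2).add
    (hasSum_moment_opDeriv_besselSol z)).congr_fun fun n => ?_).tsum_eq
  have hsucc : (n : ℂ) + 1 ≠ 0 := n.cast_add_one_ne_zero
  rw [show 2 * (n : ℂ) + 2 = 2 * (n + 1) by ring]
  field_simp
  ring

/-! ### Unbounded operators whose resolvent is a quotient of entire functions -/

section ResolventQuotient

variable {E : Type*}

section Module

variable [AddCommGroup E] [Module ℂ E] {A : E →ₗ.[ℂ] E}

theorem mem_genKer_succ {z : ℂ} {n : ℕ} {u : E} :
    u ∈ genKer A z (n + 1) ↔ ∃ v : A.domain, (v : E) = u ∧ A v - z • (v : E) ∈ genKer A z n := by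
  constructor
  · rintro ⟨v, hv, rfl⟩
    exact ⟨v, rfl, hv⟩
  · rintro ⟨v, rfl, hv⟩
    exact ⟨v, hv, rfl⟩

theorem genKer_mono (z : ℂ) : Monotone (genKer A z) := by
  refine monotone_nat_of_le_succ fun n => ?_
  induction n with
  | zero => exact bot_le
  | succ n ih =>
    intro u hu
    obtain ⟨v, hv, hvn⟩ := mem_genKer_succ.1 hu
    exact mem_genKer_succ.2 ⟨v, hv, ih hvn⟩

theorem genEigenspace_le_genKer {z : ℂ} {m : ℕ} (hm : genKer A z (m + 1) ≤ genKer A z m) :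
    genEigenspace A z ≤ genKer A z m := by
  have add_le (n : ℕ) : genKer A z (m + n) ≤ genKer A z m := by
    induction n with
    | zero => exact le_rfl
    | succ n ih =>
      intro u hu
      obtain ⟨v, hv, hvn⟩ := mem_genKer_succ.1 hu
      exact hm (mem_genKer_succ.2 ⟨v, hv, ih hvn⟩)
  exact iSup_le fun n => (genKer_mono z (Nat.le_add_left n m)).trans (add_le n)

theorem fg_genKer {z : ℂ} (hker : (LinearMap.ker (A.toFun - z • A.domain.subtype)).FG) (n : ℕ) :
    (genKer A z n).FG := by
  induction n with
  | zero => exact Submodule.fg_bot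
  | succ n ih =>
    have : FiniteDimensional ℂ (genKer A z n) := Module.Finite.iff_fg.2 ih
    have : FiniteDimensional ℂ (LinearMap.ker (A.toFun - z • A.domain.subtype)) :=
      Module.Finite.iff_fg.2 hker
    refine Submodule.FG.map _
      (Submodule.fg_of_fg_map_of_fg_inf_ker (A.toFun - z • A.domain.subtype) ?_ ?_)
    · exact Module.Finite.iff_fg.1
        (Submodule.finiteDimensional_of_le (Submodule.map_comap_le _ (genKer A z n)))
    · exact Module.Finite.iff_fg.1 (Submodule.finiteDimensional_of_le inf_le_right)

end Module

variable [NormedAddCommGroup E] [NormedSpace ℂ E] {A B : E →ₗ.[ℂ] E}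

theorem mem_spectrumOf_of_isEigenvalue {z : ℂ} (h : IsEigenvalue A z) : z ∈ spectrumOf A := by
  rintro ⟨R, hR, -⟩
  obtain ⟨u, hu, hz⟩ := h
  have hRu := hR u
  rw [hz, sub_self, map_zero] at hRu
  exact hu hRu.symm

theorem eq_zero_of_eventually_sub_smul_eq {z₀ : ℂ} {k : ℂ → ℂ} {F q : ℂ → E} {v : E}
    (hF : ContinuousAt F z₀) (hk : ContinuousAt k z₀) (hk₀ : k z₀ ≠ 0) (hq : ContinuousAt q z₀)
    (h : ∀ᶠ z in 𝓝[≠] z₀, (z - z₀) • F z = k z • (v + (z - z₀) • q z)) : v = 0 := by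
  have hleft : ContinuousAt (fun z => (z - z₀) • F z) z₀ := by fun_prop
  have hright : ContinuousAt (fun z => k z • (v + (z - z₀) • q z)) z₀ := by fun_prop
  have hlim := tendsto_nhds_unique ((hleft.tendsto.mono_left nhdsWithin_le_nhds).congr' h)
    (hright.tendsto.mono_left nhdsWithin_le_nhds)
  rw [sub_self, zero_smul, zero_smul, add_zero, eq_comm] at hlim
  exact (smul_eq_zero.1 hlim).resolve_left hk₀

/-- The unbounded operators `A` and `B` are similar through the isomorphism `e`:
`B = e A e⁻¹` with domain `e D(A)`. -/
structure IsSimilarVia (e : E ≃L[ℂ] E) (A B : E →ₗ.[ℂ] E) : Prop where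
  mem_domain_iff : ∀ u, e u ∈ B.domain ↔ u ∈ A.domain
  map_eq : ∀ (u : A.domain) (v : B.domain), (v : E) = e u → B v = e (A u)

namespace IsSimilarVia

variable {e : E ≃L[ℂ] E}

theorem exists_image (h : IsSimilarVia e A B) (u : A.domain) :
    ∃ v : B.domain, (v : E) = e u ∧ ∀ z : ℂ, B v - z • (v : E) = e (A u - z • (u : E)) := by
  refine ⟨⟨e u, (h.mem_domain_iff u).2 u.2⟩, rfl, fun z => ?_⟩
  rw [h.map_eq u _ rfl, map_sub, map_smul]

theorem exists_preimage (h : IsSimilarVia e A B) (v : B.domain) :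
    ∃ u : A.domain, (v : E) = e u ∧ ∀ z : ℂ, B v - z • (v : E) = e (A u - z • (u : E)) := by
  have hv : (v : E) = e (e.symm v) := (e.apply_symm_apply _).symm
  have hu : e.symm v ∈ A.domain := by rw [← h.mem_domain_iff, ← hv]; exact v.2
  refine ⟨⟨e.symm v, hu⟩, hv, fun z => ?_⟩
  rw [h.map_eq ⟨_, hu⟩ v hv, map_sub, map_smul, ← hv]

theorem isResolvent (h : IsSimilarVia e A B) {z : ℂ} {R : E →L[ℂ] E} (hR : IsResolvent A z R) :
    IsResolvent B z ((e : E →L[ℂ] E) ∘L R ∘L (e.symm : E →L[ℂ] E)) := by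
  constructor
  · intro v
    obtain ⟨u, hu, hv⟩ := h.exists_preimage v
    rw [hv]
    simp [hu, hR.1 u, -map_sub]
  · intro f
    obtain ⟨u, hu, huf⟩ := hR.2 (e.symm f)
    obtain ⟨v, hv, hvz⟩ := h.exists_image u
    exact ⟨v, by simp [hv, hu], by simp [hvz, huf]⟩

theorem isEigenvalue (h : IsSimilarVia e A B) {z : ℂ} (hz : IsEigenvalue A z) :
    IsEigenvalue B z := by
  obtain ⟨u, hu, huz⟩ := hz
  obtain ⟨v, hv, hvz⟩ := h.exists_image u
  refine ⟨v, by simpa [hv] using hu, ?_⟩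
  rw [← sub_eq_zero, hvz, huz, sub_self, map_zero]

end IsSimilarVia

variable (A) in
/-- The resolvent of `A` is the quotient `N z / D z` of an operator-valued function `N`, strongly
continuous on `ℂ`, and an entire function `D` whose zeros are eigenvalues of finite geometric
multiplicity. -/
structure IsResolventQuotient (D : ℂ → ℂ) (N : ℂ → E →L[ℂ] E) : Prop where
  differentiable : Differentiable ℂ D
  exists_ne_zero : ∃ z, D z ≠ 0
  continuous_apply : ∀ f, Continuous fun z => N z f
  solves : ∀ (z : ℂ) (f : E), ∃ u : A.domain, (u : E) = N z f ∧ A u - z • (u : E) = D z • f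
  injective : ∀ z : ℂ, D z ≠ 0 → ∀ u : A.domain, A u = z • (u : E) → (u : E) = 0
  isEigenvalue : ∀ z : ℂ, D z = 0 → IsEigenvalue A z
  fg_ker : ∀ z : ℂ, ∃ W : Submodule ℂ E, W.FG ∧ ∀ u : A.domain, A u = z • (u : E) → (u : E) ∈ W

namespace IsResolventQuotient

variable {D : ℂ → ℂ} {N : ℂ → E →L[ℂ] E}

theorem of_isSimilarVia (h : IsResolventQuotient A D N) {e : E ≃L[ℂ] E}
    (hAB : IsSimilarVia e A B) :
    IsResolventQuotient B D fun z => (e : E →L[ℂ] E) ∘L N z ∘L (e.symm : E →L[ℂ] E) where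
  differentiable := h.differentiable
  exists_ne_zero := h.exists_ne_zero
  continuous_apply f := e.continuous.comp (h.continuous_apply (e.symm f))
  solves z f := by
    obtain ⟨u, hu, huf⟩ := h.solves z (e.symm f)
    obtain ⟨v, hv, hvz⟩ := hAB.exists_image u
    exact ⟨v, by simp [hv, hu], by simp [hvz, huf]⟩
  injective z hz v hv := by
    obtain ⟨u, hu, huz⟩ := hAB.exists_preimage v
    have hAu : A u = z • (u : E) := by
      rw [← sub_eq_zero, ← e.map_eq_zero_iff, ← huz, hv, sub_self]
    rw [hu, h.injective z hz u hAu, map_zero]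
  isEigenvalue z hz := hAB.isEigenvalue (h.isEigenvalue z hz)
  fg_ker z := by
    obtain ⟨W, hW, hker⟩ := h.fg_ker z
    refine ⟨W.map (e : E →ₗ[ℂ] E), hW.map _, fun v hv => ?_⟩
    obtain ⟨u, hu, huz⟩ := hAB.exists_preimage v
    have hAu : A u = z • (u : E) := by
      rw [← sub_eq_zero, ← e.map_eq_zero_iff, ← huz, hv, sub_self]
    exact ⟨u, hker u hAu, hu.symm⟩

theorem apply_sub (h : IsResolventQuotient A D N) {z : ℂ} (hz : D z ≠ 0) (u : A.domain) :
    N z (A u - z • (u : E)) = D z • (u : E) := by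
  obtain ⟨v, hv, hvu⟩ := h.solves z (A u - z • (u : E))
  have hker : A (v - D z • u) = z • ((v - D z • u : A.domain) : E) := by
    rw [LinearPMap.map_sub, LinearPMap.map_smul, Submodule.coe_sub, Submodule.coe_smul,
      sub_eq_iff_eq_add.1 hvu]
    module
  have hsub := h.injective z hz _ hker
  rwa [Submodule.coe_sub, Submodule.coe_smul, hv, sub_eq_zero] at hsub

theorem isResolvent (h : IsResolventQuotient A D N) {z : ℂ} (hz : D z ≠ 0) :
    IsResolvent A z ((D z)⁻¹ • N z) := by
  constructor
  · intro u
    rw [smul_apply, h.apply_sub hz, inv_smul_smul₀ hz]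
  · intro f
    obtain ⟨v, hv, hvf⟩ := h.solves z f
    refine ⟨(D z)⁻¹ • v, ?_, ?_⟩
    · rw [Submodule.coe_smul, hv, smul_apply]
    · rw [LinearPMap.map_smul, Submodule.coe_smul, smul_comm z, ← smul_sub, hvf,
        inv_smul_smul₀ hz]

theorem mem_spectrumOf_iff (h : IsResolventQuotient A D N) (z : ℂ) :
    z ∈ spectrumOf A ↔ D z = 0 := by
  refine ⟨fun hz => ?_, fun hz => mem_spectrumOf_of_isEigenvalue (h.isEigenvalue z hz)⟩
  by_contra hne
  exact hz ⟨_, h.isResolvent hne⟩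

theorem isEigenvalue_iff (h : IsResolventQuotient A D N) (z : ℂ) : IsEigenvalue A z ↔ D z = 0 :=
  ⟨fun hz => (h.mem_spectrumOf_iff z).1 (mem_spectrumOf_of_isEigenvalue hz), h.isEigenvalue z⟩

theorem eventually_ne_zero (h : IsResolventQuotient A D N) (z : ℂ) : ∀ᶠ w in 𝓝[≠] z, D w ≠ 0 := by
  have hD : AnalyticOnNhd ℂ D univ := fun w _ => h.differentiable.analyticAt w
  rcases hD.eqOn_zero_or_eventually_ne_zero_of_preconnected isPreconnected_univ with h0 | hne
  · obtain ⟨w, hw⟩ := h.exists_ne_zero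
    exact absurd (h0 (mem_univ w)) hw
  · have hz := mem_codiscrete.1 hne z
    rwa [Filter.disjoint_principal_right, compl_compl] at hz

theorem exists_le_dist (h : IsResolventQuotient A D N) (z : ℂ) :
    ∃ ε > 0, ∀ w ∈ spectrumOf A, w ≠ z → ε ≤ dist w z := by
  have hne := h.eventually_ne_zero z
  rw [eventually_nhdsWithin_iff, Metric.eventually_nhds_iff] at hne
  obtain ⟨ε, hε, hball⟩ := hne
  refine ⟨ε, hε, fun w hw hwz => ?_⟩
  by_contra! hlt
  exact hball hlt hwz ((h.mem_spectrumOf_iff w).1 hw)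

theorem finite_spectrumOf_inter (h : IsResolventQuotient A D N) {K : Set ℂ} (hK : IsCompact K) :
    (spectrumOf A ∩ K).Finite := by
  by_contra hinf
  obtain ⟨z, -, hz⟩ := Set.Infinite.exists_accPt_of_subset_isCompact hinf hK inter_subset_right
  rw [accPt_iff_frequently_nhdsNE] at hz
  refine hz ?_
  filter_upwards [h.eventually_ne_zero z] with w hw hwσ
  exact hw ((h.mem_spectrumOf_iff w).1 hwσ.1)

theorem fg_ker_sub (h : IsResolventQuotient A D N) (z : ℂ) :
    (LinearMap.ker (A.toFun - z • A.domain.subtype)).FG := by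
  obtain ⟨W, hW, hker⟩ := h.fg_ker z
  have : FiniteDimensional ℂ W := Module.Finite.iff_fg.2 hW
  have hle : (LinearMap.ker (A.toFun - z • A.domain.subtype)).map A.domain.subtype ≤ W := by
    rintro - ⟨u, hu, rfl⟩
    exact hker u (sub_eq_zero.1 hu)
  exact Submodule.fg_of_fg_map_injective A.domain.subtype Subtype.val_injective
    (Module.Finite.iff_fg.1 (Submodule.finiteDimensional_of_le hle))

theorem sub_smul_apply (h : IsResolventQuotient A D N) {z : ℂ} (hz : D z ≠ 0) (z₀ : ℂ)
    (u : A.domain) :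
    (z - z₀) • N z (u : E) = N z (A u - z₀ • (u : E)) - D z • (u : E) := by
  rw [← h.apply_sub hz u, ← map_sub, ← map_smul]
  congr 1
  module

theorem exists_pow_smul_apply_eq (h : IsResolventQuotient A D N) (z₀ : ℂ) (n : ℕ) {u : E}
    (hu : u ∈ genKer A z₀ (n + 1)) :
    ∃ (v : E) (q : ℂ → E), Continuous q ∧ (v = 0 → u ∈ genKer A z₀ n) ∧
      ∀ z, D z ≠ 0 → (z - z₀) ^ (n + 1) • N z u = D z • (v + (z - z₀) • q z) := by
  induction n generalizing u with
  | zero =>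
    obtain ⟨w, rfl, hw⟩ := mem_genKer_succ.1 hu
    refine ⟨-w, fun _ => 0, continuous_const, neg_eq_zero.1, fun z hz => ?_⟩
    rw [zero_add, pow_one, h.sub_smul_apply hz z₀ w, (hw : A w - z₀ • (w : E) = 0), map_zero]
    module
  | succ n ih =>
    obtain ⟨w, rfl, hw⟩ := mem_genKer_succ.1 hu
    obtain ⟨v, q, hq, hv, hvq⟩ := ih hw
    refine ⟨v, fun z => q z - (z - z₀) ^ n • (w : E), by fun_prop,
      fun h0 => mem_genKer_succ.2 ⟨w, rfl, hv h0⟩, fun z hz => ?_⟩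
    rw [pow_succ, mul_smul, h.sub_smul_apply hz z₀ w, smul_sub, hvq z hz]
    module

-- The index `m` is the order of vanishing of `D` at `z₀`, which bounds the order of the pole of
-- the resolvent.
theorem exists_genKer_succ_le (h : IsResolventQuotient A D N) (z₀ : ℂ) :
    ∃ m, genKer A z₀ (m + 1) ≤ genKer A z₀ m := by
  have hD : ¬ ∀ᶠ z in 𝓝 z₀, D z = 0 := fun h0 => by
    obtain ⟨w, hw, hw₀⟩ :=
      ((h.eventually_ne_zero z₀).and (h0.filter_mono nhdsWithin_le_nhds)).exists
    exact hw hw₀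
  obtain ⟨m, k, hk, hk₀, hDk⟩ :=
    (h.differentiable.analyticAt z₀).exists_eventuallyEq_pow_smul_nonzero_iff.2 hD
  refine ⟨m, fun u hu => ?_⟩
  obtain ⟨v, q, hq, hv, hvq⟩ := h.exists_pow_smul_apply_eq z₀ m hu
  refine hv (eq_zero_of_eventually_sub_smul_eq (h.continuous_apply u).continuousAt
    hk.continuousAt hk₀ hq.continuousAt ?_)
  filter_upwards [h.eventually_ne_zero z₀, hDk.filter_mono nhdsWithin_le_nhds,
    self_mem_nhdsWithin] with z hDz hDkz hz
  have hpow : (z - z₀) ^ m ≠ 0 := pow_ne_zero _ (sub_ne_zero.2 hz)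
  have hzu := hvq z hDz
  rw [hDkz, pow_succ, mul_smul, smul_eq_mul, mul_smul] at hzu
  exact smul_right_injective E hpow hzu

theorem finiteDimensional_genEigenspace (h : IsResolventQuotient A D N) (z : ℂ) :
    FiniteDimensional ℂ (genEigenspace A z) := by
  obtain ⟨m, hm⟩ := h.exists_genKer_succ_le z
  have : FiniteDimensional ℂ (genKer A z m) := Module.Finite.iff_fg.2 (fg_genKer (h.fg_ker_sub z) m)
  exact Submodule.finiteDimensional_of_le (genEigenspace_le_genKer hm)

end IsResolventQuotient

end ResolventQuotient

/-! ### The resolvent equation for `K` -/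

/-- `X.eta` as a bounded functional. -/
def etaL : X →L[ℂ] ℂ := WithLp.fstL 2 ℂ ℂ (WithLp 2 (ℂ × WithLp 2 (H1r × L2r)))

/-- `X.omega` as a bounded functional. -/
def omegaL : X →L[ℂ] ℂ :=
  WithLp.fstL 2 ℂ ℂ (WithLp 2 (H1r × L2r)) ∘L WithLp.sndL 2 ℂ ℂ _

/-- `X.phi` as a bounded operator. -/
def phiL : X →L[ℂ] H1r :=
  WithLp.fstL 2 ℂ H1r L2r ∘L WithLp.sndL 2 ℂ ℂ (WithLp 2 (H1r × L2r)) ∘L WithLp.sndL 2 ℂ ℂ _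

/-- `X.zeta` as a bounded operator. -/
def zetaL : X →L[ℂ] L2r :=
  WithLp.sndL 2 ℂ H1r L2r ∘L WithLp.sndL 2 ℂ ℂ (WithLp 2 (H1r × L2r)) ∘L WithLp.sndL 2 ℂ ℂ _

/-- The isomorphism of the Hilbert sum `X` with the product of its four components. -/
def prodEquivX : X ≃L[ℂ] ℂ × ℂ × H1r × L2r :=
  (WithLp.prodContinuousLinearEquiv 2 ℂ ℂ (WithLp 2 (ℂ × WithLp 2 (H1r × L2r)))).trans
    ((ContinuousLinearEquiv.refl ℂ ℂ).prodCongr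
      ((WithLp.prodContinuousLinearEquiv 2 ℂ ℂ (WithLp 2 (H1r × L2r))).trans
        ((ContinuousLinearEquiv.refl ℂ ℂ).prodCongr
          (WithLp.prodContinuousLinearEquiv 2 ℂ H1r L2r))))

/-- The bounded operator into `X` with the given components. -/
def mkL (a b : X →L[ℂ] ℂ) (c : X →L[ℂ] H1r) (d : X →L[ℂ] L2r) : X →L[ℂ] X :=
  prodEquivX.symm.toContinuousLinearMap ∘L a.prod (b.prod (c.prod d))

theorem continuous_mk {T : Type*} [TopologicalSpace T] {a b : T → ℂ} {c : T → H1r} {d : T → L2r}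
    (ha : Continuous a) (hb : Continuous b) (hc : Continuous c) (hd : Continuous d) :
    Continuous fun t => X.mk (a t) (b t) (c t) (d t) :=
  prodEquivX.symm.continuous.comp (ha.prodMk (hb.prodMk (hc.prodMk hd)))

theorem linW_apply (β : ℝ) (u : X) :
    linW β u = (β : ℂ)⁻¹ * (X.omega u - moment (H1r.der (X.phi u))) := rfl

theorem linW_eq_iff {β : ℝ} (hβ : β ≠ 0) {u : X} {w : ℂ} :
    linW β u = w ↔ X.omega u = β * w + moment (H1r.der (X.phi u)) := by
  have hβ' : (β : ℂ) ≠ 0 := by exact_mod_cast hβ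
  rw [linW_apply, inv_mul_eq_iff_eq_mul₀ hβ', sub_eq_iff_eq_add]

/-- The equation `(K - z) u = f` in the components of `u = (η, ω, φ, ζ)`, with
`φ = c + opSol g`, so that `c = φ(0)` and `g = r⁻¹ (r φ_r)_r`, and with `w = f₁ + z η` and `ζ`
eliminated from the last component. -/
structure ResolventEq (β α : ℝ) (z : ℂ) (u f : X) (c : ℂ) (g : L2r) : Prop where
  phi : X.phi u = c • H1r.one + opSolH1 g
  omega : X.omega u = β * (X.eta f + z * X.eta u) + moment (opDeriv g)
  trace : mean g = -(X.eta f + z * X.eta u)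
  snd : -2 * mean (X.zeta u) - 2 * X.eta u + ((α : ℂ) - β) * X.eta u - z * X.omega u = X.omega f
  zeta : X.zeta u = H1r.val (X.phi f) + z • H1r.val (X.phi u) - (2 * X.eta u) • L2r.one
  lap : g = -(z ^ 2 • H1r.val (X.phi u)) -
    (X.zeta f + z • H1r.val (X.phi f) + (2 * X.eta f) • L2r.one)

theorem der_phi_of_phi_eq {u : X} {c : ℂ} {g : L2r} (h : X.phi u = c • H1r.one + opSolH1 g) :
    H1r.der (X.phi u) = opDeriv g := by
  simp [h]

theorem exists_resolventEq {β : ℝ} (hβ : β ≠ 0) (α : ℝ) (z : ℂ) {f : X} (u : domK β)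
    (h : opKFun β α u - z • (u : X) = f) : ∃ c g, ResolventEq β α z u f c g := by
  obtain ⟨c, hφ⟩ := exists_phi_eq (domKToY β u)
  set g := phiRR (domKToY β u) + phiRDivR (domKToY β u)
  have hφ : X.phi (u : X) = c • H1r.one + opSolH1 g := hφ
  have hw : linW β u = X.eta f + z * X.eta u := by
    rw [← h]
    exact (sub_add_cancel (linW β u) (z * X.eta u)).symm
  have hsnd : -2 * mean (X.zeta u) - 2 * X.eta u + ((α : ℂ) - β) * X.eta u - z * X.omega u =
      X.omega f := by rw [← h]; rfl
  have hthird : zetaH1 (domKToY β u) + (2 * X.eta u) • H1r.one - z • X.phi u = X.phi f := by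
    rw [← h]; rfl
  have hfourth : -g - (2 * linW β u) • L2r.one - z • X.zeta u = X.zeta f := by rw [← h]; rfl
  have hzeta : X.zeta (u : X) =
      H1r.val (X.phi f) + z • H1r.val (X.phi u) - (2 * X.eta u) • L2r.one := by
    rw [← hthird]
    simp only [map_sub, map_add, map_smul, H1r.val_one, val_zetaH1]
    change _ = X.zeta (u : X) + _ - _ + _ - _
    abel
  refine ⟨c, g, hφ, ?_, ?_, hsnd, hzeta, ?_⟩
  · rw [(linW_eq_iff hβ).1 hw, der_phi_of_phi_eq hφ]
  · rw [← hw, ← hasTraceOne_opDeriv_iff, ← der_phi_of_phi_eq hφ]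
    exact u.2.2
  · rw [← hfourth, hzeta, hw]
    module

theorem ResolventEq.exists_opKFun_sub_smul_eq {β : ℝ} (hβ : β ≠ 0) {α : ℝ} {z : ℂ} {u f : X}
    {c : ℂ} {g : L2r} (h : ResolventEq β α z u f c g) :
    ∃ v : domK β, (v : X) = u ∧ opKFun β α v - z • (v : X) = f := by
  have hw : linW β u = X.eta f + z * X.eta u := by
    rw [linW_eq_iff hβ, der_phi_of_phi_eq h.phi, h.omega]
  set ζ : H1r := X.phi f + z • X.phi u - (2 * X.eta u) • H1r.one with hζ
  have hζu : X.zeta u = H1r.val ζ := by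
    rw [h.zeta, hζ]
    simp only [map_sub, map_add, map_smul, H1r.val_one]
  have hY : u ∈ Y := mem_Y_of_phi_eq h.phi hζu
  have hζY : zetaH1 ⟨u, hY⟩ = ζ := H1r.val_injective ((val_zetaH1 ⟨u, hY⟩).trans hζu)
  have hu : u ∈ domK β := by
    refine ⟨hY, ?_⟩
    rw [der_phi_of_phi_eq h.phi, hasTraceOne_opDeriv_iff, hw, h.trace]
  refine ⟨⟨u, hu⟩, rfl, X.ext ?_ h.snd ?_ ?_⟩
  · exact sub_eq_iff_eq_add.2 hw
  · change zetaH1 ⟨u, hY⟩ + (2 * X.eta u) • H1r.one - z • X.phi u = X.phi f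
    rw [hζY, hζ]
    abel
  · change -(phiRR ⟨u, hY⟩ + phiRDivR ⟨u, hY⟩) - (2 * linW β u) • L2r.one - z • X.zeta u = X.zeta f
    rw [phiRR_add_phiRDivR_eq ⟨u, hY⟩ h.phi, hw, h.zeta, h.lap]
    module

section Coefficients

variable (β α : ℝ) (z : ℂ)

/-- The coefficient of `c` in the boundary condition, once Bessel's equation is solved. -/
def coefBdryC : ℂ := -z ^ 2 * mean (besselSol z)

/-- The coefficient of `c` in the second component of the resolvent equation, once Bessel's
equation is solved. -/
def coefSndC : ℂ := -2 * z * mean (besselSol z) + z ^ 3 * moment (opDeriv (besselSol z))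

/-- The coefficient of `η` in the second component of the resolvent equation. -/
def coefSndEta : ℂ := ((α : ℂ) - β) - β * z ^ 2

/-- The determinant of the linear system for `(c, η)`; the coefficient of `η` in the boundary
condition is `z`. -/
def charDet : ℂ := coefBdryC z * coefSndEta β α z - z * coefSndC z

/-- The inhomogeneity `f₄ + z f₃ + 2 f₁` of the Bessel equation satisfied by `φ`. -/
def inhom : X →L[ℂ] L2r :=
  zetaL + z • valL ∘L phiL + ((2 : ℂ) • etaL).smulRight L2r.one

/-- The solution of the inhomogeneous Bessel equation that vanishes at `r = 0`. -/
def partSol : X →L[ℂ] L2r := -(besselInv z ∘L opSol ∘L inhom z)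

/-- The right-hand side of the boundary condition. -/
def rhsBdry : X →L[ℂ] ℂ := z ^ 2 • meanL ∘L partSol z + meanL ∘L inhom z - etaL

/-- The right-hand side of the second component of the resolvent equation. -/
def rhsSnd : X →L[ℂ] ℂ :=
  omegaL + (2 : ℂ) • meanL ∘L valL ∘L phiL + (2 * z) • meanL ∘L partSol z + (z * β) • etaL -
    z • momentL ∘L opDeriv ∘L (z ^ 2 • partSol z + inhom z)

/-- The constant `c` given by Cramer's rule, times the determinant. -/
def cramerC : X →L[ℂ] ℂ := coefSndEta β α z • rhsBdry z - z • rhsSnd β z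

/-- The component `η` given by Cramer's rule, times the determinant. -/
def cramerEta : X →L[ℂ] ℂ := coefBdryC z • rhsSnd β z - coefSndC z • rhsBdry z

/-- The component `φ` of the solution, times the determinant, as an element of `L²_r(0,1)`. -/
def adjPhi : X →L[ℂ] L2r :=
  (cramerC β α z).smulRight (besselSol z) + charDet β α z • partSol z

/-- The radial Laplacian of the component `φ` of the solution, times the determinant. -/
def adjLap : X →L[ℂ] L2r := -(z ^ 2 • adjPhi β α z) - charDet β α z • inhom z

/-- The adjugate of `K - z`: the solution operator of the resolvent equation, times the
determinant. -/
def adjResolvent : X →L[ℂ] X :=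
  mkL (cramerEta β z)
    ((β : ℂ) • (charDet β α z • etaL + z • cramerEta β z) + momentL ∘L opDeriv ∘L adjLap β α z)
    ((cramerC β α z).smulRight H1r.one + opSolH1 ∘L adjLap β α z)
    (charDet β α z • valL ∘L phiL + z • adjPhi β α z -
      ((2 : ℂ) • cramerEta β z).smulRight L2r.one)

theorem inhom_apply (f : X) :
    inhom z f = X.zeta f + z • H1r.val (X.phi f) + (2 * X.eta f) • L2r.one := rfl

theorem rhsBdry_apply (f : X) :
    rhsBdry z f = z ^ 2 * mean (partSol z f) + mean (inhom z f) - X.eta f := rfl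

theorem rhsSnd_apply (f : X) : rhsSnd β z f = X.omega f + 2 * mean (H1r.val (X.phi f)) +
    2 * z * mean (partSol z f) + z * β * X.eta f -
      z * (z ^ 2 * moment (opDeriv (partSol z f)) + moment (opDeriv (inhom z f))) := by
  change _ + _ + _ + _ - z * moment (opDeriv (z ^ 2 • partSol z f + inhom z f)) = _
  simp only [map_add, map_smul, smul_eq_mul]
  rfl

theorem cramerC_apply (f : X) :
    cramerC β α z f = coefSndEta β α z * rhsBdry z f - z * rhsSnd β z f := rfl

theorem cramerEta_apply (f : X) :
    cramerEta β z f = coefBdryC z * rhsSnd β z f - coefSndC z * rhsBdry z f := rfl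

theorem adjPhi_apply (f : X) :
    adjPhi β α z f = cramerC β α z f • besselSol z + charDet β α z • partSol z f := rfl

theorem adjLap_apply (f : X) :
    adjLap β α z f = -(z ^ 2 • adjPhi β α z f) - charDet β α z • inhom z f := rfl

theorem adjResolvent_apply (f : X) : adjResolvent β α z f =
    X.mk (cramerEta β z f)
      (β * (charDet β α z * X.eta f + z * cramerEta β z f) + moment (opDeriv (adjLap β α z f)))
      (cramerC β α z f • H1r.one + opSolH1 (adjLap β α z f))
      (charDet β α z • H1r.val (X.phi f) + z • adjPhi β α z f -
        (2 * cramerEta β z f) • L2r.one) := rfl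

theorem partSol_add (f : X) :
    partSol z f + z ^ 2 • opSol (partSol z f) = -opSol (inhom z f) := by
  change -besselInv z (opSol (inhom z f)) + z ^ 2 • opSol (-besselInv z (opSol (inhom z f))) = _
  rw [map_neg, smul_neg, ← neg_add, besselInv_add]

theorem mean_adjPhi (f : X) : mean (adjPhi β α z f) =
    cramerC β α z f * mean (besselSol z) + charDet β α z * mean (partSol z f) := by
  simp only [adjPhi_apply, map_add, map_smul, smul_eq_mul]

theorem moment_opDeriv_adjPhi (f : X) : moment (opDeriv (adjPhi β α z f)) =
    cramerC β α z f * moment (opDeriv (besselSol z)) +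
      charDet β α z * moment (opDeriv (partSol z f)) := by
  simp only [adjPhi_apply, map_add, map_smul, smul_eq_mul]

theorem smul_one_add_opSol_adjLap (f : X) :
    cramerC β α z f • L2r.one + opSol (adjLap β α z f) = adjPhi β α z f := by
  have hinhom : opSol (inhom z f) = -(partSol z f + z ^ 2 • opSol (partSol z f)) := by
    rw [partSol_add, neg_neg]
  simp only [adjLap_apply, adjPhi_apply, map_sub, map_neg, map_smul, map_add, hinhom]
  rw [← besselSol_add z]
  module

theorem resolventEq_adjResolvent (f : X) :
    ResolventEq β α z (adjResolvent β α z f) (charDet β α z • f) (cramerC β α z f)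
      (adjLap β α z f) := by
  rw [adjResolvent_apply]
  constructor
  case phi => rfl
  case omega => simp
  case trace =>
    simp only [adjLap_apply, X.eta_mk, map_sub, map_neg, map_smul, smul_eq_mul, mean_adjPhi]
    rw [cramerC_apply, cramerEta_apply, charDet, rhsBdry_apply, coefBdryC]
    ring
  case snd =>
    simp only [X.eta_mk, X.omega_mk, X.zeta_mk, adjLap_apply, map_sub, map_neg, map_add, map_smul,
      smul_eq_mul, mean_adjPhi, moment_opDeriv_adjPhi, mean_one]
    rw [cramerC_apply, cramerEta_apply, charDet, rhsSnd_apply, coefSndC, coefSndEta]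
    ring
  case zeta =>
    simp only [X.eta_mk, X.zeta_mk, X.phi_mk, map_smul, map_add, H1r.val_one, val_opSolH1,
      smul_one_add_opSol_adjLap]
  case lap =>
    simp only [X.phi_mk, map_smul, map_add, H1r.val_one, val_opSolH1, smul_one_add_opSol_adjLap,
      smul_eq_mul]
    rw [adjLap_apply, inhom_apply]
    module

end Coefficients

/-! ### The characteristic equation and the eigenvectors of `K` -/

theorem charDet_eq (β α : ℝ) (z : ℂ) : charDet β α z =
    z * (z * besselJ 0 z - (((α - β : ℝ) : ℂ) - β * z ^ 2) * besselJ 1 z) := by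
  rw [besselJ_zero, besselJ_one, charDet, coefBdryC, coefSndC, coefSndEta]
  push_cast
  ring

theorem charDet_eq_zero_iff (β α : ℝ) (z : ℂ) : charDet β α z = 0 ↔
    z * besselJ 0 z = (((α - β : ℝ) : ℂ) - β * z ^ 2) * besselJ 1 z := by
  rw [charDet_eq, mul_eq_zero, sub_eq_zero]
  refine ⟨?_, Or.inr⟩
  rintro (rfl | h)
  · rw [besselJ_one]
    ring
  · exact h

theorem differentiable_mean_besselSol : Differentiable ℂ fun z => mean (besselSol z) :=
  meanL.differentiable.comp differentiable_besselSol

theorem differentiable_moment_opDeriv_besselSol :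
    Differentiable ℂ fun z => moment (opDeriv (besselSol z)) :=
  (momentL ∘L opDeriv).differentiable.comp differentiable_besselSol

theorem differentiable_coefBdryC : Differentiable ℂ coefBdryC := by
  have := differentiable_mean_besselSol
  unfold coefBdryC
  fun_prop

theorem differentiable_coefSndC : Differentiable ℂ coefSndC := by
  have := differentiable_mean_besselSol
  have := differentiable_moment_opDeriv_besselSol
  unfold coefSndC
  fun_prop

theorem differentiable_coefSndEta (β α : ℝ) : Differentiable ℂ (coefSndEta β α) := by
  unfold coefSndEta
  fun_prop

theorem differentiable_charDet (β α : ℝ) : Differentiable ℂ (charDet β α) :=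
  (differentiable_coefBdryC.mul (differentiable_coefSndEta β α)).sub
    (differentiable_id.mul differentiable_coefSndC)

theorem continuous_inhom_apply (f : X) : Continuous fun z => inhom z f := by
  simp only [inhom_apply]
  fun_prop

theorem continuous_partSol_apply (f : X) : Continuous fun z => partSol z f :=
  (differentiable_besselInv.continuous.clm_apply
    (opSol.continuous.comp (continuous_inhom_apply f))).neg

theorem continuous_rhsBdry_apply (f : X) : Continuous fun z => rhsBdry z f := by
  have hpart : Continuous fun z => mean (partSol z f) :=
    meanL.continuous.comp (continuous_partSol_apply f)
  have hinhom : Continuous fun z => mean (inhom z f) :=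
    meanL.continuous.comp (continuous_inhom_apply f)
  simp only [rhsBdry_apply]
  fun_prop

theorem continuous_rhsSnd_apply (β : ℝ) (f : X) : Continuous fun z => rhsSnd β z f := by
  have hmean : Continuous fun z => mean (partSol z f) :=
    meanL.continuous.comp (continuous_partSol_apply f)
  have hpart : Continuous fun z => moment (opDeriv (partSol z f)) :=
    (momentL ∘L opDeriv).continuous.comp (continuous_partSol_apply f)
  have hinhom : Continuous fun z => moment (opDeriv (inhom z f)) :=
    (momentL ∘L opDeriv).continuous.comp (continuous_inhom_apply f)
  simp only [rhsSnd_apply]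
  fun_prop

theorem continuous_cramerC_apply (β α : ℝ) (f : X) : Continuous fun z => cramerC β α z f :=
  ((differentiable_coefSndEta β α).continuous.mul (continuous_rhsBdry_apply f)).sub
    (continuous_id.mul (continuous_rhsSnd_apply β f))

theorem continuous_cramerEta_apply (β : ℝ) (f : X) : Continuous fun z => cramerEta β z f :=
  (differentiable_coefBdryC.continuous.mul (continuous_rhsSnd_apply β f)).sub
    (differentiable_coefSndC.continuous.mul (continuous_rhsBdry_apply f))

theorem continuous_adjPhi_apply (β α : ℝ) (f : X) : Continuous fun z => adjPhi β α z f :=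
  ((continuous_cramerC_apply β α f).smul differentiable_besselSol.continuous).add
    ((differentiable_charDet β α).continuous.smul (continuous_partSol_apply f))

theorem continuous_adjResolvent_apply (β α : ℝ) (f : X) :
    Continuous fun z => adjResolvent β α z f := by
  have hdet : Continuous (charDet β α) := (differentiable_charDet β α).continuous
  have hphi := continuous_adjPhi_apply β α f
  have hlap : Continuous fun z => adjLap β α z f :=
    ((continuous_pow 2).smul hphi).neg.sub (hdet.smul (continuous_inhom_apply f))
  have hmoment : Continuous fun z => moment (opDeriv (adjLap β α z f)) :=
    (momentL ∘L opDeriv).continuous.comp hlap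
  have hc := continuous_cramerC_apply β α f
  have hη := continuous_cramerEta_apply β f
  simp only [adjResolvent_apply]
  exact continuous_mk hη (by fun_prop) (by fun_prop) (by fun_prop)

/-- The vector whose components solve the homogeneous resolvent equation, apart from the boundary
condition and the second component, with `φ(0) = c` and first component `η`. -/
def kerVec (β : ℝ) (z c η : ℂ) : X :=
  X.mk η (β * (z * η) - z ^ 2 * c * moment (opDeriv (besselSol z)))
    (c • H1r.one - (z ^ 2 * c) • opSolH1 (besselSol z))
    ((z * c) • besselSol z - (2 * η) • L2r.one)

theorem kerVec_eq (β : ℝ) (z c η : ℂ) :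
    kerVec β z c η = c • kerVec β z 1 0 + η • kerVec β z 0 1 := by
  apply X.ext <;>
    simp only [kerVec, X.eta_mk, X.omega_mk, X.phi_mk, X.zeta_mk, map_add, map_smul, smul_eq_mul]
  · ring
  · ring
  · module
  · module

theorem val_phi_kerVec (β : ℝ) (z c η : ℂ) :
    H1r.val (X.phi (kerVec β z c η)) = c • besselSol z := by
  simp only [kerVec, X.phi_mk, map_sub, map_smul, H1r.val_one, val_opSolH1]
  rw [← besselSol_add z]
  module

theorem kerVec_eq_zero_iff {β : ℝ} {z c η : ℂ} : kerVec β z c η = 0 ↔ c = 0 ∧ η = 0 := by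
  constructor
  · intro h
    have hφ := val_phi_kerVec β z c η
    rw [h, map_zero, map_zero] at hφ
    have hη : X.eta (kerVec β z c η) = 0 := by rw [h, map_zero]
    exact ⟨(smul_eq_zero.1 hφ.symm).resolve_right (besselSol_ne_zero z), hη⟩
  · rintro ⟨rfl, rfl⟩
    rw [kerVec_eq, zero_smul, zero_smul, add_zero]

theorem resolventEq_kerVec {β α : ℝ} {z c η : ℂ} (hbdry : coefBdryC z * c + z * η = 0)
    (hsnd : coefSndC z * c + coefSndEta β α z * η = 0) :
    ResolventEq β α z (kerVec β z c η) 0 c (-(z ^ 2 * c) • besselSol z) := by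
  rw [coefBdryC] at hbdry
  rw [coefSndC, coefSndEta] at hsnd
  constructor
  case phi =>
    simp only [kerVec, X.phi_mk, map_smul]
    module
  case omega =>
    simp only [kerVec, X.omega_mk, X.eta_mk, map_smul, map_zero, smul_eq_mul]
    ring
  case trace =>
    simp only [kerVec, X.eta_mk, map_smul, map_zero, smul_eq_mul]
    linear_combination hbdry
  case snd =>
    simp only [kerVec, X.omega_mk, X.eta_mk, X.zeta_mk, map_smul, map_zero, map_sub, smul_eq_mul,
      mean_one]
    linear_combination hsnd
  case zeta =>
    rw [val_phi_kerVec]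
    simp only [kerVec, X.eta_mk, X.zeta_mk, map_zero]
    module
  case lap =>
    rw [val_phi_kerVec]
    simp only [map_zero]
    module

namespace ResolventEq

variable {β α : ℝ} {z : ℂ} {u : X} {c : ℂ} {g : L2r}

theorem val_phi_eq (h : ResolventEq β α z u 0 c g) : H1r.val (X.phi u) = c • besselSol z := by
  have hg : g = -(z ^ 2) • H1r.val (X.phi u) := by
    rw [h.lap]
    simp only [map_zero]
    module
  have hbessel : H1r.val (X.phi u) + z ^ 2 • opSol (H1r.val (X.phi u)) = c • L2r.one := by
    have hφ : H1r.val (X.phi u) = c • L2r.one + opSol g := by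
      rw [h.phi, map_add, map_smul, H1r.val_one, val_opSolH1]
    rw [hg, map_smul, neg_smul, ← sub_eq_add_neg, eq_sub_iff_add_eq] at hφ
    exact hφ
  rw [← besselInv_apply_add z (H1r.val (X.phi u)), hbessel, map_smul]
  rfl

theorem lap_eq_smul_besselSol (h : ResolventEq β α z u 0 c g) :
    g = -(z ^ 2 * c) • besselSol z := by
  rw [h.lap, h.val_phi_eq]
  simp only [map_zero]
  module

theorem zeta_eq_smul_besselSol (h : ResolventEq β α z u 0 c g) :
    X.zeta u = (z * c) • besselSol z - (2 * X.eta u) • L2r.one := by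
  rw [h.zeta, h.val_phi_eq]
  simp only [map_zero]
  module

theorem eq_kerVec (h : ResolventEq β α z u 0 c g) : u = kerVec β z c (X.eta u) := by
  refine X.ext rfl ?_ ?_ ?_
  · rw [h.omega, h.lap_eq_smul_besselSol]
    simp only [kerVec, X.omega_mk, map_zero, map_smul, smul_eq_mul]
    ring
  · rw [h.phi, kerVec, X.phi_mk, h.lap_eq_smul_besselSol, map_smul]
    module
  · rw [h.zeta_eq_smul_besselSol, kerVec, X.zeta_mk]

theorem coefBdryC_mul_add (h : ResolventEq β α z u 0 c g) :
    coefBdryC z * c + z * X.eta u = 0 := by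
  have htrace := h.trace
  simp only [h.lap_eq_smul_besselSol, map_smul, map_zero, smul_eq_mul] at htrace
  rw [coefBdryC]
  linear_combination htrace

theorem coefSndC_mul_add (h : ResolventEq β α z u 0 c g) :
    coefSndC z * c + coefSndEta β α z * X.eta u = 0 := by
  have hsnd := h.snd
  rw [h.zeta_eq_smul_besselSol, h.omega, h.lap_eq_smul_besselSol] at hsnd
  simp only [map_smul, map_sub, map_zero, smul_eq_mul, mean_one] at hsnd
  rw [coefSndC, coefSndEta]
  linear_combination hsnd

end ResolventEq

theorem exists_ne_zero_of_det_eq_zero {R : Type*} [CommRing R] [IsDomain R] {a b p q : R}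
    (h : a * q - p * b = 0) :
    ∃ x y : R, ¬ (x = 0 ∧ y = 0) ∧ a * x + p * y = 0 ∧ b * x + q * y = 0 := by
  have hdet : (!![a, p; b, q] : Matrix (Fin 2) (Fin 2) R).det = 0 := by
    rw [Matrix.det_fin_two_of, h]
  obtain ⟨v, hv, hMv⟩ := Matrix.exists_mulVec_eq_zero_iff.2 hdet
  refine ⟨v 0, v 1, fun h0 => hv (funext (Fin.forall_fin_two.2 h0)), ?_, ?_⟩
  · simpa [Matrix.mulVec, dotProduct] using congrFun hMv 0
  · simpa [Matrix.mulVec, dotProduct] using congrFun hMv 1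

section Eigenvectors

variable {β α : ℝ} {z : ℂ}

theorem exists_resolventEq_zero (hβ : β ≠ 0) {u : domK β} (h : opKFun β α u = z • (u : X)) :
    ∃ c g, ResolventEq β α z u 0 c g :=
  exists_resolventEq hβ α z u (by rw [h, sub_self])

theorem eigenvector_eq_zero (hβ : β ≠ 0) (hdet : charDet β α z ≠ 0) {u : domK β}
    (h : opKFun β α u = z • (u : X)) : (u : X) = 0 := by
  obtain ⟨c, g, hcg⟩ := exists_resolventEq_zero hβ h
  have hc : charDet β α z * c = 0 := by
    rw [charDet]
    linear_combination coefSndEta β α z * hcg.coefBdryC_mul_add - z * hcg.coefSndC_mul_add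
  have hη : charDet β α z * X.eta u = 0 := by
    rw [charDet]
    linear_combination coefBdryC z * hcg.coefSndC_mul_add - coefSndC z * hcg.coefBdryC_mul_add
  rw [hcg.eq_kerVec, kerVec_eq_zero_iff]
  exact ⟨(mul_eq_zero.1 hc).resolve_left hdet, (mul_eq_zero.1 hη).resolve_left hdet⟩

theorem exists_eigenvector (hβ : β ≠ 0) (hdet : charDet β α z = 0) :
    ∃ u : domK β, (u : X) ≠ 0 ∧ opKFun β α u = z • (u : X) := by
  obtain ⟨c, η, hne, hbdry, hsnd⟩ := exists_ne_zero_of_det_eq_zero hdet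
  obtain ⟨u, hu, hKu⟩ := (resolventEq_kerVec hbdry hsnd).exists_opKFun_sub_smul_eq hβ
  exact ⟨u, hu ▸ kerVec_eq_zero_iff.not.2 hne, sub_eq_zero.1 hKu⟩

theorem eigenvector_mem_span (hβ : β ≠ 0) {u : domK β} (h : opKFun β α u = z • (u : X)) :
    (u : X) ∈ Submodule.span ℂ {kerVec β z 1 0, kerVec β z 0 1} := by
  obtain ⟨c, g, hcg⟩ := exists_resolventEq_zero hβ h
  exact Submodule.mem_span_pair.2 ⟨c, X.eta u, by rw [← kerVec_eq, ← hcg.eq_kerVec]⟩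

end Eigenvectors

/-! ### The resolvent estimate on the imaginary axis -/

theorem X.norm_sq (u : X) :
    ‖u‖ ^ 2 = ‖X.eta u‖ ^ 2 + (‖X.omega u‖ ^ 2 + (‖X.phi u‖ ^ 2 + ‖X.zeta u‖ ^ 2)) := by
  have h₁ : ‖u‖ ^ 2 = ‖X.eta u‖ ^ 2 + ‖WithLp.snd u‖ ^ 2 := WithLp.prod_norm_sq_eq_of_L2 u
  have h₂ : ‖WithLp.snd u‖ ^ 2 = ‖X.omega u‖ ^ 2 + ‖WithLp.snd (WithLp.snd u)‖ ^ 2 :=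
    WithLp.prod_norm_sq_eq_of_L2 (WithLp.snd u)
  have h₃ : ‖WithLp.snd (WithLp.snd u)‖ ^ 2 = ‖X.phi u‖ ^ 2 + ‖X.zeta u‖ ^ 2 :=
    WithLp.prod_norm_sq_eq_of_L2 (WithLp.snd (WithLp.snd u))
  rw [h₁, h₂, h₃]

theorem X.norm_le (u : X) : ‖u‖ ≤ ‖X.eta u‖ + ‖X.omega u‖ + ‖X.phi u‖ + ‖X.zeta u‖ := by
  have hη := norm_nonneg (X.eta u)
  have hω := norm_nonneg (X.omega u)
  have hφ := norm_nonneg (X.phi u)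
  have hζ := norm_nonneg (X.zeta u)
  refine (sq_le_sq₀ (norm_nonneg u) (by positivity)).1 ?_
  rw [X.norm_sq]
  nlinarith [mul_nonneg hη hω, mul_nonneg hη hφ, mul_nonneg hη hζ, mul_nonneg hω hφ,
    mul_nonneg hω hζ, mul_nonneg hφ hζ]

theorem X.norm_eta_le (u : X) : ‖X.eta u‖ ≤ ‖u‖ := WithLp.norm_fst_le _ u

theorem X.norm_omega_le (u : X) : ‖X.omega u‖ ≤ ‖u‖ :=
  (WithLp.norm_fst_le _ (WithLp.snd u)).trans (WithLp.norm_snd_le _ u)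

theorem X.norm_phi_le (u : X) : ‖X.phi u‖ ≤ ‖u‖ :=
  ((WithLp.norm_fst_le _ (WithLp.snd (WithLp.snd u))).trans
    (WithLp.norm_snd_le _ (WithLp.snd u))).trans (WithLp.norm_snd_le _ u)

theorem X.norm_zeta_le (u : X) : ‖X.zeta u‖ ≤ ‖u‖ :=
  ((WithLp.norm_snd_le _ (WithLp.snd (WithLp.snd u))).trans
    (WithLp.norm_snd_le _ (WithLp.snd u))).trans (WithLp.norm_snd_le _ u)

theorem H1r.norm_val_le (p : H1r) : ‖H1r.val p‖ ≤ ‖p‖ := WithLp.norm_fst_le _ p.1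

theorem H1r.norm_der_le (p : H1r) : ‖H1r.der p‖ ≤ ‖p‖ := WithLp.norm_snd_le _ p.1

theorem norm_powL2_le_one (k : ℕ) : ‖powL2 k‖ ≤ 1 := by
  simpa using norm_powL2_le one_pos (k := k) (by linarith [k.cast_nonneg (α := ℝ)])

theorem norm_mean_le (f : L2r) : ‖mean f‖ ≤ ‖f‖ := by
  rw [← inner_powL2_zero_left]
  exact (norm_inner_le_norm _ _).trans
    (mul_le_of_le_one_left (norm_nonneg f) (norm_powL2_le_one 0))

theorem norm_moment_le (f : L2r) : ‖moment f‖ ≤ ‖f‖ := by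
  rw [← inner_powL2_one_left]
  exact (norm_inner_le_norm _ _).trans
    (mul_le_of_le_one_left (norm_nonneg f) (norm_powL2_le_one 1))

theorem norm_smul_one_le (c : ℂ) : ‖c • L2r.one‖ ≤ ‖c‖ := by
  rw [norm_smul, ← powL2_zero]
  exact mul_le_of_le_one_right (norm_nonneg c) (norm_powL2_le_one 0)

theorem norm_traceOne_le (ψ : H1r) : ‖traceOne ψ‖ ≤ 3 * ‖ψ‖ := by
  rw [traceOne_apply]
  refine (norm_add_le _ _).trans ?_
  rw [norm_mul, Complex.norm_ofNat]
  linarith [norm_moment_le (H1r.der ψ), norm_mean_le (H1r.val ψ), ψ.norm_val_le, ψ.norm_der_le]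

theorem norm_I_mul_ofReal (s : ℝ) : ‖Complex.I * (s : ℂ)‖ = |s| := by
  rw [norm_mul, Complex.norm_I, one_mul, Complex.norm_real, Real.norm_eq_abs]

theorem norm_I_div_ofReal (s : ℝ) : ‖Complex.I / (s : ℂ)‖ = |s|⁻¹ := by
  rw [norm_div, Complex.norm_I, Complex.norm_real, Real.norm_eq_abs, one_div]

section EnergyNorm

/-- The norm on `H¹_r(0,1)` weighted by the frequency `s`, in which the resolvent equation at
`z = i s` is coercive uniformly in `s`. -/
def energyNorm (s : ℝ) (ψ : H1r) : ℝ := √(‖H1r.der ψ‖ ^ 2 + s ^ 2 * ‖H1r.val ψ‖ ^ 2)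

variable (s : ℝ) (ψ : H1r)

theorem energyNorm_nonneg : 0 ≤ energyNorm s ψ := Real.sqrt_nonneg _

theorem energyNorm_sq : energyNorm s ψ ^ 2 = ‖H1r.der ψ‖ ^ 2 + s ^ 2 * ‖H1r.val ψ‖ ^ 2 :=
  Real.sq_sqrt (by positivity)

theorem norm_der_le_energyNorm : ‖H1r.der ψ‖ ≤ energyNorm s ψ :=
  Real.le_sqrt_of_sq_le (le_add_of_nonneg_right (by positivity))

theorem abs_mul_norm_val_le_energyNorm : |s| * ‖H1r.val ψ‖ ≤ energyNorm s ψ :=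
  Real.le_sqrt_of_sq_le (by
    rw [mul_pow, sq_abs]
    exact le_add_of_nonneg_left (sq_nonneg _))

variable {s}

theorem norm_le_energyNorm (hs : 1 ≤ |s|) : ‖ψ‖ ≤ energyNorm s ψ :=
  Real.le_sqrt_of_sq_le (by
    rw [H1r.norm_sq, add_comm, ← sq_abs s]
    exact add_le_add le_rfl (le_mul_of_one_le_left (sq_nonneg _) (one_le_pow₀ hs)))

/-- The power `m = ⌈|s|⌉` balances the two terms of `norm_traceOne_mul_sqrt_le`. -/
theorem abs_mul_norm_traceOne_sq_le (hs : 1 ≤ |s|) :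
    |s| * ‖traceOne ψ‖ ^ 2 ≤ 17 * energyNorm s ψ ^ 2 := by
  set m := ⌈|s|⌉₊
  have hsm : |s| ≤ m + 2 := (Nat.le_ceil |s|).trans (by linarith)
  have hms : (m : ℝ) + 2 ≤ 4 * |s| := by linarith [Nat.ceil_lt_add_one (abs_nonneg s)]
  have htrace : ‖traceOne ψ‖ * √(m + 2) ≤ 4 * (|s| * ‖H1r.val ψ‖) + ‖H1r.der ψ‖ :=
    (norm_traceOne_mul_sqrt_le ψ m).trans (by rw [← mul_assoc]; gcongr)
  calc |s| * ‖traceOne ψ‖ ^ 2 ≤ (m + 2) * ‖traceOne ψ‖ ^ 2 := by gcongr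
    _ = (‖traceOne ψ‖ * √(m + 2)) ^ 2 := by rw [mul_pow, Real.sq_sqrt (by positivity), mul_comm]
    _ ≤ (4 * (|s| * ‖H1r.val ψ‖) + ‖H1r.der ψ‖) ^ 2 := by gcongr
    _ ≤ 17 * energyNorm s ψ ^ 2 := by
        rw [energyNorm_sq, ← sq_abs s]
        nlinarith [sq_nonneg (|s| * ‖H1r.val ψ‖ - 4 * ‖H1r.der ψ‖)]

end EnergyNorm

/-- The difference `φ - (i/s) f₃` of the component `φ` and the leading term of its expansion in
`s⁻¹`; subtracting it removes the terms of order `s` from the equation for `φ`. -/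
def phiCorr (s : ℝ) (u f : X) : H1r := X.phi u - (Complex.I / s) • X.phi f

section Estimate

variable {β α : ℝ} {s : ℝ} {u f : X} {c : ℂ} {g : L2r}

theorem ResolventEq.zeta_eq (hs : s ≠ 0) (h : ResolventEq β α (Complex.I * s) u f c g) :
    X.zeta u = (Complex.I * s) • H1r.val (phiCorr s u f) - (2 * X.eta u) • L2r.one := by
  have hs' : (s : ℂ) ≠ 0 := by exact_mod_cast hs
  have hcoef : Complex.I * s * (Complex.I / s) = -1 := by
    field_simp
    exact Complex.I_sq
  rw [h.zeta, phiCorr, map_sub, map_smul, smul_sub, smul_smul, hcoef]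
  module

theorem ResolventEq.lap_eq (hs : s ≠ 0) (h : ResolventEq β α (Complex.I * s) u f c g) :
    g = ((s : ℂ) ^ 2) • H1r.val (phiCorr s u f) - (X.zeta f + (2 * X.eta f) • L2r.one) := by
  have hs' : (s : ℂ) ≠ 0 := by exact_mod_cast hs
  have hcoef : (s : ℂ) ^ 2 * (Complex.I / s) = Complex.I * s := by field_simp
  have hz : (Complex.I * (s : ℂ)) ^ 2 = -(s : ℂ) ^ 2 := by
    rw [mul_pow, Complex.I_sq, neg_one_mul]
  rw [h.lap, phiCorr, map_sub, map_smul, smul_sub, smul_smul, hcoef, hz]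
  module

theorem ResolventEq.mul_w_eq (hs : s ≠ 0) (h : ResolventEq β α (Complex.I * s) u f c g) :
    ((α : ℂ) - β + β * s ^ 2) * (X.eta f + Complex.I * s * X.eta u) =
      -((s : ℂ) ^ 2 * traceOne (phiCorr s u f)) +
        (Complex.I * s * (X.omega f + 2 * mean (H1r.val (X.phi f)) - traceOne (X.phi f)) +
          ((α : ℂ) - β) * X.eta f) := by
  have hs' : (s : ℂ) ≠ 0 := by exact_mod_cast hs
  have hcoef : (s : ℂ) ^ 2 * (Complex.I / s) = Complex.I * s := by field_simp
  have htrace : (s : ℂ) ^ 2 * traceOne (phiCorr s u f) =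
      (s : ℂ) ^ 2 * traceOne (X.phi u) - Complex.I * s * traceOne (X.phi f) := by
    rw [phiCorr, map_sub, map_smul, smul_eq_mul, mul_sub, ← mul_assoc, hcoef]
  have hsnd := h.snd
  rw [h.zeta, h.omega] at hsnd
  simp only [map_add, map_sub, map_smul, smul_eq_mul, mean_one] at hsnd
  rw [htrace, traceOne_apply (X.phi u), der_phi_of_phi_eq h.phi]
  linear_combination Complex.I * s * hsnd + s ^ 2 * (2 * mean (H1r.val (X.phi u)) + β * X.eta f +
    β * Complex.I * s * X.eta u + moment (opDeriv g)) * Complex.I_sq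

/-- Green's identity tested with `phiCorr s u f` itself. -/
theorem ResolventEq.energyNorm_sq_eq (hs : s ≠ 0) (h : ResolventEq β α (Complex.I * s) u f c g) :
    ((energyNorm s (phiCorr s u f) ^ 2 : ℝ) : ℂ) =
      -(conj (traceOne (phiCorr s u f)) * (X.eta f + Complex.I * s * X.eta u)) +
        ⟪H1r.val (phiCorr s u f), X.zeta f + (2 * X.eta f) • L2r.one⟫_ℂ -
          Complex.I / s * ⟪H1r.der (phiCorr s u f), H1r.der (X.phi f)⟫_ℂ := by
  have green := inner_der_opDeriv (phiCorr s u f) g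
  have hder : opDeriv g = H1r.der (phiCorr s u f) + (Complex.I / s) • H1r.der (X.phi f) := by
    rw [phiCorr, map_sub, map_smul, sub_add_cancel, der_phi_of_phi_eq h.phi]
  rw [hder, h.trace, inner_add_right, inner_smul_right, inner_self_eq_norm_sq_to_K,
    h.lap_eq hs, inner_sub_right, inner_smul_right, inner_self_eq_norm_sq_to_K] at green
  simp only [Complex.coe_algebraMap] at green
  rw [energyNorm_sq]
  push_cast
  linear_combination green

theorem ResolventEq.energyNorm_sq_le (hs : s ≠ 0) (h : ResolventEq β α (Complex.I * s) u f c g) :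
    energyNorm s (phiCorr s u f) ^ 2 ≤
      ‖traceOne (phiCorr s u f)‖ * ‖X.eta f + Complex.I * s * X.eta u‖ +
        4 * energyNorm s (phiCorr s u f) * (‖f‖ / |s|) := by
  set ψ := phiCorr s u f
  have hs_pos : 0 < |s| := abs_pos.2 hs
  have hinhom : ‖X.zeta f + (2 * X.eta f) • L2r.one‖ ≤ 3 * ‖f‖ := by
    have h₂ := norm_smul_one_le (2 * X.eta f)
    rw [norm_mul, Complex.norm_ofNat] at h₂
    linarith [norm_add_le (X.zeta f) ((2 * X.eta f) • L2r.one), f.norm_zeta_le, f.norm_eta_le]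
  have hval : ‖⟪H1r.val ψ, X.zeta f + (2 * X.eta f) • L2r.one⟫_ℂ‖ ≤
      energyNorm s ψ / |s| * (3 * ‖f‖) := by
    refine (norm_inner_le_norm _ _).trans ?_
    refine mul_le_mul ?_ hinhom (norm_nonneg _) (div_nonneg (energyNorm_nonneg s ψ) hs_pos.le)
    rw [le_div_iff₀' hs_pos]
    exact abs_mul_norm_val_le_energyNorm s ψ
  have hder : ‖⟪H1r.der ψ, H1r.der (X.phi f)⟫_ℂ‖ ≤ energyNorm s ψ * ‖f‖ := by
    refine (norm_inner_le_norm _ _).trans ?_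
    gcongr
    exacts [energyNorm_nonneg s ψ, norm_der_le_energyNorm s ψ,
      (X.phi f).norm_der_le.trans f.norm_phi_le]
  have henergy := congrArg norm (h.energyNorm_sq_eq hs)
  rw [Complex.norm_real, Real.norm_of_nonneg (sq_nonneg _)] at henergy
  calc energyNorm s ψ ^ 2
      ≤ ‖traceOne ψ‖ * ‖X.eta f + Complex.I * s * X.eta u‖ +
          energyNorm s ψ / |s| * (3 * ‖f‖) + |s|⁻¹ * (energyNorm s ψ * ‖f‖) := by
        rw [henergy]
        refine (norm_sub_le _ _).trans (add_le_add (norm_add_le_of_le ?_ hval) ?_)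
        · rw [norm_neg, norm_mul, RCLike.norm_conj]
        · rw [norm_mul, norm_I_div_ofReal]
          gcongr
    _ = _ := by ring

theorem half_mul_sq_le (hβ : 0 < β) (hs : 1 ≤ |s|) (hγ : 2 * |α - β| ≤ β * |s|) :
    β / 2 * |s| ^ 2 ≤ α - β + β * |s| ^ 2 := by
  have hs_sq : |s| ≤ |s| ^ 2 := le_self_pow₀ hs two_ne_zero
  nlinarith [neg_abs_le (α - β)]

theorem ResolventEq.norm_w_le (hβ : 0 < β) (hs : 1 ≤ |s|) (hγ : 2 * |α - β| ≤ β * |s|)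
    (h : ResolventEq β α (Complex.I * s) u f c g) :
    ‖X.eta f + Complex.I * s * X.eta u‖ ≤
      (‖traceOne (phiCorr s u f)‖ + (6 + |α - β|) * (‖f‖ / |s|)) / (β / 2) := by
  have hs_pos : 0 < |s| := by linarith
  have hcoef := half_mul_sq_le hβ hs hγ
  have hnorm_coef : ‖(α : ℂ) - β + β * (s : ℂ) ^ 2‖ = α - β + β * |s| ^ 2 := by
    have : (α : ℂ) - β + β * (s : ℂ) ^ 2 = ((α - β + β * |s| ^ 2 : ℝ) : ℂ) := by
      rw [sq_abs]; push_cast; ring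
    rw [this, Complex.norm_real, Real.norm_of_nonneg (le_trans (by positivity) hcoef)]
  have hnorm_sub : ‖(α : ℂ) - β‖ = |α - β| := by
    rw [← Complex.ofReal_sub, Complex.norm_real, Real.norm_eq_abs]
  have hdata : ‖X.omega f + 2 * mean (H1r.val (X.phi f)) - traceOne (X.phi f)‖ ≤ 6 * ‖f‖ := by
    refine (norm_sub_le _ _).trans ?_
    have hadd := norm_add_le (X.omega f) (2 * mean (H1r.val (X.phi f)))
    rw [norm_mul, Complex.norm_ofNat] at hadd
    linarith [norm_mean_le (H1r.val (X.phi f)), (X.phi f).norm_val_le, norm_traceOne_le (X.phi f),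
      f.norm_omega_le, f.norm_phi_le]
  have hη : ‖X.eta f‖ ≤ |s| * ‖f‖ :=
    f.norm_eta_le.trans (le_mul_of_one_le_left (norm_nonneg f) hs)
  rw [le_div_iff₀' (by positivity)]
  refine le_of_mul_le_mul_left ?_ (pow_pos hs_pos 2)
  calc |s| ^ 2 * (β / 2 * ‖X.eta f + Complex.I * s * X.eta u‖)
      = β / 2 * |s| ^ 2 * ‖X.eta f + Complex.I * s * X.eta u‖ := by ring
    _ ≤ ‖((α : ℂ) - β + β * s ^ 2) * (X.eta f + Complex.I * s * X.eta u)‖ := by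
        rw [norm_mul, hnorm_coef]
        gcongr
    _ ≤ |s| ^ 2 * ‖traceOne (phiCorr s u f)‖ + (|s| * (6 * ‖f‖) + |α - β| * (|s| * ‖f‖)) := by
        rw [h.mul_w_eq (abs_pos.1 hs_pos)]
        refine norm_add_le_of_le ?_ (norm_add_le_of_le ?_ ?_)
        · rw [norm_neg, norm_mul, norm_pow, Complex.norm_real, Real.norm_eq_abs]
        · rw [norm_mul, norm_I_mul_ofReal]
          gcongr
        · rw [norm_mul, hnorm_sub]
          gcongr
    _ = |s| ^ 2 * (‖traceOne (phiCorr s u f)‖ + (6 + |α - β|) * (‖f‖ / |s|)) := by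
        field_simp

/-- The trace term `T W ≲ T² / B` is absorbed into the left-hand side, since `T` is small
compared with `N`. -/
theorem le_of_energy_inequality {B N T W F κ : ℝ} (hB : 0 < B) (hN : 0 ≤ N) (hT : 0 ≤ T)
    (hF : 0 ≤ F) (hκ : 0 ≤ κ) (hTN : T ≤ N) (hTB : 2 * T ^ 2 ≤ B * N ^ 2)
    (hW : W ≤ (T + κ * F) / B) (hE : N ^ 2 ≤ T * W + 4 * N * F) :
    N ≤ (2 * κ / B + 8) * F := by
  have hTT : T ^ 2 / B ≤ N ^ 2 / 2 := by
    rw [div_le_div_iff₀ hB two_pos]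
    linarith
  have hTW : T * W ≤ N ^ 2 / 2 + N * (κ * F / B) :=
    calc T * W ≤ T * ((T + κ * F) / B) := by gcongr
      _ = T ^ 2 / B + T * (κ * F / B) := by ring
      _ ≤ _ := by gcongr
  have hNN : N * N ≤ N * ((2 * κ / B + 8) * F) := by
    have : N * ((2 * κ / B + 8) * F) = 2 * (N * (κ * F / B)) + 8 * N * F := by ring
    linarith
  rcases hN.eq_or_lt with rfl | hN
  · positivity
  · exact le_of_mul_le_mul_left hNN hN

theorem norm_traceOne_le_energyNorm (hs : 17 ≤ |s|) (ψ : H1r) :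
    ‖traceOne ψ‖ ≤ energyNorm s ψ := by
  refine (sq_le_sq₀ (norm_nonneg _) (energyNorm_nonneg s ψ)).1 ?_
  nlinarith [abs_mul_norm_traceOne_sq_le ψ (by linarith : 1 ≤ |s|), sq_nonneg ‖traceOne ψ‖]

theorem ResolventEq.energyNorm_phiCorr_le (hβ : 0 < β) (hs : 17 ≤ |s|) (hβs : 68 ≤ β * |s|)
    (hγ : 2 * |α - β| ≤ β * |s|) (h : ResolventEq β α (Complex.I * s) u f c g) :
    energyNorm s (phiCorr s u f) ≤ (2 * (6 + |α - β|) / (β / 2) + 8) * (‖f‖ / |s|) := by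
  have hs_one : 1 ≤ |s| := by linarith
  set ψ := phiCorr s u f
  have hsmall : 2 * ‖traceOne ψ‖ ^ 2 ≤ β / 2 * energyNorm s ψ ^ 2 := by
    have htrace := mul_le_mul_of_nonneg_left (abs_mul_norm_traceOne_sq_le ψ hs_one) hβ.le
    nlinarith [sq_nonneg ‖traceOne ψ‖]
  exact le_of_energy_inequality (by positivity) (energyNorm_nonneg s ψ) (norm_nonneg _)
    (by positivity) (by positivity) (norm_traceOne_le_energyNorm hs ψ) hsmall
    (h.norm_w_le hβ hs_one hγ) (h.energyNorm_sq_le (abs_pos.1 (by linarith)))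

theorem abs_mul_norm_eta_le (s : ℝ) (u f : X) :
    |s| * ‖X.eta u‖ ≤ ‖X.eta f + Complex.I * s * X.eta u‖ + ‖f‖ := by
  have hη : Complex.I * s * X.eta u = (X.eta f + Complex.I * s * X.eta u) - X.eta f := by ring
  rw [← norm_I_mul_ofReal, ← norm_mul, hη]
  exact (norm_sub_le _ _).trans (add_le_add (by rw [← hη]) f.norm_eta_le)

theorem ResolventEq.norm_zeta_le (hs : s ≠ 0) (h : ResolventEq β α (Complex.I * s) u f c g) :
    ‖X.zeta u‖ ≤ energyNorm s (phiCorr s u f) + 2 * ‖X.eta u‖ := by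
  rw [h.zeta_eq hs]
  refine (norm_sub_le _ _).trans (add_le_add ?_ ((norm_smul_one_le _).trans_eq ?_))
  · rw [norm_smul, norm_I_mul_ofReal]
    exact abs_mul_norm_val_le_energyNorm s _
  · rw [norm_mul, Complex.norm_ofNat]

theorem ResolventEq.abs_mul_norm_omega_le (h : ResolventEq β α (Complex.I * s) u f c g) :
    |s| * ‖X.omega u‖ ≤ 2 * ‖X.zeta u‖ + 2 * ‖X.eta u‖ + |α - β| * ‖X.eta u‖ + ‖f‖ := by
  have hω : Complex.I * s * X.omega u = -2 * mean (X.zeta u) - 2 * X.eta u +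
      ((α : ℂ) - β) * X.eta u - X.omega f := by linear_combination -h.snd
  rw [← norm_I_mul_ofReal, ← norm_mul, hω]
  refine (norm_sub_le _ _).trans (add_le_add (norm_add_le_of_le
    ((norm_sub_le _ _).trans (add_le_add ?_ ?_)) ?_) f.norm_omega_le)
  · rw [norm_mul, norm_neg, Complex.norm_ofNat]
    exact mul_le_mul_of_nonneg_left (norm_mean_le _) zero_le_two
  · rw [norm_mul, Complex.norm_ofNat]
  · rw [norm_mul, ← Complex.ofReal_sub, Complex.norm_real, Real.norm_eq_abs]

theorem norm_phi_le_energyNorm_add (hs : 1 ≤ |s|) (u f : X) :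
    ‖X.phi u‖ ≤ energyNorm s (phiCorr s u f) + ‖f‖ / |s| := by
  have hφ : X.phi u = phiCorr s u f + (Complex.I / s) • X.phi f := by
    rw [phiCorr, sub_add_cancel]
  rw [hφ]
  refine norm_add_le_of_le (norm_le_energyNorm _ hs) ?_
  rw [norm_smul, norm_I_div_ofReal, div_eq_inv_mul]
  gcongr
  exact f.norm_phi_le

theorem ResolventEq.norm_le (hs : 1 ≤ |s|) (h : ResolventEq β α (Complex.I * s) u f c g)
    {C₁ C₂ : ℝ} (hC₁ : 0 ≤ C₁) (hC₂ : 0 ≤ C₂)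
    (hN : energyNorm s (phiCorr s u f) ≤ C₁ * (‖f‖ / |s|))
    (hw : ‖X.eta f + Complex.I * s * X.eta u‖ + ‖f‖ ≤ C₂ * ‖f‖) :
    ‖u‖ ≤ (C₂ + (2 * (C₁ + 2 * C₂) + (2 + |α - β|) * C₂ + 1) + (C₁ + 1) + (C₁ + 2 * C₂)) *
      (‖f‖ / |s|) := by
  have hs_pos : 0 < |s| := by linarith
  have hdiv : ‖f‖ / |s| ≤ ‖f‖ := div_le_self (norm_nonneg f) hs
  have hη : ‖X.eta u‖ ≤ C₂ * (‖f‖ / |s|) := by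
    rw [← mul_div_assoc, le_div_iff₀' hs_pos]
    exact (abs_mul_norm_eta_le s u f).trans hw
  have hζ : ‖X.zeta u‖ ≤ (C₁ + 2 * C₂) * (‖f‖ / |s|) := by
    linarith [h.norm_zeta_le (abs_pos.1 hs_pos)]
  have hω : ‖X.omega u‖ ≤ (2 * (C₁ + 2 * C₂) + (2 + |α - β|) * C₂ + 1) * (‖f‖ / |s|) := by
    have hζ' : ‖X.zeta u‖ ≤ (C₁ + 2 * C₂) * ‖f‖ := hζ.trans (by gcongr)
    have hη' : ‖X.eta u‖ ≤ C₂ * ‖f‖ := hη.trans (by gcongr)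
    rw [← mul_div_assoc, le_div_iff₀' hs_pos]
    refine h.abs_mul_norm_omega_le.trans ?_
    nlinarith [abs_nonneg (α - β)]
  linarith [X.norm_le u, norm_phi_le_energyNorm_add hs u f]

end Estimate

theorem exists_resolvent_bound {β : ℝ} (hβ : 0 < β) (α : ℝ) :
    ∃ C > (0 : ℝ), ∃ s₀ > (0 : ℝ), ∀ s : ℝ, s₀ < |s| → ∀ u : domK β,
      ‖(u : X)‖ ≤ C / |s| * ‖opKFun β α u - (Complex.I * s) • (u : X)‖ := by
  set κ := 6 + |α - β|
  set C₁ := 2 * κ / (β / 2) + 8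
  set C₂ := 1 + (C₁ + κ) / (β / 2) with hC₂
  refine ⟨C₂ + (2 * (C₁ + 2 * C₂) + (2 + |α - β|) * C₂ + 1) + (C₁ + 1) + (C₁ + 2 * C₂),
    by positivity, 17 + 68 / β + 2 * |α - β| / β, by positivity, fun s hs u => ?_⟩
  obtain ⟨f, hf⟩ : ∃ f, opKFun β α u - (Complex.I * s) • (u : X) = f := ⟨_, rfl⟩
  obtain ⟨c, g, h⟩ := exists_resolventEq hβ.ne' α (Complex.I * s) u hf
  have hβ_pos : 0 ≤ 68 / β := by positivity
  have hγ_pos : 0 ≤ 2 * |α - β| / β := by positivity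
  have hs₁₇ : 17 ≤ |s| := by linarith
  have hs_one : 1 ≤ |s| := by linarith
  have hβs : 68 ≤ β * |s| := (div_le_iff₀' hβ).1 (by linarith)
  have hγ : 2 * |α - β| ≤ β * |s| := (div_le_iff₀' hβ).1 (by linarith)
  have hN := h.energyNorm_phiCorr_le hβ hs₁₇ hβs hγ
  rw [hf, div_mul_eq_mul_div, mul_div_assoc]
  refine h.norm_le hs_one (by positivity) (by positivity) hN ?_
  have hdiv : ‖f‖ / |s| ≤ ‖f‖ := div_le_self (norm_nonneg f) hs_one
  have htrace : ‖traceOne (phiCorr s u f)‖ ≤ C₁ * ‖f‖ :=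
    (norm_traceOne_le_energyNorm hs₁₇ _).trans (hN.trans (by gcongr))
  calc ‖X.eta f + Complex.I * s * X.eta u‖ + ‖f‖
      ≤ (C₁ * ‖f‖ + κ * ‖f‖) / (β / 2) + ‖f‖ := by
        refine add_le_add_left ((h.norm_w_le hβ hs_one hγ).trans ?_) _
        gcongr
    _ = C₂ * ‖f‖ := by rw [hC₂]; ring

/-! ### The spectrum of `L` -/

theorem exists_charDet_ne_zero {β : ℝ} (hβ : 0 < β) (α : ℝ) :
    ∃ s₀ > (0 : ℝ), ∀ s : ℝ, s₀ < |s| → charDet β α (Complex.I * s) ≠ 0 := by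
  obtain ⟨C, -, s₀, hs₀, hbound⟩ := exists_resolvent_bound hβ α
  refine ⟨s₀, hs₀, fun s hs hdet => ?_⟩
  obtain ⟨u, hne, hu⟩ := exists_eigenvector hβ.ne' hdet
  have hnorm := hbound s hs u
  rw [hu, sub_self, norm_zero, mul_zero] at hnorm
  exact hne (norm_le_zero_iff.1 hnorm)

theorem isResolventQuotient_opK {β : ℝ} (hβ : 0 < β) (α : ℝ) :
    IsResolventQuotient (opK β α) (charDet β α) (adjResolvent β α) where
  differentiable := differentiable_charDet β α
  exists_ne_zero := by
    obtain ⟨s₀, hs₀, hdet⟩ := exists_charDet_ne_zero hβ α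
    exact ⟨_, hdet (s₀ + 1) (by rw [abs_of_pos (by linarith)]; linarith)⟩
  continuous_apply := continuous_adjResolvent_apply β α
  solves z f := (resolventEq_adjResolvent β α z f).exists_opKFun_sub_smul_eq hβ.ne'
  injective _ hz _ hu := eigenvector_eq_zero hβ.ne' hz hu
  isEigenvalue _ hz := exists_eigenvector hβ.ne' hz
  fg_ker z := ⟨_, Submodule.fg_span (Set.toFinite {kerVec β z 1 0, kerVec β z 0 1}),
    fun _ hu => eigenvector_mem_span hβ.ne' hu⟩

theorem exists_opK_resolvent_bound {β : ℝ} (hβ : 0 < β) (α : ℝ) :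
    ∃ C > (0 : ℝ), ∃ s₀ > (0 : ℝ), ∀ s : ℝ, s₀ < |s| →
      ∃ R : X →L[ℂ] X, IsResolvent (opK β α) (Complex.I * s) R ∧ ‖R‖ ≤ C / |s| := by
  obtain ⟨C, hC, s₀, hs₀, hbound⟩ := exists_resolvent_bound hβ α
  obtain ⟨s₁, -, hdet⟩ := exists_charDet_ne_zero hβ α
  refine ⟨C, hC, max s₀ s₁, lt_max_of_lt_left hs₀, fun s hs => ?_⟩
  have hR := (isResolventQuotient_opK hβ α).isResolvent (hdet s ((le_max_right _ _).trans_lt hs))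
  refine ⟨_, hR, ContinuousLinearMap.opNorm_le_bound _ (by positivity) fun f => ?_⟩
  obtain ⟨u, hu, hf⟩ := hR.2 f
  rw [← hu, ← hf]
  exact hbound s ((le_max_left _ _).trans_lt hs) u

section Conjugation

variable {β : ℝ} (hβ : 0 < β)

theorem continuous_dG : Continuous (dG β hβ) :=
  (mkL etaL (momentL ∘L derL ∘L phiL)
    (phiL + ((β : ℂ)⁻¹ • (omegaL - momentL ∘L derL ∘L phiL)).smulRight H1r.halfSq) zetaL).continuous

theorem continuous_dG_symm : Continuous (dG β hβ).symm :=
  (mkL etaL (omegaL + (β : ℂ) • (4 : ℂ) • (momentL ∘L derL ∘L phiL - omegaL))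
    (phiL - ((4 : ℂ) • (momentL ∘L derL ∘L phiL - omegaL)).smulRight H1r.halfSq) zetaL).continuous

/-- `dG` as an isomorphism of topological vector spaces. -/
def dGEquiv : X ≃L[ℂ] X :=
  { dG β hβ with
    continuous_toFun := continuous_dG hβ
    continuous_invFun := continuous_dG_symm hβ }

theorem dGEquiv_apply (u : X) : dGEquiv hβ u = dG β hβ u := rfl

theorem mem_domain_opL_iff {α : ℝ} {u : X} :
    u ∈ (opL β α hβ).domain ↔ (dG β hβ).symm u ∈ domK β := Iff.rfl

theorem opL_apply {α : ℝ} (u : (opL β α hβ).domain) :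
    opL β α hβ u = dG β hβ (opKFun β α ⟨(dG β hβ).symm u, u.2⟩) := rfl

theorem isSimilarVia_opK_opL (α : ℝ) :
    IsSimilarVia (dGEquiv hβ) (opK β α) (opL β α hβ) where
  mem_domain_iff u := by
    rw [dGEquiv_apply, mem_domain_opL_iff, LinearEquiv.symm_apply_apply]
    rfl
  map_eq u v hv := by
    have hsymm : (⟨(dG β hβ).symm v, v.2⟩ : domK β) = u :=
      Subtype.ext ((LinearEquiv.symm_apply_eq _).2 hv)
    rw [dGEquiv_apply, opL_apply, hsymm]
    rfl

theorem isResolventQuotient_opL (α : ℝ) :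
    IsResolventQuotient (opL β α hβ) (charDet β α) fun z =>
      (dGEquiv hβ : X →L[ℂ] X) ∘L adjResolvent β α z ∘L ((dGEquiv hβ).symm : X →L[ℂ] X) :=
  (isResolventQuotient_opK hβ α).of_isSimilarVia (isSimilarVia_opK_opL hβ α)

theorem finite_spectrumOf_opL_inter_re_eq_zero (α : ℝ) :
    (spectrumOf (opL β α hβ) ∩ {z : ℂ | z.re = 0}).Finite := by
  have hL := isResolventQuotient_opL hβ α
  obtain ⟨s₀, -, hdet⟩ := exists_charDet_ne_zero hβ α
  refine (hL.finite_spectrumOf_inter (isCompact_closedBall (0 : ℂ) s₀)).subset ?_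
  rintro z ⟨hz, hre : z.re = 0⟩
  have hzI : z = Complex.I * (z.im : ℂ) := by
    apply Complex.ext <;> simp [hre]
  refine ⟨hz, ?_⟩
  rw [mem_closedBall_zero_iff, hzI, norm_I_mul_ofReal]
  by_contra! hlt
  exact hdet z.im hlt (hzI ▸ (hL.mem_spectrumOf_iff z).1 hz)

theorem exists_opL_resolvent_bound (α : ℝ) :
    ∃ C > (0 : ℝ), ∃ s₀ > (0 : ℝ), ∀ s : ℝ, s₀ < |s| →
      ∃ R : X →L[ℂ] X, IsResolvent (opL β α hβ) (Complex.I * s) R ∧ ‖R‖ ≤ C / |s| := by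
  obtain ⟨C, hC, s₀, hs₀, hK⟩ := exists_opK_resolvent_bound hβ α
  let e : X →L[ℂ] X := dGEquiv hβ
  let e' : X →L[ℂ] X := (dGEquiv hβ).symm
  refine ⟨(‖e‖ + 1) * (C * (‖e'‖ + 1)), by positivity, s₀, hs₀, fun s hs => ?_⟩
  obtain ⟨R, hR, hnorm⟩ := hK s hs
  refine ⟨e ∘L R ∘L e', (isSimilarVia_opK_opL hβ α).isResolvent hR, ?_⟩
  calc ‖e ∘L R ∘L e'‖ ≤ ‖e‖ * (‖R‖ * ‖e'‖) :=
        (e.opNorm_comp_le _).trans (by gcongr; exact R.opNorm_comp_le e')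
    _ ≤ (‖e‖ + 1) * (C / |s| * (‖e'‖ + 1)) := by gcongr <;> linarith
    _ = (‖e‖ + 1) * (C * (‖e'‖ + 1)) / |s| := by ring

end Conjugation

end FerroJet

end

theorem mainTheorem5 (β₀ α₀ : ℝ) (hβ : 0 < β₀) :
    -- (i) the spectrum consists of isolated eigenvalues of finite algebraic multiplicity
    (∀ z ∈ FerroJet.spectrumOf (FerroJet.opL β₀ α₀ hβ),
      FerroJet.IsEigenvalue (FerroJet.opL β₀ α₀ hβ) z ∧
      (∃ ε > 0, ∀ z' ∈ FerroJet.spectrumOf (FerroJet.opL β₀ α₀ hβ), z' ≠ z → ε ≤ dist z' z) ∧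
      FiniteDimensional ℂ (FerroJet.genEigenspace (FerroJet.opL β₀ α₀ hβ) z)) ∧
    (∀ z : ℂ, FerroJet.IsEigenvalue (FerroJet.opL β₀ α₀ hβ) z ↔
      z * FerroJet.besselJ 0 z =
        (((α₀ - β₀ : ℝ) : ℂ) - (β₀ : ℂ) * z ^ 2) * FerroJet.besselJ 1 z) ∧
    FerroJet.IsEigenvalue (FerroJet.opL β₀ α₀ hβ) 0 ∧
    (FerroJet.spectrumOf (FerroJet.opL β₀ α₀ hβ) ∩ {z : ℂ | z.re = 0}).Finite ∧
    -- (ii) the resolvent estimate on the imaginary axis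
    ∃ C > (0 : ℝ), ∃ s₀ > (0 : ℝ), ∀ s : ℝ, s₀ < |s| →
      ∃ R : FerroJet.X →L[ℂ] FerroJet.X,
        FerroJet.IsResolvent (FerroJet.opL β₀ α₀ hβ) (Complex.I * s) R ∧ ‖R‖ ≤ C / |s| := by
  have hL := FerroJet.isResolventQuotient_opL hβ α₀
  refine ⟨fun z hz => ⟨?_, hL.exists_le_dist z, hL.finiteDimensional_genEigenspace z⟩,
    fun z => ?_, ?_, FerroJet.finite_spectrumOf_opL_inter_re_eq_zero hβ α₀,
    FerroJet.exists_opL_resolvent_bound hβ α₀⟩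
  · exact (hL.isEigenvalue_iff z).2 ((hL.mem_spectrumOf_iff z).1 hz)
  · rw [hL.isEigenvalue_iff, FerroJet.charDet_eq_zero_iff]
  · rw [hL.isEigenvalue_iff, FerroJet.charDet_eq, zero_mul]
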